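/- **Theorem 1.3 (Approximation of maps in $(\mathcal A\cap SBV_\infty)\cup\mathcal A^\parallel$).** Let $\Omega\subset\mathbb R^2$ be a bounded domain (non-empty, open, connected) with Lipschitz boundary that is $x_1$-connected, i.e. for every $t\in\mathbb R$ the slice $\{x_2=t\}\cap\Omega$ is a (possibly empty) interval. Put $a_\Omega=\inf_{x\in\Omega}x_2$, $b_\Omega=\sup_{x\in\Omega}x_2$. Let $\lambda\in(0,1)$ and let $Y_{\rm rig}=[0,1)\times[\lambda,1)$ be extended to $\mathbb R^2$ by $\mathbb Z^2$-periodicity. For $\varepsilon>0$ let $$\mathcal A_\varepsilon=\{u\in W^{1,1}(\Omega;\mathbb R^2):\ \det\nabla u=1 \text{ and } |\nabla u\,e_1|=1 \text{ a.e. in }\Omega,\ \nabla u\in SO(2)\text{ a.e. in }\varepsilon Y_{\rm rig}\cap\Omega\}.$$ For $u\in BV(\Omega;\mathbb R^2)$ let $\nabla u$ denote the density of the absolutely continuous part of $Du$, $D^cu$ the Cantor part of $Du$, and $J_u$ the jump set of $u$. Let $$\mathcal A=\{u\in BV(\Omega;\mathbb R^2):\ u(x)=R(x_2)x+\psi(x_2)\text{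 for a.e. }x\in\Omega\text{ with }R\in BV(a_\Omega,b_\Omega;SO(2)),\ \psi\in BV(a_\Omega,b_\Omega;\mathbb R^2),\text{ and }\det\nabla u=1\text{ a.e. in }\Omega\},$$ $$SBV_\infty(\Omega;\mathbb R^2)=\{u\in BV(\Omega;\mathbb R^2):\ D^cu=0,\ \nabla u\in L^\infty(\Omega;\mathbb R^{2\times2}),\ \mathcal H^1(J_u)<\infty\},$$ $$\mathcal A^\parallel=\{u\in BV(\Omega;\mathbb R^2):\ u(x)=Rx+\vartheta(x_2)Re_1+c\text{ for a.e. }x\in\Omega\text{ with }R\in SO(2),\ \vartheta\in BV(a_\Omega,b_\Omega),\ c\in\mathbb R^2\}.$$ Then for every $u\in(\mathcal A\cap SBV_\infty(\Omega;\mathbb R^2))\cup\mathcal A^\parallel$ there is a family $(u_\varepsilon)_{\varepsilon>0}\subset W^{1,1}(\Omega;\mathbb R^2)$ with $u_\varepsilon\in\mathcal A_\varepsilon$ for every $\varepsilon>0$ and $u_\varepsilon\overset{*}{\rightharpoonup}u$ in $BV(\Omega;\mathbb R^2)$ as $\varepsilon\to0$; that is, $u_\varepsilon\to u$ in $L^1(\Omega;\mathbb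 R^2)$ and $\int_\Omega\varphi\,dDu_\varepsilon\to\int_\Omega\varphi\,dDu$ for every $\varphi\in C_0(\Omega)$. -/

import Mathlib

open MeasureTheory Set Filter Topology
open scoped ContDiff MeasureTheory Matrix

noncomputable section

namespace LayeredBV

/-- The Euclidean plane; the coordinates `x₁, x₂` of a point `x` are `x 0, x 1`. -/
abbrev Plane : Type := EuclideanSpace ℝ (Fin 2)

/-- Real `2 × 2` matrices. -/
abbrev Mat2 : Type := Matrix (Fin 2) (Fin 2) ℝ

/-- The standard unit vectors `e₁, e₂` of the plane, indexed by `0, 1`. -/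
abbrev unitVec (j : Fin 2) : Plane := EuclideanSpace.single j (1 : ℝ)

/-- The product of a matrix and a vector of the plane. -/
def matVec (F : Mat2) (x : Plane) : Plane := WithLp.toLp 2 (F *ᵥ x.ofLp)

/-- The rotations: real `2 × 2` matrices with `R Rᵀ = 1` and `det R = 1`. -/
def SO2 : Set Mat2 := {R | R ∈ Matrix.specialOrthogonalGroup (Fin 2) ℝ}

/-- The set `{F : det F = 1, |F e₁| = 1}`. -/
def slipMatrices : Set Mat2 := {F | F.det = 1 ∧ ‖matVec F (unitVec 0)‖ = 1}

/-! ### Geometry of the domain -/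

/-- Every horizontal slice is a (possibly empty) interval. -/
def IsX1Connected (Ω : Set Plane) : Prop :=
  ∀ t : ℝ, {s : ℝ | !₂[s, t] ∈ Ω}.OrdConnected

/-- Lipschitz boundary: near each boundary point the set is, in suitable orthonormal coordinates,
the region strictly above the graph of a Lipschitz function. -/
def HasLipschitzBoundary (Ω : Set Plane) : Prop :=
  ∀ p ∈ frontier Ω, ∃ r > (0 : ℝ), ∃ T : Plane ≃ₗᵢ[ℝ] Plane, ∃ g : ℝ → ℝ,
    (∃ K, LipschitzWith K g) ∧ ∀ x ∈ Metric.ball p r, (x ∈ Ω ↔ g (T x 0) < T x 1)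

/-- `a_Ω`, the infimum of `x₂` over the domain. -/
def lowerHeight (Ω : Set Plane) : ℝ := sInf ((fun x : Plane => x 1) '' Ω)

/-- `b_Ω`, the supremum of `x₂` over the domain. -/
def upperHeight (Ω : Set Plane) : ℝ := sSup ((fun x : Plane => x 1) '' Ω)

/-- The open interval `(a_Ω, b_Ω)`. -/
def heightInterval (Ω : Set Plane) : Set ℝ := Ioo (lowerHeight Ω) (upperHeight Ω)

/-- The rigid layers `ε Y_rig`, where `Y_rig = [0,1) × [lam, 1)` is extended periodically to the
plane: the points for which the fractional part of `x₂ / ε` is at least `lam`. -/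
def rigidLayers (lam ε : ℝ) : Set Plane := {x | lam ≤ Int.fract (x 1 / ε)}

/-! ### Functions of bounded variation -/

section General

variable {E : Type*} [NormedAddCommGroup E] [NormedSpace ℝ E] [MeasureSpace E]

/-- Test functions: smooth, with compact support contained in `Ω`. -/
def IsTestFunction (Ω : Set E) (φ : E → ℝ) : Prop :=
  ContDiff ℝ ∞ φ ∧ HasCompactSupport φ ∧ tsupport φ ⊆ Ω

/-- `C₀(Ω)` for an open set `Ω`: the continuous functions that vanish on the boundary (and at
infinity), extended by zero outside of `Ω`. -/
def IsC0 (Ω : Set E) (φ : E → ℝ) : Prop :=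
  Continuous φ ∧ (∀ x, x ∉ Ω → φ x = 0) ∧ Tendsto φ (cocompact E) (𝓝 0)

/-- The finite signed measure `μ`, carried by `Ω`, is the distributional derivative of the scalar
function `f` on `Ω` in direction `v`. -/
def IsDistribDeriv (Ω : Set E) (f : E → ℝ) (v : E) (μ : SignedMeasure E) : Prop :=
  (∀ B, MeasurableSet B → Disjoint B Ω → μ B = 0) ∧
  ∀ φ : E → ℝ, IsTestFunction Ω φ →
    ∫ x in Ω, f x * fderiv ℝ φ x v = - ∫ᵛ x, φ x ∂•μ

/-- The function `g` is the weak derivative on `Ω` of `f` in direction `v`, and `g ∈ L¹(Ω)`. -/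
def IsWeakDerivL1 (Ω : Set E) (f : E → ℝ) (v : E) (g : E → ℝ) : Prop :=
  IntegrableOn g Ω ∧
  ∀ φ : E → ℝ, IsTestFunction Ω φ →
    ∫ x in Ω, f x * fderiv ℝ φ x v = - ∫ x in Ω, g x * φ x

end General

/-- Scalar functions of bounded variation on an open subset `I` of the real line. -/
def IsBV1 (I : Set ℝ) (f : ℝ → ℝ) : Prop :=
  IntegrableOn f I ∧ ∃ μ : SignedMeasure ℝ, IsDistribDeriv I f 1 μ

/-- `u ∈ BV(Ω; ℝ²)`, with matrix-valued derivative measure `D u = Du`: the entry `Du i j` is the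
derivative of the component `u_i` in direction `e_j`. For open `Ω`, `Du` is uniquely determined. -/
def IsBVWithDeriv (Ω : Set Plane) (u : Plane → Plane)
    (Du : Fin 2 → Fin 2 → SignedMeasure Plane) : Prop :=
  IntegrableOn u Ω ∧ ∀ i j, IsDistribDeriv Ω (fun x => u x i) (unitVec j) (Du i j)

/-- `u ∈ W^{1,1}(Ω; ℝ²)`, with weak gradient `∇u = G`. -/
def IsW11WithGrad (Ω : Set Plane) (u : Plane → Plane) (G : Plane → Mat2) : Prop :=
  IntegrableOn u Ω ∧ ∀ i j, IsWeakDerivL1 Ω (fun x => u x i) (unitVec j) (fun x => G x i j)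

/-- `∇u`, the density of the absolutely continuous part of `Du` with respect to Lebesgue measure. -/
def gradDensity (Du : Fin 2 → Fin 2 → SignedMeasure Plane) (x : Plane) : Mat2 :=
  Matrix.of fun i j => (Du i j).rnDeriv volume x

/-- Weak* convergence in `BV(Ω; ℝ²)`: convergence in `L¹`, and weak* convergence of the derivatives
as finite matrix-valued Radon measures in duality with `C₀(Ω)`. -/
def WeakStarTendstoBV {ι : Type*} (Ω : Set Plane) (v : ι → Plane → Plane) (l : Filter ι)
    (u : Plane → Plane) : Prop :=
  ∃ (Dv : ι → Fin 2 → Fin 2 → SignedMeasure Plane) (Du : Fin 2 → Fin 2 → SignedMeasure Plane),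
    (∀ᶠ k in l, IsBVWithDeriv Ω (v k) (Dv k)) ∧ IsBVWithDeriv Ω u Du ∧
    Tendsto (fun k => eLpNorm (fun x => v k x - u x) 1 (volume.restrict Ω)) l (𝓝 0) ∧
    ∀ φ : Plane → ℝ, IsC0 Ω φ → ∀ i j,
      Tendsto (fun k => ∫ᵛ x, φ x ∂•(Dv k i j)) l (𝓝 (∫ᵛ x, φ x ∂•(Du i j)))

/-! ### Special functions of bounded variation -/

/-- `u` has an approximate limit at `x`. -/
def HasApproxLimit (u : Plane → Plane) (x : Plane) : Prop :=
  ∃ z : Plane, Tendsto (fun r : ℝ => ⨍ y in Metric.ball x r, ‖u y - z‖) (𝓝[>] 0) (𝓝 0)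

/-- The approximate discontinuity set `S_u` of a function on `Ω`. -/
def approxDiscSet (Ω : Set Plane) (u : Plane → Plane) : Set Plane :=
  {x ∈ Ω | ¬ HasApproxLimit u x}

/-- The open half ball around `x` of radius `r` on the side to which `ν` points. -/
def halfBall (x ν : Plane) (r : ℝ) : Set Plane :=
  {y ∈ Metric.ball x r | 0 < inner ℝ (y - x) ν}

/-- The jump set `J_u`: the points with two different approximate one-sided limits `p`, `q` with
respect to some direction `ν`. -/
def jumpSet (Ω : Set Plane) (u : Plane → Plane) : Set Plane :=
  {x ∈ Ω | ∃ p q ν : Plane, p ≠ q ∧ ‖ν‖ = 1 ∧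
    Tendsto (fun r : ℝ => ⨍ y in halfBall x ν r, ‖u y - p‖) (𝓝[>] 0) (𝓝 0) ∧
    Tendsto (fun r : ℝ => ⨍ y in halfBall x (-ν) r, ‖u y - q‖) (𝓝[>] 0) (𝓝 0)}

/-- The Cantor part `D^c u` vanishes. It is the restriction of the singular part of `Du`
to the complement of `S_u` in `Ω`. -/
def CantorPartZero (Ω : Set Plane) (u : Plane → Plane)
    (Du : Fin 2 → Fin 2 → SignedMeasure Plane) : Prop :=
  ∀ i j, ∀ B : Set Plane, MeasurableSet B → B ⊆ Ω \ approxDiscSet Ω u →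
    (Du i j).singularPart volume B = 0

/-- `SBV_∞(Ω; ℝ²)`: functions in `SBV` with bounded `∇u` and with a jump set of finite length. -/
def SBVInfty (Ω : Set Plane) : Set (Plane → Plane) :=
  {u | ∃ Du, IsBVWithDeriv Ω u Du ∧ CantorPartZero Ω u Du ∧
    (∃ C : ℝ, ∀ᵐ x ∂(volume.restrict Ω), ∀ i j, |gradDensity Du x i j| ≤ C) ∧
    Measure.hausdorffMeasure 1 (jumpSet Ω u) < ⊤}

/-! ### The classes of deformations -/

/-- `𝒜_ε`: maps in `W^{1,1}(Ω; ℝ²)` with `det ∇u = 1` and `|∇u e₁| = 1` a.e. in `Ω`, and with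
`∇u ∈ SO(2)` a.e. in the rigid layers. -/
def admissible (Ω : Set Plane) (lam ε : ℝ) : Set (Plane → Plane) :=
  {u | ∃ G : Plane → Mat2, IsW11WithGrad Ω u G ∧
    (∀ᵐ x ∂(volume.restrict Ω), G x ∈ slipMatrices) ∧
    ∀ᵐ x ∂(volume.restrict (rigidLayers lam ε ∩ Ω)), G x ∈ SO2}

/-- `𝒜`: maps `u ∈ BV(Ω; ℝ²)` with `u(x) = R(x₂) x + ψ(x₂)` a.e. in `Ω`, where
`R ∈ BV(a_Ω, b_Ω; SO(2))` and `ψ ∈ BV(a_Ω, b_Ω; ℝ²)`, and with `det ∇u = 1` a.e. in `Ω`. -/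
def classA (Ω : Set Plane) : Set (Plane → Plane) :=
  {u | ∃ Du, IsBVWithDeriv Ω u Du ∧
    (∃ (R : ℝ → Mat2) (ψ : ℝ → Plane),
      (∀ i j, IsBV1 (heightInterval Ω) fun t => R t i j) ∧
      (∀ᵐ t ∂(volume.restrict (heightInterval Ω)), R t ∈ SO2) ∧
      (∀ i, IsBV1 (heightInterval Ω) fun t => ψ t i) ∧
      ∀ᵐ x ∂(volume.restrict Ω), u x = matVec (R (x 1)) x + ψ (x 1)) ∧
    ∀ᵐ x ∂(volume.restrict Ω), (gradDensity Du x).det = 1}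

/-- `𝒜^∥`: maps `u ∈ BV(Ω; ℝ²)` with `u(x) = R x + ϑ(x₂) R e₁ + c` a.e. in `Ω`, where
`R ∈ SO(2)`, `ϑ ∈ BV(a_Ω, b_Ω)` and `c ∈ ℝ²`. -/
def classAPar (Ω : Set Plane) : Set (Plane → Plane) :=
  {u | (∃ Du, IsBVWithDeriv Ω u Du) ∧
    ∃ R ∈ SO2, ∃ (ϑ : ℝ → ℝ) (c : Plane), IsBV1 (heightInterval Ω) ϑ ∧
      ∀ᵐ x ∂(volume.restrict Ω), u x = matVec R x + ϑ (x 1) • matVec R (unitVec 0) + c}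

end LayeredBV

end

/-! Both classes consist of maps `u(x) = R(x₂) x + ψ(x₂)`, and both reduce to one notion,
`IsProfile`: a bounded monotone `F` controls the oscillation of `ψ`, and between two heights either
`R` is unchanged and `ψ` moves along `R e₁`, or the increment of `F` is at least the width of `Ω` at
some height in between. Such profiles are approximated in `IsProfile.exists_approximation`.

Construction. Cut the plane into blocks of eight layers of height `ε`. Inside a block the map passes
from one sampled rigid motion to the next; all deformation takes place in the soft parts of the
layers, of height `λε`. A translation by `r` along `R e₁` is a simple shear with gradient at most `1
+ |r|/(λε)` (`connects_shear`). An arbitrary change of rigid motion is also possible: rotations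
differing by at most `π/2` can be joined across a diagonal interface, where two sheared rotations
differ by a rank-one matrix (`connects_rotation`), and shears in two orthogonal directions correct
the translation (`layers_jump`). This costs a gradient of order `1/ε`.

Compactness. Weak* convergence follows from `L¹` convergence and a uniform `L¹` bound on the
gradients. An expensive block has area at most `8ε` times its largest width, so it contributes a
multiple of that width, whereas `F` pays only for the width at one height between the two sample
heights. The two are comparable: by the Lipschitz boundary and the connected slices, widths decrease
up to a factor away from a central height `c` (`exists_width_comparison`), and the sample heights
are shifted towards `c`. The sum over the blocks then telescopes (`IsProfile.exists_map`). Near a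
continuity point of `F` the increments eventually fall below the local widths, so only cheap blocks
remain and the maps converge there; dominated convergence gives `L¹` convergence.

Profiles. For `𝒜^∥` the rotation is constant and `F` comes from the variation of `Dϑ`. For `𝒜 ∩
SBV_∞`, `Du` has no singular part between jump heights. Testing with products `α(x₁) β(x₂)` turns
`det ∇u = 1` into two statements: the derivative of the unit vector `R e₁` is parallel to `R e₁`,
hence zero; and `ψ` moves only along `R e₁` (`IsLayered.rotation_eq`, `IsLayered.translation_eq`).
At a jump height two different rigid motions agree in at most one point of the slice, so the width
is at most the length of `J_u` there (`IsLayered.width_le_hausdorffMeasure`). Here `F` is the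
distribution function of the variation of `Dψ` plus the image of `ℋ¹` on `J_u` under `x₂`. -/

noncomputable section

namespace LayeredBV

/-! ### Integration against signed measures. -/

section SignedIntegrals

variable {X : Type*} [MeasurableSpace X]

instance isFiniteMeasure_variation (μ : SignedMeasure X) : IsFiniteMeasure μ.variation := by
  rw [← SignedMeasure.totalVariation_eq_variation]; infer_instance

lemma signedMeasure_eq_sub (μ : SignedMeasure X) :
    μ = μ.toJordanDecomposition.posPart.toSignedMeasure -
      μ.toJordanDecomposition.negPart.toSignedMeasure :=
  μ.toSignedMeasure_toJordanDecomposition.symm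

lemma integrable_posPart {μ : SignedMeasure X} {f : X → ℝ} (hf : Integrable f μ.variation) :
    Integrable f μ.toJordanDecomposition.posPart := by
  rw [← SignedMeasure.totalVariation_eq_variation] at hf
  exact hf.mono_measure (Measure.le_add_right le_rfl)

lemma integrable_negPart {μ : SignedMeasure X} {f : X → ℝ} (hf : Integrable f μ.variation) :
    Integrable f μ.toJordanDecomposition.negPart := by
  rw [← SignedMeasure.totalVariation_eq_variation] at hf
  exact hf.mono_measure (Measure.le_add_left le_rfl)

/-- The formula for measures that are regarded as signed measures concerns the flipped pairing; on
`ℝ` multiplication is commutative, so it also applies to `∂•`. -/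
lemma lsmul_flip_eq : (ContinuousLinearMap.lsmul ℝ ℝ : ℝ →L[ℝ] ℝ →L[ℝ] ℝ) =
    (ContinuousLinearMap.lsmul ℝ ℝ : ℝ →L[ℝ] ℝ →L[ℝ] ℝ).flip := by
  ext; simp

lemma integral_toSignedMeasure_smul (ν : Measure X) [IsFiniteMeasure ν] (f : X → ℝ) :
    ∫ᵛ x, f x ∂•ν.toSignedMeasure = ∫ x, f x ∂ν := by
  rw [lsmul_flip_eq]; exact VectorMeasure.integral_toSignedMeasure

lemma signedIntegral_eq_sub (μ : SignedMeasure X) {f : X → ℝ} (hf : Integrable f μ.variation) :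
    ∫ᵛ x, f x ∂•μ = ∫ x, f x ∂μ.toJordanDecomposition.posPart -
      ∫ x, f x ∂μ.toJordanDecomposition.negPart := by
  conv_lhs => rw [signedMeasure_eq_sub μ]
  rw [VectorMeasure.integral_sub_vectorMeasure, integral_toSignedMeasure_smul,
    integral_toSignedMeasure_smul]
  · simpa [VectorMeasure.Integrable] using integrable_posPart hf
  · simpa [VectorMeasure.Integrable] using integrable_negPart hf

/-- Pass to a measurable version of the density, split it into positive and negative parts, and use
the formula for positive densities on each. -/
lemma signedIntegral_withDensity {ν : Measure X} {g φ : X → ℝ} (hg : Integrable g ν)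
    (hφ : Measurable φ) {C : ℝ} (hC : ∀ x, |φ x| ≤ C) :
    ∫ᵛ x, φ x ∂•(ν.withDensityᵥ g) = ∫ x, g x * φ x ∂ν := by
  obtain ⟨g', hg'm, hgg'⟩ := hg.1
  have hg'i : Integrable g' ν := hg.congr hgg'
  have e1 : ν.withDensityᵥ g = ν.withDensityᵥ g' := WithDensityᵥEq.congr_ae hgg'
  have e2 : ∫ x, g x * φ x ∂ν = ∫ x, g' x * φ x ∂ν := by
    apply integral_congr_ae; filter_upwards [hgg'] with x hx; rw [hx]
  rw [e1, e2]
  have hm := hg'm.measurable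
  have f1 : IsFiniteMeasure (ν.withDensity fun x => ENNReal.ofReal (g' x)) :=
    isFiniteMeasure_withDensity_ofReal hg'i.2
  have f2 : IsFiniteMeasure (ν.withDensity fun x => ENNReal.ofReal (-g' x)) :=
    isFiniteMeasure_withDensity_ofReal hg'i.neg.2
  rw [withDensityᵥ_eq_withDensity_pos_part_sub_withDensity_neg_part hg'i]
  have i1 : Integrable φ (ν.withDensity fun x => ENNReal.ofReal (g' x)) :=
    Integrable.of_bound hφ.aestronglyMeasurable C (Eventually.of_forall hC)
  have i2 : Integrable φ (ν.withDensity fun x => ENNReal.ofReal (-g' x)) :=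
    Integrable.of_bound hφ.aestronglyMeasurable C (Eventually.of_forall hC)
  rw [VectorMeasure.integral_sub_vectorMeasure (by simpa [VectorMeasure.Integrable] using i1)
    (by simpa [VectorMeasure.Integrable] using i2), integral_toSignedMeasure_smul,
    integral_toSignedMeasure_smul,
    integral_withDensity_eq_integral_toReal_smul (by fun_prop) (by simp),
    integral_withDensity_eq_integral_toReal_smul (by fun_prop) (by simp), ← integral_sub]
  · congr 1; ext x
    simp only [ENNReal.toReal_ofReal', smul_eq_mul]
    rcases le_total 0 (g' x) with h | h
    · rw [max_eq_left h, max_eq_right (by linarith)]; ring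
    · rw [max_eq_right h, max_eq_left (by linarith)]; ring
  · exact (integrable_withDensity_iff_integrable_smul' (by fun_prop) (by simp)).1 i1
  · exact (integrable_withDensity_iff_integrable_smul' (by fun_prop) (by simp)).1 i2

lemma abs_signedIntegral_le (μ : SignedMeasure X) {f : X → ℝ} {C : ℝ} (h : ∀ x, |f x| ≤ C) :
    |∫ᵛ x, f x ∂•μ| ≤ C * μ.variation.real univ := by
  have := VectorMeasure.norm_integral_le_of_norm_le_const (μ := μ)
    (B := ContinuousLinearMap.lsmul ℝ ℝ) (f := f) (C := C) (Eventually.of_forall h)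
  simpa [ContinuousLinearMap.opNorm_lsmul] using this

lemma variation_withDensity_real {ν : Measure X} {g : X → ℝ} (hg : Integrable g ν) :
    (ν.withDensityᵥ g).variation.real univ = ∫ x, |g x| ∂ν := by
  rw [Measure.real, Measure.variation_withDensityᵥ hg, withDensity_apply _ MeasurableSet.univ,
    Measure.restrict_univ]
  exact (integral_norm_eq_lintegral_enorm hg.1).symm

end SignedIntegrals

end LayeredBV
end

noncomputable section

namespace LayeredBV

/-! ### Test functions are dense in `C₀(Ω)`. -/

section Density

variable {E : Type*} [NormedAddCommGroup E]

/-- Subtracting the truncation of `φ` to `[-δ/2, δ/2]` leaves a function that vanishes off the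
compact set `{|φ| ≥ δ/2} ⊆ Ω`. Mollifying it at a small scale costs another `δ/2` and keeps the
support inside `Ω`. -/
lemma IsC0.exists_isTestFunction_near [NormedSpace ℝ E] [FiniteDimensional ℝ E] {Ω : Set E} (hΩ : IsOpen Ω)
    {φ : E → ℝ} (hφ : IsC0 Ω φ) {δ : ℝ} (hδ : 0 < δ) :
    ∃ ψ, IsTestFunction Ω ψ ∧ ∀ x, |φ x - ψ x| ≤ δ := by
  obtain ⟨hc, h0, hlim⟩ := hφ
  set f : E → ℝ := fun x => φ x - max (-(δ / 2)) (min (δ / 2) (φ x)) with hf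
  have hfc : Continuous f := by fun_prop
  set K : Set E := {x | δ / 2 ≤ |φ x|} with hK
  have hKc : IsClosed K := isClosed_le continuous_const hc.abs
  have hKΩ : K ⊆ Ω := by
    intro x hx
    by_contra hxΩ
    simp only [hK, mem_ofPred_eq, h0 x hxΩ, abs_zero] at hx
    linarith
  have hKcomp : IsCompact K := by
    have : ∀ᶠ x in cocompact E, φ x ∈ Metric.ball (0 : ℝ) (δ / 2) :=
      hlim (Metric.ball_mem_nhds _ (by linarith))
    obtain ⟨T, hT, hTs⟩ := mem_cocompact.1 this
    refine hT.of_isClosed_subset hKc fun x hx => ?_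
    by_contra hxT
    have := hTs hxT
    simp only [mem_ofPred_eq, Metric.mem_ball, dist_zero_right, Real.norm_eq_abs] at this
    simp only [hK, mem_ofPred_eq] at hx
    linarith
  have hfz : ∀ x, x ∉ K → f x = 0 := by
    intro x hx
    simp only [hK, mem_ofPred_eq, not_le, abs_lt] at hx
    simp only [hf]
    rw [min_eq_right hx.2.le, max_eq_right hx.1.le, sub_self]
  have hfφ : ∀ x, |φ x - f x| ≤ δ / 2 := by
    intro x
    simp only [hf, sub_sub_cancel]
    exact abs_le.2 ⟨le_max_left _ _, max_le (by linarith) (min_le_left _ _)⟩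
  obtain ⟨r, hr, hrΩ⟩ := hKcomp.exists_cthickening_subset_open hΩ hKΩ
  have hfs : HasCompactSupport f := HasCompactSupport.intro hKcomp hfz
  have huc : UniformContinuous f := hfs.uniformContinuous_of_continuous hfc
  obtain ⟨r', hr', hfr'⟩ := Metric.uniformContinuous_iff.1 huc (δ / 2) (by linarith)
  obtain ⟨g, hg, hgd⟩ := hfc.exists_contDiff_dist_le_of_forall_mem_ball_dist_le
    (lt_min hr hr')
  have hgz : ∀ x, x ∉ Metric.cthickening r K → g x = 0 := by
    intro x hx
    have hxK : x ∉ K := fun h => hx (Metric.self_subset_cthickening _ h)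
    have := hgd x 0 fun y hy => by
      have hyK : y ∉ K := by
        intro hyK
        refine hx (Metric.mem_cthickening_of_dist_le x y r K hyK ?_)
        rw [dist_comm]; exact ((Metric.mem_ball.1 hy).trans_le (min_le_left _ _)).le
      simp [hfz y hyK, hfz x hxK]
    rw [hfz x hxK, dist_zero_right] at this
    exact norm_le_zero_iff.1 this
  have hsub : tsupport g ⊆ Metric.cthickening r K :=
    closure_minimal (fun x hx => by_contra fun h => hx (hgz x h)) Metric.isClosed_cthickening
  refine ⟨g, ⟨hg, ?_, hsub.trans hrΩ⟩, fun x => ?_⟩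
  · exact HasCompactSupport.intro hKcomp.cthickening hgz
  · have h1 := hgd x (δ / 2) fun y hy =>
      (hfr' ((Metric.mem_ball.1 hy).trans_le (min_le_right _ _))).le
    rw [Real.dist_eq, abs_sub_comm] at h1
    calc |φ x - g x| = |(φ x - f x) + (f x - g x)| := by ring_nf
      _ ≤ |φ x - f x| + |f x - g x| := abs_add_le _ _
      _ ≤ δ := by linarith [hfφ x]

lemma IsC0.bounded {Ω : Set E} {φ : E → ℝ} (hφ : IsC0 Ω φ) : ∃ C, ∀ x, |φ x| ≤ C := by
  obtain ⟨hc, -, hlim⟩ := hφ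
  have : ∀ᶠ x in cocompact E, φ x ∈ Metric.ball (0 : ℝ) 1 :=
    hlim (Metric.ball_mem_nhds _ one_pos)
  obtain ⟨T, hT, hTs⟩ := mem_cocompact.1 this
  obtain ⟨C, hC⟩ := hT.exists_bound_of_continuousOn hc.continuousOn
  refine ⟨max C 1, fun x => ?_⟩
  by_cases hx : x ∈ T
  · exact (hC x hx).trans (le_max_left _ _)
  · have := hTs hx
    simp only [mem_ofPred_eq, Metric.mem_ball, dist_zero_right, Real.norm_eq_abs] at this
    exact this.le.trans (le_max_right _ _)

lemma IsTestFunction.isC0 [NormedSpace ℝ E] {Ω : Set E} {φ : E → ℝ} (hφ : IsTestFunction Ω φ) : IsC0 Ω φ := by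
  refine ⟨hφ.1.continuous, fun x hx => ?_, ?_⟩
  · exact image_eq_zero_of_notMem_tsupport fun h => hx (hφ.2.2 h)
  · exact hφ.2.1.is_zero_at_infty

lemma signedIntegrable_of_bounded [MeasurableSpace E] [OpensMeasurableSpace E]
    (μ : SignedMeasure E) {φ : E → ℝ} (hφ : Measurable φ) {C : ℝ} (hC : ∀ x, |φ x| ≤ C) :
    Integrable φ μ.variation :=
  Integrable.of_bound hφ.aestronglyMeasurable C (Eventually.of_forall hC)

lemma IsTestFunction.exists_fderiv_bound [NormedSpace ℝ E] {Ω : Set E} {φ : E → ℝ} (hφ : IsTestFunction Ω φ)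
    (v : E) : ∃ C, ∀ x, |fderiv ℝ φ x v| ≤ C := by
  have hc : Continuous fun x => fderiv ℝ φ x v :=
    (hφ.1.continuous_fderiv (by simp)).clm_apply continuous_const
  obtain ⟨C, hC⟩ := hc.bounded_above_of_compact_support (hφ.2.1.fderiv_apply (𝕜 := ℝ) v)
  exact ⟨C, hC⟩

lemma IsTestFunction.continuous_fderiv_apply [NormedSpace ℝ E] {Ω : Set E} {φ : E → ℝ} (hφ : IsTestFunction Ω φ)
    (v : E) : Continuous fun x => fderiv ℝ φ x v :=
  (hφ.1.continuous_fderiv (by simp)).clm_apply continuous_const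

end Density

/-! ### Weak* convergence from `L¹` convergence and bounded gradients. -/

section WeakStar

lemma IsWeakDerivL1.isDistribDeriv {X : Type*} [NormedAddCommGroup X] [NormedSpace ℝ X]
    [MeasureSpace X] [OpensMeasurableSpace X] {Ω : Set X} {f g : X → ℝ} {e : X}
    (h : IsWeakDerivL1 Ω f e g) :
    IsDistribDeriv Ω f e ((volume.restrict Ω).withDensityᵥ g) := by
  refine ⟨fun B hB hd => ?_, fun φ hφ => ?_⟩
  · rw [withDensityᵥ_apply h.1 hB, Measure.restrict_restrict hB, hd.inter_eq]
    simp
  · obtain ⟨C, hC⟩ := hφ.isC0.bounded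
    rw [h.2 φ hφ, signedIntegral_withDensity h.1 hφ.1.continuous.measurable hC]

lemma integrableOn_apply {Ω : Set Plane} {u : Plane → Plane} (h : IntegrableOn u Ω) (i : Fin 2) :
    IntegrableOn (fun x => u x i) Ω :=
  ContinuousLinearMap.integrable_comp (EuclideanSpace.proj i : Plane →L[ℝ] ℝ) h

/-- A sequence that converges in `L¹` and whose gradients are bounded in `L¹` converges weakly*
in `BV`. -/
lemma weakStarTendstoBV_of_bound {ι : Type*} {l : Filter ι} {Ω : Set Plane} (hΩ : IsOpen Ω)
    {u : Plane → Plane} {Du : Fin 2 → Fin 2 → SignedMeasure Plane} (hu : IsBVWithDeriv Ω u Du)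
    {v : ι → Plane → Plane} {G : ι → Plane → Mat2}
    (hv : ∀ᶠ k in l, IsW11WithGrad Ω (v k) (G k)) {C : ℝ}
    (hC : ∀ᶠ k in l, ∀ i j, ∫ x in Ω, |G k x i j| ≤ C)
    (hL : Tendsto (fun k => eLpNorm (fun x => v k x - u x) 1 (volume.restrict Ω)) l (𝓝 0)) :
    WeakStarTendstoBV Ω v l u := by
  set Dv : ι → Fin 2 → Fin 2 → SignedMeasure Plane := fun k i j =>
    (volume.restrict Ω).withDensityᵥ fun x => G k x i j with hDv
  have hvBV : ∀ᶠ k in l, IsBVWithDeriv Ω (v k) (Dv k) := by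
    filter_upwards [hv] with k hk
    exact ⟨hk.1, fun i j => (hk.2 i j).isDistribDeriv⟩
  refine ⟨Dv, Du, hvBV, hu, hL, fun φ hφ i j => ?_⟩
  rw [Metric.tendsto_nhds]
  intro η hη
  set V := (Du i j).variation.real univ with hV
  have hV0 : 0 ≤ V := measureReal_nonneg
  -- Replacing `φ` by a test function `ψ` costs at most `δ` times the two total variations, which is
  -- at most `η/2`. The remaining `η/2` is for the `ψ` terms: integrated by parts, they are bounded
  -- by the `L¹` distance times a bound `L` for the derivative of `ψ`.
  set δ := η / (2 * (|C| + V + 1)) with hδdef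
  have hpos : 0 < |C| + V + 1 := by positivity
  have hδ : 0 < δ := by positivity
  obtain ⟨ψ, hψ, hφψ⟩ := hφ.exists_isTestFunction_near hΩ hδ
  obtain ⟨L, hLb⟩ := hψ.exists_fderiv_bound (unitVec j)
  have hLpos : 0 < |L| + 1 := by positivity
  have hL1 : ∀ᶠ k in l, eLpNorm (fun x => v k x - u x) 1 (volume.restrict Ω) <
      ENNReal.ofReal (η / (2 * (|L| + 1))) :=
    hL.eventually_lt_const (by rw [ENNReal.ofReal_pos]; positivity)
  filter_upwards [hv, hvBV, hC, hL1] with k hk hkBV hkC hkL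
  obtain ⟨Cφ, hCφ⟩ := hφ.bounded
  obtain ⟨Cψ, hCψ⟩ := hψ.isC0.bounded
  have hφm := hφ.1.measurable
  have hψm := hψ.1.continuous.measurable
  have key : ∀ μ : SignedMeasure Plane,
      ∫ᵛ x, φ x ∂•μ = ∫ᵛ x, (φ x - ψ x) ∂•μ + ∫ᵛ x, ψ x ∂•μ := by
    intro μ
    rw [VectorMeasure.integral_fun_sub (signedIntegrable_of_bounded μ hφm hCφ)
      (signedIntegrable_of_bounded μ hψm hCψ)]
    ring
  have hd1 := abs_signedIntegral_le (Dv k i j) (f := fun x => φ x - ψ x) hφψ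
  have hd2 := abs_signedIntegral_le (Du i j) (f := fun x => φ x - ψ x) hφψ
  rw [variation_withDensity_real (hk.2 i j).1] at hd1
  have e1 := (hkBV.2 i j).2 ψ hψ
  have e2 := (hu.2 i j).2 ψ hψ
  have hcont := hψ.continuous_fderiv_apply (unitVec j)
  have iv : IntegrableOn (fun x => v k x i * fderiv ℝ ψ x (unitVec j)) Ω :=
    (integrableOn_apply hk.1 i).mul_bdd (c := L) hcont.aestronglyMeasurable
      (Eventually.of_forall hLb)
  have iu : IntegrableOn (fun x => u x i * fderiv ℝ ψ x (unitVec j)) Ω :=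
    (integrableOn_apply hu.1 i).mul_bdd (c := L) hcont.aestronglyMeasurable
      (Eventually.of_forall hLb)
  have hint : Integrable (fun x => v k x - u x) (volume.restrict Ω) := hk.1.sub hu.1
  have hdiff : |∫ᵛ x, ψ x ∂•(Dv k i j) - ∫ᵛ x, ψ x ∂•(Du i j)| ≤
      |L| * ∫ x in Ω, ‖v k x - u x‖ := by
    have : ∫ᵛ x, ψ x ∂•(Dv k i j) - ∫ᵛ x, ψ x ∂•(Du i j) =
        - ∫ x in Ω, (v k x i - u x i) * fderiv ℝ ψ x (unitVec j) := by
      simp_rw [sub_mul]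
      rw [integral_sub iv iu, e1, e2]; ring
    rw [this, abs_neg, ← integral_const_mul]
    refine (abs_integral_le_integral_abs).trans (integral_mono_of_nonneg
      (Eventually.of_forall fun x => abs_nonneg _) (hint.norm.const_mul _)
      (Eventually.of_forall fun x => ?_))
    show |(v k x i - u x i) * fderiv ℝ ψ x (unitVec j)| ≤ |L| * ‖v k x - u x‖
    rw [abs_mul, mul_comm]
    refine mul_le_mul ((hLb x).trans (le_abs_self L)) ?_ (abs_nonneg _) (abs_nonneg _)
    exact PiLp.norm_apply_le (v k x - u x) i
  have hnorm : ∫ x in Ω, ‖v k x - u x‖ < η / (2 * (|L| + 1)) := by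
    rw [integral_norm_eq_lintegral_enorm hint.1, ← eLpNorm_one_eq_lintegral_enorm]
    exact ENNReal.toReal_lt_of_lt_ofReal hkL
  have hfin : |L| * ∫ x in Ω, ‖v k x - u x‖ ≤ η / 2 * (|L| / (|L| + 1)) := by
    calc _ ≤ |L| * (η / (2 * (|L| + 1))) := by gcongr
      _ = _ := by field_simp
  have hfin2 : η / 2 * (|L| / (|L| + 1)) < η / 2 := by
    have : |L| / (|L| + 1) < 1 := by rw [div_lt_one hLpos]; linarith
    nlinarith
  have hfin3 : δ * |C| + δ * V ≤ η / 2 := by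
    have : δ * (|C| + V + 1) = η / 2 := by rw [hδdef]; field_simp
    nlinarith
  rw [Real.dist_eq, key (Dv k i j), key (Du i j)]
  have hkC' : δ * ∫ x in Ω, |G k x i j| ≤ δ * |C| := by
    gcongr; exact (hkC i j).trans (le_abs_self C)
  rw [abs_lt]
  rw [abs_le] at hd1 hd2 hdiff
  constructor <;> linarith [hd1.1, hd1.2, hd2.1, hd2.2, hdiff.1, hdiff.2]

end WeakStar

/-! ### Uniqueness of the distributional derivative. -/

section Uniqueness

lemma signedIntegral_indicator_one {X : Type*} [MeasurableSpace X] (μ : SignedMeasure X)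
    {U : Set X} (hU : MeasurableSet U) : ∫ᵛ x, U.indicator (fun _ => (1 : ℝ)) x ∂•μ = μ U := by
  rw [VectorMeasure.integral_indicator hU, VectorMeasure.integral_const,
    VectorMeasure.restrict_apply _ hU MeasurableSet.univ]
  simp

/-- The two Jordan parts are finite measures that agree on the π-system of open sets. -/
lemma signedMeasure_eq_zero_of_isOpen {X : Type*} [TopologicalSpace X] [MeasurableSpace X]
    [BorelSpace X] {μ : SignedMeasure X} (h : ∀ U, IsOpen U → μ U = 0) : μ = 0 := by
  have key : μ.toJordanDecomposition.posPart = μ.toJordanDecomposition.negPart := by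
    have hU : ∀ U, IsOpen U →
        μ.toJordanDecomposition.posPart U = μ.toJordanDecomposition.negPart U := by
      intro U hU
      have h1 := μ.apply_eq_posPart_real_sub_negPart_real hU.measurableSet
      rw [h U hU] at h1
      exact (measureReal_eq_measureReal_iff).1 (by linarith)
    refine ext_of_generate_finite _ (BorelSpace.measurable_eq (α := X)) isPiSystem_isOpen (fun U h => hU U h) (hU _ isOpen_univ)
  ext B hB
  rw [μ.apply_eq_posPart_real_sub_negPart_real hB, key]
  simp

/-- A signed measure that is carried by a bounded open set and annihilates the test functions
vanishes. -/
lemma signedMeasure_eq_zero_of_testFunction {Ω : Set Plane} (hΩ : IsOpen Ω)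
    (hb : Bornology.IsBounded Ω) {μ : SignedMeasure Plane}
    (hc : ∀ B, MeasurableSet B → Disjoint B Ω → μ B = 0)
    (h : ∀ φ, IsTestFunction Ω φ → ∫ᵛ x, φ x ∂•μ = 0) : μ = 0 := by
  have hC0 : ∀ φ, IsC0 Ω φ → ∫ᵛ x, φ x ∂•μ = 0 := by
    intro φ hφ
    have hV : 0 ≤ μ.variation.real univ := measureReal_nonneg
    refine abs_eq_zero.1 (le_antisymm (le_of_forall_pos_le_add fun η hη => ?_) (abs_nonneg _))
    obtain ⟨ψ, hψ, hφψ⟩ := hφ.exists_isTestFunction_near hΩ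
      (δ := η / (μ.variation.real univ + 1)) (by positivity)
    obtain ⟨Cφ, hCφ⟩ := hφ.bounded
    obtain ⟨Cψ, hCψ⟩ := hψ.isC0.bounded
    have h1 := abs_signedIntegral_le μ (f := fun x => φ x - ψ x) hφψ
    rw [VectorMeasure.integral_fun_sub (signedIntegrable_of_bounded μ hφ.1.measurable hCφ)
      (signedIntegrable_of_bounded μ hψ.1.continuous.measurable hCψ), h ψ hψ, sub_zero] at h1
    refine h1.trans ?_
    rw [zero_add, div_mul_eq_mul_div, div_le_iff₀ (by positivity)]
    nlinarith
  apply signedMeasure_eq_zero_of_isOpen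
  intro U hU
  have hsplit : μ U = μ (U ∩ Ω) + μ (U \ Ω) := by
    rw [← VectorMeasure.of_union (disjoint_sdiff_right.mono_left inter_subset_right)
      (hU.inter hΩ).measurableSet (hU.measurableSet.diff hΩ.measurableSet), inter_union_sdiff]
  rw [hsplit, hc (U \ Ω) (hU.measurableSet.diff hΩ.measurableSet) disjoint_sdiff_left, add_zero]
  set O := U ∩ Ω with hO
  have hOo : IsOpen O := hU.inter hΩ
  have hOb : Bornology.IsBounded O := hb.subset inter_subset_right
  -- The distance to the empty set is zero by convention, so the cutoffs below would vanish if `O`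
  -- were the whole plane; boundedness excludes this.
  have hne : Oᶜ.Nonempty := by
    by_contra hne
    rw [not_nonempty_iff_eq_empty, compl_empty_iff] at hne
    rw [hne] at hOb
    exact NormedSpace.unbounded_univ ℝ Plane hOb
  -- These functions of `C₀(Ω)` tend pointwise to the indicator of `O`.
  set F : ℕ → Plane → ℝ := fun n x => min 1 (n * Metric.infDist x Oᶜ) with hF
  have hF0 : ∀ n x, x ∉ O → F n x = 0 := by
    intro n x hx
    simp [hF, Metric.infDist_zero_of_mem (show x ∈ Oᶜ from hx)]
  have hFc : ∀ n, Continuous (F n) := fun n => by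
    have := Metric.continuous_infDist_pt (Oᶜ : Set Plane)
    fun_prop
  have hFC0 : ∀ n, IsC0 Ω (F n) := by
    intro n
    refine ⟨hFc n, fun x hx => hF0 n x fun h => hx h.2, ?_⟩
    apply HasCompactSupport.is_zero_at_infty
    exact HasCompactSupport.intro hOb.isCompact_closure
      fun x hx => hF0 n x fun h => hx (subset_closure h)
  have hlim : Tendsto (fun n => ∫ᵛ x, F n x ∂•μ) atTop
      (𝓝 (∫ᵛ x, O.indicator (fun _ => (1 : ℝ)) x ∂•μ)) := by
    refine VectorMeasure.tendsto_integral_of_dominated_convergence (fun _ => (1 : ℝ))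
      (fun n => (hFc n).aestronglyMeasurable) (integrable_const _)
      (fun n => Eventually.of_forall fun x => ?_) (Eventually.of_forall fun x => ?_)
    · have h0 : 0 ≤ F n x := le_min zero_le_one (by positivity [Metric.infDist_nonneg (x := x) (s := Oᶜ)])
      rw [Real.norm_of_nonneg h0]
      exact min_le_left _ _
    · by_cases hx : x ∈ O
      · rw [indicator_of_mem hx]
        have hpos : 0 < Metric.infDist x Oᶜ :=
          (hOo.isClosed_compl.notMem_iff_infDist_pos hne).1 (by simpa using hx)
        apply tendsto_const_nhds.congr'
        obtain ⟨N, hN⟩ := exists_nat_gt (1 / Metric.infDist x Oᶜ)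
        filter_upwards [eventually_ge_atTop N] with n hn
        symm
        apply min_eq_left
        rw [div_lt_iff₀ hpos] at hN
        have : (N : ℝ) ≤ n := by exact_mod_cast hn
        nlinarith
      · rw [indicator_of_notMem hx]
        simp only [hF0 _ x hx]
        exact tendsto_const_nhds
  rw [signedIntegral_indicator_one μ hOo.measurableSet] at hlim
  simp only [hC0 _ (hFC0 _)] at hlim
  exact tendsto_nhds_unique hlim tendsto_const_nhds

lemma IsDistribDeriv.unique {Ω : Set Plane} (hΩ : IsOpen Ω) (hb : Bornology.IsBounded Ω)
    {f : Plane → ℝ} {e : Plane} {μ μ' : SignedMeasure Plane}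
    (h : IsDistribDeriv Ω f e μ) (h' : IsDistribDeriv Ω f e μ') : μ = μ' := by
  rw [← sub_eq_zero]
  apply signedMeasure_eq_zero_of_testFunction hΩ hb
  · intro B hB hd
    rw [_root_.sub_apply, h.1 B hB hd, h'.1 B hB hd, sub_zero]
  · intro φ hφ
    obtain ⟨C, hC⟩ := hφ.isC0.bounded
    have hm := hφ.1.continuous.measurable
    rw [VectorMeasure.integral_sub_vectorMeasure (signedIntegrable_of_bounded _ hm hC)
      (signedIntegrable_of_bounded _ hm hC)]
    linarith [h.2 φ hφ, h'.2 φ hφ]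

/-- The classes `classA` and `SBVInfty` each provide their own derivative measure; this identifies
the two. -/
lemma IsBVWithDeriv.unique {Ω : Set Plane} (hΩ : IsOpen Ω) (hb : Bornology.IsBounded Ω)
    {u : Plane → Plane} {D D' : Fin 2 → Fin 2 → SignedMeasure Plane}
    (h : IsBVWithDeriv Ω u D) (h' : IsBVWithDeriv Ω u D') : D = D' := by
  ext1 i; ext1 j
  exact (h.2 i j).unique hΩ hb (h'.2 i j)

end Uniqueness

end LayeredBV
end

noncomputable section

namespace LayeredBV

/-! ### Functions of bounded variation of one variable and their cumulative representatives. -/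

section OneDimensional

lemma exists_isTestFunction_integral_eq_one {a b : ℝ} (hab : a < b) :
    ∃ β : ℝ → ℝ, IsTestFunction (Ioo a b) β ∧ ∫ t, β t = 1 := by
  let f : ContDiffBump ((a + b) / 2 : ℝ) :=
    ⟨(b - a) / 8, (b - a) / 4, by linarith, by linarith⟩
  refine ⟨f.normed volume, ⟨f.contDiff_normed, f.hasCompactSupport_normed, ?_⟩,
    f.integral_normed⟩
  rw [f.tsupport_normed_eq, Real.closedBall_eq_Icc]
  show Icc ((a + b) / 2 - (b - a) / 4) ((a + b) / 2 + (b - a) / 4) ⊆ Ioo a b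
  intro x hx
  constructor <;> linarith [hx.1, hx.2]

lemma IsTestFunction.eq_zero {E : Type*} [NormedAddCommGroup E] [NormedSpace ℝ E] {Ω : Set E}
    {φ : E → ℝ} (hφ : IsTestFunction Ω φ) {x : E} (hx : x ∉ Ω) : φ x = 0 :=
  hφ.isC0.2.1 x hx

lemma IsTestFunction.fderiv_eq_zero {E : Type*} [NormedAddCommGroup E] [NormedSpace ℝ E]
    {Ω : Set E} {φ : E → ℝ} (hφ : IsTestFunction Ω φ) {x : E} (hx : x ∉ Ω) :
    fderiv ℝ φ x = 0 :=
  image_eq_zero_of_notMem_tsupport fun h => hx (hφ.2.2 (tsupport_fderiv_subset ℝ h))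

lemma IsTestFunction.deriv_one {a b : ℝ} {φ : ℝ → ℝ} (hφ : IsTestFunction (Ioo a b) φ) :
    IsTestFunction (Ioo a b) (deriv φ) := by
  refine ⟨(contDiff_infty_iff_deriv.1 hφ.1).2, hφ.2.1.deriv, ?_⟩
  exact (closure_minimal (support_deriv_subset (𝕜 := ℝ)) (isClosed_tsupport φ)).trans hφ.2.2

lemma IsTestFunction.integrable {Ω : Set ℝ} {φ : ℝ → ℝ} (hφ : IsTestFunction Ω φ) :
    Integrable φ :=
  hφ.1.continuous.integrable_of_hasCompactSupport hφ.2.1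

/-- The primitive vanishes to the left of the support of `χ`, and to its right because the mean of
`χ` is zero. The empty support is treated apart since it has no least and greatest point. -/
lemma IsTestFunction.primitive {a b : ℝ} {χ : ℝ → ℝ} (hχ : IsTestFunction (Ioo a b) χ)
    (h0 : ∫ t, χ t = 0) : ∃ φ, IsTestFunction (Ioo a b) φ ∧ deriv φ = χ := by
  set φ : ℝ → ℝ := fun x => ∫ t in a..x, χ t with hφ
  have hd : ∀ x, HasDerivAt φ (χ x) x := fun x =>
    intervalIntegral.integral_hasDerivAt_right (hχ.1.continuous.intervalIntegrable _ _)
      (hχ.1.continuous.stronglyMeasurableAtFilter _ _) hχ.1.continuous.continuousAt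
  have hderiv : deriv φ = χ := funext fun x => (hd x).deriv
  have hsm : ContDiff ℝ ∞ φ := by
    rw [contDiff_infty_iff_deriv, hderiv]
    exact ⟨fun x => (hd x).differentiableAt, hχ.1⟩
  rcases (tsupport χ).eq_empty_or_nonempty with he | hne
  · have hz : ∀ t, χ t = 0 := fun t => image_eq_zero_of_notMem_tsupport (by simp [he])
    refine ⟨φ, ⟨hsm, ?_, ?_⟩, hderiv⟩
    all_goals
      have : φ = 0 := by ext x; simp [hφ, hz]
      rw [this]
    · exact HasCompactSupport.zero
    · simp [tsupport]
  obtain ⟨c, hc, hcmin⟩ := hχ.2.1.exists_isLeast hne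
  obtain ⟨d, hd', hdmax⟩ := hχ.2.1.exists_isGreatest hne
  have hzc : ∀ t, t < c → χ t = 0 := fun t ht =>
    image_eq_zero_of_notMem_tsupport fun h => absurd (hcmin h) (not_le.2 ht)
  have hzd : ∀ t, d < t → χ t = 0 := fun t ht =>
    image_eq_zero_of_notMem_tsupport fun h => absurd (hdmax h) (not_le.2 ht)
  have hca := hχ.2.2 hc
  have hdb := hχ.2.2 hd'
  have hzero : ∀ x, x ∉ Icc c d → φ x = 0 := by
    intro x hx
    by_cases h : x < c
    · simp only [hφ]
      rw [← intervalIntegral.integral_zero (a := a) (b := x)]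
      refine intervalIntegral.integral_congr fun t ht => hzc t ?_
      exact (le_max_iff.1 (show t ≤ max a x from ht.2)).elim
        (fun h' => h'.trans_lt hca.1) (fun h' => h'.trans_lt h)
    · have hdx : d < x := by
        by_contra hdx; exact hx ⟨not_lt.1 h, not_lt.1 hdx⟩
      have hax : a ≤ x := by linarith [hca.1, not_lt.1 h]
      simp only [hφ]
      rw [intervalIntegral.integral_of_le hax, ← h0]
      apply setIntegral_eq_integral_of_forall_compl_eq_zero
      intro t ht
      by_cases h1 : t ≤ a
      · exact hzc t (h1.trans_lt hca.1)
      · exact hzd t (hdx.trans (by by_contra h2; exact ht ⟨not_le.1 h1, not_lt.1 h2⟩))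
  refine ⟨φ, ⟨hsm, HasCompactSupport.intro isCompact_Icc hzero, ?_⟩, hderiv⟩
  have hsub : Function.support φ ⊆ Icc c d := fun x hx => by_contra fun h => hx (hzero x h)
  refine (closure_minimal hsub isClosed_Icc).trans ?_
  exact fun x hx => ⟨hca.1.trans_le hx.1, hx.2.trans_lt hdb.2⟩

/-- A function on an interval with vanishing weak derivative is constant. -/
lemma ae_eq_const_of_integral_mul_deriv_eq_zero {a b : ℝ} (hab : a < b) {f : ℝ → ℝ}
    (hf : IntegrableOn f (Ioo a b))
    (h : ∀ φ, IsTestFunction (Ioo a b) φ → ∫ t in Ioo a b, f t * deriv φ t = 0) :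
    ∃ c, ∀ᵐ t ∂volume.restrict (Ioo a b), f t = c := by
  obtain ⟨β, hβ, hβ1⟩ := exists_isTestFunction_integral_eq_one hab
  set c := ∫ t in Ioo a b, f t * β t with hc
  refine ⟨c, ?_⟩
  have hmul : ∀ g : ℝ → ℝ, IsTestFunction (Ioo a b) g →
      IntegrableOn (fun t => f t * g t) (Ioo a b) := by
    intro g hg
    obtain ⟨C, hC⟩ := hg.isC0.bounded
    exact hf.mul_bdd (c := C) hg.1.continuous.aestronglyMeasurable (Eventually.of_forall hC)
  rw [ae_restrict_iff' measurableSet_Ioo]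
  have key := isOpen_Ioo.ae_eq_zero_of_integral_contDiff_smul_eq_zero (U := Ioo a b)
    (f := fun t => f t - c) (μ := volume)
    (((hf.sub (integrableOn_const (by simp))).locallyIntegrableOn)) ?_
  · filter_upwards [key] with t ht hm
    linarith [ht hm]
  intro g hg hgc hgs
  have hgT : IsTestFunction (Ioo a b) g := ⟨hg, hgc, hgs⟩
  set m := ∫ t, g t with hm
  -- Subtracting `m β` makes the mean zero, so the difference is the derivative of a test function
  -- and the hypothesis applies.
  have hχ : IsTestFunction (Ioo a b) fun t => g t - m * β t := by
    refine ⟨hg.sub (contDiff_const.mul hβ.1), hgc.sub hβ.2.1.mul_left, ?_⟩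
    refine (tsupport_sub g _).trans (union_subset hgs ?_)
    exact (tsupport_mul_subset_right (f := fun _ => m)).trans hβ.2.2
  obtain ⟨φ, hφ, hφd⟩ := hχ.primitive (by
    rw [integral_sub hgT.integrable (hβ.integrable.const_mul m), integral_const_mul, hβ1]
    simp [hm])
  have h1 := h φ hφ
  rw [hφd] at h1
  have h2 : ∫ t in Ioo a b, f t * (g t - m * β t) =
      (∫ t in Ioo a b, f t * g t) - m * c := by
    rw [hc, ← integral_const_mul]
    refine Eq.trans ?_ (integral_sub (hmul g hgT) ((hmul β hβ).const_mul m))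
    congr 1; ext t; ring
  have h3 : ∫ t in Ioo a b, g t = m := by
    rw [hm]
    exact setIntegral_eq_integral_of_forall_compl_eq_zero fun t ht => hgT.eq_zero ht
  have h4 : ∫ t, g t • (f t - c) = ∫ t in Ioo a b, g t • (f t - c) := by
    symm
    exact setIntegral_eq_integral_of_forall_compl_eq_zero fun t ht => by simp [hgT.eq_zero ht]
  rw [h4]
  have h5 : ∀ t, g t • (f t - c) = f t * g t - c * g t := fun t => by
    simp only [smul_eq_mul]; ring
  simp_rw [h5]
  refine (integral_sub (hmul g hgT) (hgT.integrable.integrableOn.const_mul c)).trans ?_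
  rw [integral_const_mul, h3]
  linarith

/-- Fubini: write `ν (Iic t)` as the integral of an indicator; the inner integral of `deriv φ` over
`[y, ∞)` is `-φ y`. -/
lemma integral_measureReal_Iic_mul_deriv (ν : Measure ℝ) [IsFiniteMeasure ν] {φ : ℝ → ℝ}
    (hφ : ContDiff ℝ ∞ φ) (hs : HasCompactSupport φ) :
    ∫ t, ν.real (Iic t) * deriv φ t = - ∫ x, φ x ∂ν := by
  have hint : Integrable (deriv φ) :=
    (hφ.continuous_deriv (by simp)).integrable_of_hasCompactSupport hs.deriv
  have h1 : ∀ t, ν.real (Iic t) * deriv φ t =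
      ∫ y, (Ici y).indicator (fun t => deriv φ t) t ∂ν := by
    intro t
    have : ∀ y, (Ici y).indicator (fun t => deriv φ t) t =
        (Iic t).indicator (fun _ => deriv φ t) y := by
      intro y; simp [indicator, mem_Ici, mem_Iic]
    simp_rw [this]
    rw [integral_indicator_const _ measurableSet_Iic, smul_eq_mul]
  simp_rw [h1]
  rw [integral_integral_swap, ← integral_neg]
  · congr 1; ext y
    rw [integral_indicator measurableSet_Ici, integral_Ici_eq_integral_Ioi,
      hs.integral_Ioi_deriv_eq (hφ.of_le (by simp))]
  · have hm : MeasurableSet {p : ℝ × ℝ | p.2 ≤ p.1} := measurableSet_le measurable_snd measurable_fst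
    have : Function.uncurry (fun t y => (Ici y).indicator (fun t => deriv φ t) t) =
        {p : ℝ × ℝ | p.2 ≤ p.1}.indicator fun p => deriv φ p.1 := by
      ext ⟨t, y⟩; simp [Function.uncurry, indicator, mem_Ici]
    rw [this]
    exact (hint.comp_fst ν).indicator hm

lemma signedIntegral_eq_neg_integral_cumulative (μ : SignedMeasure ℝ) {φ : ℝ → ℝ}
    (hφ : ContDiff ℝ ∞ φ) (hs : HasCompactSupport φ) :
    ∫ t, μ (Iic t) * deriv φ t = - ∫ᵛ x, φ x ∂•μ := by
  obtain ⟨C, hC⟩ := hφ.continuous.bounded_above_of_compact_support hs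
  rw [signedIntegral_eq_sub μ (signedIntegrable_of_bounded μ hφ.continuous.measurable hC)]
  have hint : Integrable (deriv φ) :=
    (hφ.continuous_deriv (by simp)).integrable_of_hasCompactSupport hs.deriv
  have hmono : ∀ (ν : Measure ℝ) [IsFiniteMeasure ν],
      Integrable fun t => ν.real (Iic t) * deriv φ t := by
    intro ν _
    have hm : Monotone fun t => ν.real (Iic t) := fun s t hst =>
      measureReal_mono (Iic_subset_Iic.2 hst)
    refine hint.bdd_mul (c := ν.real univ) hm.measurable.aestronglyMeasurable
      (Eventually.of_forall fun t => ?_)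
    rw [Real.norm_of_nonneg measureReal_nonneg]
    exact measureReal_mono (subset_univ _)
  have : ∀ t, μ (Iic t) * deriv φ t =
      μ.toJordanDecomposition.posPart.real (Iic t) * deriv φ t -
      μ.toJordanDecomposition.negPart.real (Iic t) * deriv φ t := by
    intro t
    rw [μ.apply_eq_posPart_real_sub_negPart_real measurableSet_Iic]; ring
  simp_rw [this]
  rw [integral_sub (hmono _) (hmono _), integral_measureReal_Iic_mul_deriv _ hφ hs,
    integral_measureReal_Iic_mul_deriv _ hφ hs]
  ring

lemma measurable_cumulative (μ : SignedMeasure ℝ) : Measurable fun t => μ (Iic t) := by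
  have hm : ∀ (ν : Measure ℝ) [IsFiniteMeasure ν], Measurable fun t => ν.real (Iic t) := by
    intro ν _
    have : Monotone fun t => ν.real (Iic t) := fun s t hst =>
      measureReal_mono (Iic_subset_Iic.2 hst)
    exact this.measurable
  simp_rw [μ.apply_eq_posPart_real_sub_negPart_real measurableSet_Iic]
  exact (hm _).sub (hm _)

lemma abs_signedMeasure_le (μ : SignedMeasure ℝ) (B : Set ℝ) : |μ B| ≤ μ.variation.real B := by
  rw [← SignedMeasure.totalVariation_eq_variation]
  exact μ.norm_le_totalVariation B

/-- A function of one variable whose distributional derivative is the measure `μ` agrees with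
the cumulative distribution function of `μ` up to a constant. -/
lemma IsDistribDeriv.exists_ae_eq_cumulative {a b : ℝ} (hab : a < b) {f : ℝ → ℝ}
    {μ : SignedMeasure ℝ} (hf : IntegrableOn f (Ioo a b))
    (h : IsDistribDeriv (Ioo a b) f 1 μ) :
    ∃ c, ∀ᵐ t ∂volume.restrict (Ioo a b), f t = c + μ (Iic t) := by
  have hci : IntegrableOn (fun t => μ (Iic t)) (Ioo a b) := by
    refine Measure.integrableOn_of_bounded (M := μ.variation.real univ) (by simp)
      (measurable_cumulative μ).aestronglyMeasurable (Eventually.of_forall fun t => ?_)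
    exact (abs_signedMeasure_le μ _).trans (measureReal_mono (subset_univ _))
  obtain ⟨c, hc⟩ := ae_eq_const_of_integral_mul_deriv_eq_zero hab (hf.sub hci) (by
    intro φ hφ
    have h1 := h.2 φ hφ
    have h2 := signedIntegral_eq_neg_integral_cumulative μ hφ.1 hφ.2.1
    have h3 : ∫ t in Ioo a b, μ (Iic t) * deriv φ t = ∫ t, μ (Iic t) * deriv φ t :=
      setIntegral_eq_integral_of_forall_compl_eq_zero fun t ht => by simp [hφ.deriv_one.eq_zero ht]
    obtain ⟨C, hC⟩ := hφ.deriv_one.isC0.bounded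
    have hb : ∀ g : ℝ → ℝ, IntegrableOn g (Ioo a b) →
        IntegrableOn (fun t => g t * deriv φ t) (Ioo a b) := fun g hg =>
      hg.mul_bdd (c := C) hφ.deriv_one.1.continuous.aestronglyMeasurable (Eventually.of_forall hC)
    simp_rw [fderiv_apply_one_eq_deriv] at h1
    simp_rw [Pi.sub_apply, sub_mul]
    rw [integral_sub (hb f hf) (hb _ hci), h1, h3, h2, sub_self])
  refine ⟨c, ?_⟩
  filter_upwards [hc] with t ht
  simp only [Pi.sub_apply] at ht
  linarith

/-- Dominated convergence for the indicators of half-lines; with its left counterpart it yields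
right-continuous representatives with explicit left limits. -/
lemma tendsto_cumulative_right (μ : SignedMeasure ℝ) (t : ℝ) :
    Tendsto (fun s => μ (Iic s)) (𝓝[>] t) (𝓝 (μ (Iic t))) := by
  simp_rw [← signedIntegral_indicator_one μ measurableSet_Iic]
  refine VectorMeasure.tendsto_integral_filter_of_dominated_convergence (fun _ => (1 : ℝ))
    (Eventually.of_forall fun s =>
      (measurable_const.indicator measurableSet_Iic).aestronglyMeasurable)
    (Eventually.of_forall fun s => Eventually.of_forall fun x => ?_) (integrable_const _)
    (Eventually.of_forall fun x => ?_)
  · by_cases hx : x ∈ Iic s <;> simp [hx]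
  · apply tendsto_const_nhds.congr'
    by_cases hx : x ≤ t
    · filter_upwards [self_mem_nhdsWithin] with s hs
      rw [indicator_of_mem (show x ∈ Iic t from hx),
        indicator_of_mem (show x ∈ Iic s from hx.trans (le_of_lt hs))]
    · filter_upwards [Ioo_mem_nhdsGT (not_le.1 hx)] with s hs
      rw [indicator_of_notMem (show x ∉ Iic t from hx),
        indicator_of_notMem (show x ∉ Iic s from not_le.2 hs.2)]

lemma tendsto_cumulative_left (μ : SignedMeasure ℝ) (t : ℝ) :
    Tendsto (fun s => μ (Iic s)) (𝓝[<] t) (𝓝 (μ (Iio t))) := by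
  simp_rw [← signedIntegral_indicator_one μ measurableSet_Iic,
    ← signedIntegral_indicator_one μ measurableSet_Iio]
  refine VectorMeasure.tendsto_integral_filter_of_dominated_convergence (fun _ => (1 : ℝ))
    (Eventually.of_forall fun s =>
      (measurable_const.indicator measurableSet_Iic).aestronglyMeasurable)
    (Eventually.of_forall fun s => Eventually.of_forall fun x => ?_) (integrable_const _)
    (Eventually.of_forall fun x => ?_)
  · by_cases hx : x ∈ Iic s <;> simp [hx]
  · apply tendsto_const_nhds.congr'
    by_cases hx : x < t
    · filter_upwards [Ioo_mem_nhdsLT hx] with s hs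
      rw [indicator_of_mem (show x ∈ Iio t from hx),
        indicator_of_mem (show x ∈ Iic s from hs.1.le)]
    · filter_upwards [self_mem_nhdsWithin] with s hs
      rw [indicator_of_notMem (show x ∉ Iio t from hx),
        indicator_of_notMem (show x ∉ Iic s from not_le.2 (lt_of_lt_of_le hs (not_lt.1 hx)))]

lemma abs_cumulative_sub_le (μ : SignedMeasure ℝ) {s t : ℝ} (hst : s ≤ t) :
    |μ (Iic t) - μ (Iic s)| ≤ μ.variation.real (Iic t) - μ.variation.real (Iic s) := by
  have hU : Iic t = Iic s ∪ Ioc s t := (Iic_union_Ioc_eq_Iic hst).symm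
  have hd : Disjoint (Iic s) (Ioc s t) := by
    rw [Set.disjoint_left]; intro x hx hx'; exact absurd hx'.1 (not_lt.2 hx)
  rw [hU, VectorMeasure.of_union hd measurableSet_Iic measurableSet_Ioc,
    measureReal_union hd measurableSet_Ioc, add_sub_cancel_left, add_sub_cancel_left]
  exact abs_signedMeasure_le μ _

end OneDimensional

end LayeredBV
end

open scoped ENNReal

noncomputable section

namespace LayeredBV

/-! ### Widths of the horizontal slices of the domain. -/

section Geometry

/-- The horizontal slice of a set at height `t`. -/
def slice (Ω : Set Plane) (t : ℝ) : Set ℝ := {s | !₂[s, t] ∈ Ω}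

/-- The length of the horizontal slice at height `t`. -/
def width (Ω : Set Plane) (t : ℝ) : ℝ≥0∞ := volume (slice Ω t)

lemma mk_apply_self (x : Plane) : (!₂[x 0, x 1] : Plane) = x := by
  ext i; fin_cases i <;> simp

lemma abs_apply_le_norm (x : Plane) (i : Fin 2) : |x i| ≤ ‖x‖ := PiLp.norm_apply_le x i

lemma width_le {Ω : Set Plane} {M : ℝ} (hM : ∀ x ∈ Ω, ‖x‖ ≤ M) (t : ℝ) :
    width Ω t ≤ ENNReal.ofReal (2 * M) := by
  have : slice Ω t ⊆ Icc (-M) M := fun s hs => by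
    have h := (abs_apply_le_norm !₂[s, t] 0).trans (hM _ hs)
    exact abs_le.1 (by simpa using h)
  refine (measure_mono this).trans ?_
  rw [Real.volume_Icc]
  exact ENNReal.ofReal_le_ofReal (by linarith)

lemma mem_heightInterval {Ω : Set Plane} (hΩ : IsOpen Ω) (hb : Bornology.IsBounded Ω)
    {x : Plane} (hx : x ∈ Ω) : x 1 ∈ heightInterval Ω := by
  obtain ⟨M, hM⟩ := hb.exists_norm_le
  have hbd : ∀ y ∈ Ω, |y 1| ≤ M := fun y hy => (abs_apply_le_norm y 1).trans (hM y hy)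
  have hbb : BddBelow ((fun x : Plane => x 1) '' Ω) :=
    ⟨-M, by rintro _ ⟨y, hy, rfl⟩; exact (abs_le.1 (hbd y hy)).1⟩
  have hba : BddAbove ((fun x : Plane => x 1) '' Ω) :=
    ⟨M, by rintro _ ⟨y, hy, rfl⟩; exact (abs_le.1 (hbd y hy)).2⟩
  have hcont : Continuous fun τ : ℝ => x + τ • unitVec 1 := by fun_prop
  have hnear : ∀ᶠ τ in 𝓝 (0 : ℝ), x + τ • unitVec 1 ∈ Ω :=
    hcont.continuousAt.eventually (by simpa using hΩ.mem_nhds hx)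
  obtain ⟨r, hr, hball⟩ := Metric.eventually_nhds_iff.1 hnear
  have h1 := hball (y := r / 2) (by rw [dist_zero_right, Real.norm_of_nonneg] <;> linarith)
  have h2 := hball (y := -(r / 2)) (by
    rw [dist_zero_right, norm_neg, Real.norm_of_nonneg] <;> linarith)
  constructor
  · have := csInf_le hbb ⟨_, h2, rfl⟩
    simp at this
    show sInf _ < _
    linarith
  · have := le_csSup hba ⟨_, h1, rfl⟩
    simp at this
    show _ < sSup _
    linarith

lemma exists_mem_of_mem_heightInterval {Ω : Set Plane} (hc : IsConnected Ω) {t : ℝ}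
    (ht : t ∈ heightInterval Ω) : ∃ s, !₂[s, t] ∈ Ω := by
  have hne : ((fun x : Plane => x 1) '' Ω).Nonempty := hc.nonempty.image _
  obtain ⟨_, ⟨x, hx, rfl⟩, hxt⟩ := exists_lt_of_csInf_lt hne ht.1
  obtain ⟨_, ⟨y, hy, rfl⟩, hyt⟩ := exists_lt_of_lt_csSup hne ht.2
  have hconn : IsPreconnected ((fun x : Plane => x 1) '' Ω) :=
    hc.isPreconnected.image _ (by fun_prop)
  obtain ⟨z, hz, hzt⟩ := hconn.ordConnected.out ⟨x, hx, rfl⟩ ⟨y, hy, rfl⟩ ⟨hxt.le, hyt.le⟩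
  simp only at hzt
  exact ⟨z 0, by rw [← hzt, mk_apply_self]; exact hz⟩

lemma exists_box {Ω : Set Plane} (hΩ : IsOpen Ω) {s t : ℝ} (h : !₂[s, t] ∈ Ω) :
    ∃ r > 0, ∀ s' t', |s' - s| < r → |t' - t| < r → !₂[s', t'] ∈ Ω := by
  have hcont : Continuous fun p : ℝ × ℝ => (!₂[p.1, p.2] : Plane) := by fun_prop
  have hn : ∀ᶠ p in 𝓝 (s, t), (!₂[p.1, p.2] : Plane) ∈ Ω :=
    hcont.continuousAt.eventually (hΩ.mem_nhds h)
  obtain ⟨r, hr, hb⟩ := Metric.eventually_nhds_iff.1 hn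
  exact ⟨r, hr, fun s' t' hs ht => hb (y := (s', t')) (max_lt hs ht)⟩

/-- `Ω` contains a box around a point of the slice. This local bound later excludes changes of the
rotation near continuity points of `F`. -/
lemma exists_width_lower_bound_near {Ω : Set Plane} (hΩ : IsOpen Ω) (hc : IsConnected Ω) {t : ℝ}
    (ht : t ∈ heightInterval Ω) :
    ∃ w : ℝ, 0 < w ∧ ∃ r > 0, ∀ t', |t' - t| < r → ENNReal.ofReal w ≤ width Ω t' := by
  obtain ⟨s, hs⟩ := exists_mem_of_mem_heightInterval hc ht
  obtain ⟨r, hr, hbox⟩ := exists_box hΩ hs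
  refine ⟨r, hr, r, hr, fun t' ht' => ?_⟩
  have : Ioo s (s + r) ⊆ slice Ω t' := fun s' hs' =>
    hbox s' t' (by rw [abs_lt]; constructor <;> linarith [hs'.1, hs'.2]) ht'
  calc ENNReal.ofReal r = volume (Ioo s (s + r)) := by rw [Real.volume_Ioo]; congr 1; ring
    _ ≤ _ := measure_mono this

lemma exists_width_lower_bound {Ω : Set Plane} (hΩ : IsOpen Ω) (hc : IsConnected Ω) {K : Set ℝ}
    (hK : IsCompact K) (hKI : K ⊆ heightInterval Ω) :
    ∃ w : ℝ, 0 < w ∧ ∀ t ∈ K, ENNReal.ofReal w ≤ width Ω t := by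
  refine hK.induction_on (p := fun K => ∃ w : ℝ, 0 < w ∧ ∀ t ∈ K, ENNReal.ofReal w ≤ width Ω t)
    ⟨1, one_pos, by simp⟩ ?_ ?_ ?_
  · rintro s t hst ⟨w, hw, h⟩
    exact ⟨w, hw, fun x hx => h x (hst hx)⟩
  · rintro s t ⟨w, hw, h⟩ ⟨w', hw', h'⟩
    refine ⟨min w w', lt_min hw hw', fun x hx => ?_⟩
    rcases hx with hx | hx
    · exact (ENNReal.ofReal_le_ofReal (min_le_left _ _)).trans (h x hx)
    · exact (ENNReal.ofReal_le_ofReal (min_le_right _ _)).trans (h' x hx)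
  · intro t ht
    obtain ⟨w, hw, r, hr, h⟩ := exists_width_lower_bound_near hΩ hc (hKI ht)
    exact ⟨Metric.ball t r, mem_nhdsWithin_of_mem_nhds (Metric.ball_mem_nhds t hr), w, hw,
      fun x hx => h x hx⟩

/-- At a boundary point where the signed height `σ x₂` is maximal, some direction that decreases
the signed height points into the domain. -/
lemma HasLipschitzBoundary.exists_inward {Ω : Set Plane} (hlip : HasLipschitzBoundary Ω)
    {σ B : ℝ} (hB : ∀ x ∈ Ω, σ * x 1 < B) {p : Plane} (hp : p ∈ closure Ω) (hpB : σ * p 1 = B) :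
    ∃ r > 0, ∃ k : Plane, σ * k 1 = -1 ∧
      (∀ x ∈ Ω, x ∈ Metric.ball p r → ∀ τ : ℝ, 0 ≤ τ → x + τ • k ∈ Metric.ball p r →
        x + τ • k ∈ Ω) ∧
      ∀ τ : ℝ, 0 < τ → p + τ • k ∈ Metric.ball p r → p + τ • k ∈ Ω := by
  have hpΩ : p ∉ Ω := fun h => (hB p h).ne hpB
  have hpf : p ∈ frontier Ω := ⟨hp, fun h => hpΩ (interior_subset h)⟩
  obtain ⟨r, hr, T, g, ⟨K, hg⟩, hchart⟩ := hlip p hpf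
  -- The direction that points straight up in the chart, hence into the domain.
  set d : Plane := T.symm (unitVec 1) with hd
  have hT : ∀ (x : Plane) (τ : ℝ), T (x + τ • d) = T x + τ • unitVec 1 := by
    intro x τ; simp [hd]
  have hT0 : ∀ (x : Plane) (τ : ℝ), T (x + τ • d) 0 = T x 0 := by intro x τ; rw [hT]; simp
  have hT1 : ∀ (x : Plane) (τ : ℝ), T (x + τ • d) 1 = T x 1 + τ := by intro x τ; rw [hT]; simp
  have hgp : g (T p 0) ≤ T p 1 := by
    by_contra hlt
    push Not at hlt
    have hc1 : Continuous fun x : Plane => g (T x 0) - T x 1 := by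
      have := hg.continuous
      fun_prop
    have : ∀ᶠ x in 𝓝 p, 0 < g (T x 0) - T x 1 :=
      hc1.continuousAt.eventually (lt_mem_nhds (by simpa using hlt))
    obtain ⟨x, ⟨hx1, hx2⟩, hxΩ⟩ := (mem_closure_iff_nhds.1 hp) _
      (inter_mem this (Metric.ball_mem_nhds p hr))
    have := (hchart x hx2).1 hxΩ
    have hx1' : 0 < g (T x 0) - T x 1 := hx1
    linarith
  have hmove : ∀ x ∈ Ω, x ∈ Metric.ball p r → ∀ τ : ℝ, 0 ≤ τ → x + τ • d ∈ Metric.ball p r →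
      x + τ • d ∈ Ω := by
    intro x hx hxb τ hτ hxb'
    rw [hchart _ hxb', hT0, hT1]
    linarith [(hchart x hxb).1 hx]
  have hmovep : ∀ τ : ℝ, 0 < τ → p + τ • d ∈ Metric.ball p r → p + τ • d ∈ Ω := by
    intro τ hτ hb
    rw [hchart _ hb, hT0, hT1]
    linarith
  -- A short move from `p` along `d` enters `Ω`, where the signed height is below its value `B` at
  -- `p`.
  have hdneg : σ * d 1 < 0 := by
    have hcont : Continuous fun τ : ℝ => p + τ • d := by fun_prop
    have hn : ∀ᶠ τ in 𝓝 (0 : ℝ), p + τ • d ∈ Metric.ball p r :=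
      hcont.continuousAt.eventually (by
        simp only [zero_smul, add_zero]; exact Metric.ball_mem_nhds p hr)
    obtain ⟨ρ, hρ, hball⟩ := Metric.eventually_nhds_iff.1 hn
    have h1 := hB _ (hmovep (ρ / 2) (by linarith)
      (hball (by rw [dist_zero_right, Real.norm_of_nonneg] <;> linarith)))
    simp only [PiLp.add_apply, PiLp.smul_apply, smul_eq_mul] at h1
    by_contra hcon
    push Not at hcon
    nlinarith
  -- Normalisation: along `m • d` the signed height decreases at unit speed.
  set m := (-(σ * d 1))⁻¹ with hm
  have hm0 : 0 < m := inv_pos.2 (by linarith)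
  refine ⟨r, hr, m • d, ?_, ?_, ?_⟩
  · simp only [PiLp.smul_apply, smul_eq_mul]
    rw [hm, mul_left_comm, inv_neg, neg_mul, inv_mul_cancel₀ hdneg.ne]
  · intro x hx hxb τ hτ hxb'
    rw [smul_smul] at hxb' ⊢
    exact hmove x hx hxb _ (by positivity) hxb'
  · intro τ hτ hb
    rw [smul_smul] at hb ⊢
    exact hmovep _ (by positivity) hb

/-- Near the top (`σ = 1`) or the bottom (`σ = -1`) of the domain the widths of the slices
are decreasing towards the boundary, up to a factor. -/
lemma exists_width_comparison_near_end {Ω : Set Plane} (hb : Bornology.IsBounded Ω)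
    (hlip : HasLipschitzBoundary Ω) (hx1 : IsX1Connected Ω) {σ B : ℝ} (hσ : σ * σ = 1)
    (hB : ∀ x ∈ Ω, σ * x 1 < B) {p : Plane} (hp : p ∈ closure Ω) (hpB : σ * p 1 = B) :
    ∃ C : ℝ≥0∞, C ≠ ⊤ ∧ ∃ τ₀ < B, ∀ t t', τ₀ < σ * t → σ * t ≤ σ * t' → σ * t' < B →
      width Ω t' ≤ C * width Ω t := by
  obtain ⟨M, hM⟩ := hb.exists_norm_le
  obtain ⟨r, hr, k, hk, hmove, hmovep⟩ := hlip.exists_inward hB hp hpB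
  have hk1 : k 1 = -σ := by linear_combination σ * hk - k 1 * hσ
  -- Either the extreme part of `Ω` lies in one chart at `p`, and translation along `k` embeds the
  -- slice nearer to the end into the one farther away; or the closure has a second point `q` of
  -- extreme height far from `p`, and the slices near the end are long.
  by_cases hcase : ∃ τ₁ < B, ∀ x ∈ Ω, τ₁ < σ * x 1 → x ∈ Metric.ball p (r / 4)
  · obtain ⟨τ₁, hτ₁, hnear⟩ := hcase
    refine ⟨1, ENNReal.one_ne_top, max τ₁ (B - r / (4 * (‖k‖ + 1))), ?_, ?_⟩
    · have : 0 < r / (4 * (‖k‖ + 1)) := by positivity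
      exact max_lt hτ₁ (by linarith)
    intro t t' ht htt' ht'
    rw [one_mul]
    set δ := σ * t' - σ * t with hδ
    have hδ0 : 0 ≤ δ := by linarith
    have hδ1 : δ * ‖k‖ ≤ r / 4 := by
      have h1 : δ ≤ r / (4 * (‖k‖ + 1)) := by linarith [le_max_right τ₁ (B - r / (4 * (‖k‖ + 1)))]
      have h2 : δ * (4 * (‖k‖ + 1)) ≤ r := (le_div_iff₀ (by positivity)).1 h1
      nlinarith
    have hsub : slice Ω t' ⊆ (fun s => s + δ * k 0) ⁻¹' slice Ω t := by
      intro s hs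
      have hs' : !₂[s, t'] ∈ Ω := hs
      have hball : !₂[s, t'] ∈ Metric.ball p (r / 4) := hnear _ hs' (by
        simp only [Matrix.cons_val_one, Matrix.cons_val_zero]
        linarith [le_max_left τ₁ (B - r / (4 * (‖k‖ + 1)))])
      have hpt : (!₂[s + δ * k 0, t] : Plane) = !₂[s, t'] + δ • k := by
        ext i; fin_cases i
        · simp
        · simp [hk1, hδ]; linear_combination (t' - t) * hσ
      show !₂[s + δ * k 0, t] ∈ Ω
      rw [hpt]
      refine hmove _ hs' (Metric.ball_subset_ball (by linarith) hball) δ hδ0 ?_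
      rw [Metric.mem_ball, dist_eq_norm] at hball ⊢
      calc ‖!₂[s, t'] + δ • k - p‖ = ‖(!₂[s, t'] - p) + δ • k‖ := by congr 1; abel
        _ ≤ ‖!₂[s, t'] - p‖ + ‖δ • k‖ := norm_add_le _ _
        _ < r := by rw [norm_smul, Real.norm_of_nonneg hδ0]; linarith
    refine (measure_mono hsub).trans ?_
    rw [measure_preimage_add_right]; rfl
  · push Not at hcase
    obtain ⟨u, -, hu1, hu2⟩ := exists_seq_strictMono_tendsto B
    choose x hxΩ hxu hxb using fun n => hcase (u n) (hu1 n)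
    obtain ⟨q, hq, φ, hφ, hlim⟩ := hb.isCompact_closure.tendsto_subseq
      fun n => subset_closure (hxΩ n)
    have hqB : σ * q 1 = B := by
      have hc : Continuous fun x : Plane => σ * x 1 := by fun_prop
      have h1 : Tendsto (fun n => σ * (x (φ n)) 1) atTop (𝓝 (σ * q 1)) :=
        (hc.tendsto q).comp hlim
      have h2 : Tendsto (fun n => σ * (x (φ n)) 1) atTop (𝓝 B) :=
        tendsto_of_tendsto_of_tendsto_of_le_of_le (hu2.comp hφ.tendsto_atTop)
          tendsto_const_nhds (fun n => (hxu (φ n)).le) (fun n => (hB _ (hxΩ (φ n))).le)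
      exact tendsto_nhds_unique h1 h2
    have hqp : r / 4 ≤ dist q p := by
      refine ge_of_tendsto (hlim.dist tendsto_const_nhds) (Eventually.of_forall fun n => ?_)
      simpa using hxb (φ n)
    have hq1 : q 1 = p 1 := by linear_combination σ * hqB - σ * hpB - (q 1 - p 1) * hσ
    have hq0 : r / 4 ≤ |q 0 - p 0| := by
      rwa [EuclideanSpace.dist_eq, Fin.sum_univ_two, hq1, dist_self, Real.dist_eq, sq_abs,
        zero_pow two_ne_zero, add_zero, Real.sqrt_sq_eq_abs] at hqp
    obtain ⟨r', hr', k', hk', -, hmovep'⟩ := hlip.exists_inward hB hq hqB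
    have hk1' : k' 1 = -σ := by linear_combination σ * hk' - k' 1 * hσ
    set D := ‖k‖ + ‖k'‖ + 1 with hD
    have hDpos : 0 < D := by positivity
    -- Up to the height `η` below the end, the moves from `p` and `q` have length at most `r/16`, so
    -- they stay in their charts and reduce the horizontal distance `r/4` at most to `r/8`.
    set η := min r r' / (16 * D) with hη
    have hη0 : 0 < η := div_pos (lt_min hr hr') (by positivity)
    have hηD : η * D * 16 ≤ r ∧ η * D * 16 ≤ r' := by
      have : η * D * 16 = min r r' := by rw [hη]; field_simp
      exact ⟨this ▸ min_le_left _ _, this ▸ min_le_right _ _⟩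
    refine ⟨ENNReal.ofReal (2 * M) / ENNReal.ofReal (r / 8), ?_, B - η, by linarith, ?_⟩
    · exact ENNReal.div_ne_top ENNReal.ofReal_ne_top (by simp; linarith)
    intro t t' ht htt' ht'
    set δ := B - σ * t with hδ
    have hδ0 : 0 < δ := by linarith
    have hδη : δ ≤ η := by linarith
    have hkn : δ * ‖k‖ ≤ η * D := by
      gcongr; rw [hD]; linarith [norm_nonneg k']
    have hkn' : δ * ‖k'‖ ≤ η * D := by
      gcongr; rw [hD]; linarith [norm_nonneg k]
    have hηD0 : 0 < η * D := by positivity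
    have hP : p 0 + δ * k 0 ∈ slice Ω t := by
      have hpt : (!₂[p 0 + δ * k 0, t] : Plane) = p + δ • k := by
        ext i; fin_cases i
        · simp
        · simp [hk1, hδ]; rw [← hpB]; linear_combination (p 1 - t) * hσ
      show !₂[p 0 + δ * k 0, t] ∈ Ω
      rw [hpt]
      refine hmovep δ hδ0 ?_
      rw [Metric.mem_ball, dist_eq_norm, add_sub_cancel_left, norm_smul,
        Real.norm_of_nonneg hδ0.le]
      linarith [hηD.1]
    have hQ : q 0 + δ * k' 0 ∈ slice Ω t := by
      have hpt : (!₂[q 0 + δ * k' 0, t] : Plane) = q + δ • k' := by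
        ext i; fin_cases i
        · simp
        · simp [hk1', hδ]; rw [← hqB]; linear_combination (q 1 - t) * hσ
      show !₂[q 0 + δ * k' 0, t] ∈ Ω
      rw [hpt]
      refine hmovep' δ hδ0 ?_
      rw [Metric.mem_ball, dist_eq_norm, add_sub_cancel_left, norm_smul,
        Real.norm_of_nonneg hδ0.le]
      linarith [hηD.2]
    have hdist : r / 8 ≤ |(q 0 + δ * k' 0) - (p 0 + δ * k 0)| := by
      have e1 : |δ * k 0| ≤ η * D := by
        rw [abs_mul, abs_of_pos hδ0]
        exact (mul_le_mul_of_nonneg_left (abs_apply_le_norm k 0) hδ0.le).trans hkn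
      have e2 : |δ * k' 0| ≤ η * D := by
        rw [abs_mul, abs_of_pos hδ0]
        exact (mul_le_mul_of_nonneg_left (abs_apply_le_norm k' 0) hδ0.le).trans hkn'
      have e3 : |q 0 - p 0| ≤ |(q 0 + δ * k' 0) - (p 0 + δ * k 0)| + |δ * k 0| + |δ * k' 0| := by
        calc |q 0 - p 0| = |((q 0 + δ * k' 0) - (p 0 + δ * k 0)) + δ * k 0 - δ * k' 0| := by
              congr 1; ring
          _ ≤ |((q 0 + δ * k' 0) - (p 0 + δ * k 0)) + δ * k 0| + |δ * k' 0| := abs_sub _ _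
          _ ≤ _ := by gcongr; exact abs_add_le _ _
      linarith [hηD.1]
    -- The slice is an interval, so it contains everything between the two points reached from `p`
    -- and `q`.
    have hlow : ENNReal.ofReal (r / 8) ≤ width Ω t := by
      have hoc : (slice Ω t).OrdConnected := hx1 t
      refine (ENNReal.ofReal_le_ofReal hdist).trans ?_
      rw [← Real.volume_interval]
      exact measure_mono (hoc.uIcc_subset hP hQ)
    calc width Ω t' ≤ ENNReal.ofReal (2 * M) := width_le hM t'
      _ = ENNReal.ofReal (2 * M) / ENNReal.ofReal (r / 8) * ENNReal.ofReal (r / 8) := by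
        rw [ENNReal.div_mul_cancel (by simp; linarith) ENNReal.ofReal_ne_top]
      _ ≤ _ := by gcongr

lemma exists_mem_closure_height {Ω : Set Plane} (hne : Ω.Nonempty) (hb : Bornology.IsBounded Ω)
    {σ B : ℝ} (hlub : IsLUB ((fun x : Plane => σ * x 1) '' Ω) B) :
    ∃ p ∈ closure Ω, σ * p 1 = B := by
  have hc : Continuous fun x : Plane => σ * x 1 := by fun_prop
  have hcomp := hb.isCompact_closure.image hc
  have : B ∈ closure ((fun x : Plane => σ * x 1) '' Ω) := hlub.mem_closure (hne.image _)
  have h2 := closure_minimal (image_mono subset_closure) hcomp.isClosed this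
  exact h2

/-- Away from the middle height of the domain the widths of the slices are decreasing, up to
a factor. -/
lemma exists_width_comparison {Ω : Set Plane} (hΩ : IsOpen Ω) (hc : IsConnected Ω)
    (hb : Bornology.IsBounded Ω) (hlip : HasLipschitzBoundary Ω) (hx1 : IsX1Connected Ω) :
    ∃ c ∈ heightInterval Ω, ∃ C : ℝ≥0∞, C ≠ ⊤ ∧ ∀ t ∈ heightInterval Ω, ∀ t' ∈ heightInterval Ω,
      (c ≤ t ∧ t ≤ t') ∨ (t ≤ c ∧ t' ≤ t) → width Ω t' ≤ C * width Ω t := by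
  obtain ⟨M, hM⟩ := hb.exists_norm_le
  obtain ⟨x₀, hx₀⟩ := hc.nonempty
  have hbd : ∀ y ∈ Ω, |y 1| ≤ M := fun y hy => (abs_apply_le_norm y 1).trans (hM y hy)
  have hne : ((fun x : Plane => x 1) '' Ω).Nonempty := hc.nonempty.image _
  have hbb : BddBelow ((fun x : Plane => x 1) '' Ω) :=
    ⟨-M, by rintro _ ⟨y, hy, rfl⟩; exact (abs_le.1 (hbd y hy)).1⟩
  have hba : BddAbove ((fun x : Plane => x 1) '' Ω) :=
    ⟨M, by rintro _ ⟨y, hy, rfl⟩; exact (abs_le.1 (hbd y hy)).2⟩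
  set a := lowerHeight Ω with ha
  set b := upperHeight Ω with hbdef
  have hI : ∀ x ∈ Ω, a < x 1 ∧ x 1 < b := fun x hx => mem_heightInterval hΩ hb hx
  have hlub : IsLUB ((fun x : Plane => 1 * x 1) '' Ω) b := by
    simp only [one_mul]; exact isLUB_csSup hne hba
  have hglb : IsLUB ((fun x : Plane => -1 * x 1) '' Ω) (-a) := by
    have h := (isGLB_csInf hne hbb).neg
    rw [← image_neg_eq_neg, image_image] at h
    simpa [ha, lowerHeight] using h
  obtain ⟨p, hp, hpb⟩ := exists_mem_closure_height hc.nonempty hb hlub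
  obtain ⟨q, hq, hqa⟩ := exists_mem_closure_height hc.nonempty hb hglb
  obtain ⟨C₁, hC₁, τ₁, hτ₁, h₁⟩ := exists_width_comparison_near_end hb hlip hx1 (by norm_num)
    (fun x hx => by linarith [(hI x hx).2]) hp hpb
  obtain ⟨C₂, hC₂, τ₂, hτ₂, h₂⟩ := exists_width_comparison_near_end hb hlip hx1 (by norm_num)
    (fun x hx => by linarith [(hI x hx).1]) hq hqa
  set c := x₀ 1 with hcdef
  have hcI := hI x₀ hx₀
  -- Away from both ends the widths are at least `w`, and every width is at most `2 * M`; the ratio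
  -- serves as the factor there. The central height `c` is that of an arbitrary point of `Ω`.
  obtain ⟨w, hw, hwK⟩ := exists_width_lower_bound hΩ hc
    (isCompact_Icc (a := min c (-τ₂)) (b := max c τ₁)) (fun t ht => by
      exact ⟨lt_of_lt_of_le (lt_min hcI.1 (by linarith)) ht.1,
        lt_of_le_of_lt ht.2 (max_lt hcI.2 hτ₁)⟩)
  have hmid : ∀ t ∈ Icc (min c (-τ₂)) (max c τ₁), ∀ t', width Ω t' ≤
      ENNReal.ofReal (2 * M) / ENNReal.ofReal w * width Ω t := by
    intro t ht t'
    calc width Ω t' ≤ ENNReal.ofReal (2 * M) := width_le hM t'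
      _ = ENNReal.ofReal (2 * M) / ENNReal.ofReal w * ENNReal.ofReal w := by
        rw [ENNReal.div_mul_cancel (by simpa using hw) ENNReal.ofReal_ne_top]
      _ ≤ _ := by gcongr; exact hwK t ht
  refine ⟨c, hcI, C₁ + C₂ + ENNReal.ofReal (2 * M) / ENNReal.ofReal w, ?_, ?_⟩
  · exact ENNReal.add_ne_top.2 ⟨ENNReal.add_ne_top.2 ⟨hC₁, hC₂⟩,
      ENNReal.div_ne_top ENNReal.ofReal_ne_top (by simpa using hw)⟩
  intro t ht t' ht' hcase
  rw [add_mul, add_mul]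
  rcases hcase with ⟨hct, htt'⟩ | ⟨htc, ht't⟩
  · by_cases h : t ≤ τ₁
    · refine (hmid t ⟨(min_le_left _ _).trans hct, h.trans (le_max_right _ _)⟩ t').trans ?_
      exact le_add_self
    · refine (h₁ t t' (by linarith) (by linarith) (by linarith [ht'.2])).trans ?_
      rw [add_assoc]; exact le_self_add
  · by_cases h : -τ₂ ≤ t
    · refine (hmid t ⟨(min_le_right _ _).trans h, htc.trans (le_max_left _ _)⟩ t').trans ?_
      exact le_add_self
    · refine (h₂ t t' (by linarith) (by linarith) (by linarith [ht'.1])).trans ?_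
      rw [add_comm (C₁ * _), add_assoc]; exact le_self_add

end Geometry

end LayeredBV
end

open scoped ENNReal

noncomputable section

namespace LayeredBV

/-! ### Continuous piecewise affine maps and their weak gradients. -/

section WeakGradients

/-- `G` is the weak gradient of the continuous map `V` on the whole plane. -/
def HasWeakGrad (V : Plane → Plane) (G : Plane → Mat2) : Prop :=
  Continuous V ∧ (∀ i j, LocallyIntegrable fun x => G x i j) ∧
  ∀ φ : Plane → ℝ, ContDiff ℝ ∞ φ → HasCompactSupport φ → ∀ i j,
    ∫ x, V x i * fderiv ℝ φ x (unitVec j) = - ∫ x, G x i j * φ x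

lemma integrable_mul_fderiv {f φ : Plane → ℝ} (hf : Continuous f) (hφ : ContDiff ℝ ∞ φ)
    (hs : HasCompactSupport φ) (v : Plane) : Integrable fun x => f x * fderiv ℝ φ x v := by
  have hc : Continuous fun x => fderiv ℝ φ x v :=
    (hφ.continuous_fderiv (by simp)).clm_apply continuous_const
  exact (hf.mul hc).integrable_of_hasCompactSupport (hs.fderiv_apply (𝕜 := ℝ) v).mul_left

lemma integrable_mul_of_locallyIntegrable {g φ : Plane → ℝ} (hg : LocallyIntegrable g)
    (hφ : Continuous φ) (hs : HasCompactSupport φ) : Integrable fun x => g x * φ x := by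
  have := hg.integrable_smul_left_of_hasCompactSupport hφ hs
  simpa only [smul_eq_mul, mul_comm] using this

lemma HasWeakGrad.add {V V' : Plane → Plane} {G G' : Plane → Mat2} (h : HasWeakGrad V G)
    (h' : HasWeakGrad V' G') :
    HasWeakGrad (fun x => V x + V' x) (fun x => G x + G' x) := by
  refine ⟨h.1.add h'.1, fun i j => (h.2.1 i j).add (h'.2.1 i j), fun φ hφ hs i j => ?_⟩
  have c1 : Continuous fun x => V x i := by have := h.1; fun_prop
  have c2 : Continuous fun x => V' x i := by have := h'.1; fun_prop
  simp only [PiLp.add_apply, Matrix.add_apply, add_mul]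
  rw [integral_add (integrable_mul_fderiv c1 hφ hs _) (integrable_mul_fderiv c2 hφ hs _),
    integral_add (integrable_mul_of_locallyIntegrable (h.2.1 i j) hφ.continuous hs)
      (integrable_mul_of_locallyIntegrable (h'.2.1 i j) hφ.continuous hs),
    h.2.2 φ hφ hs i j, h'.2.2 φ hφ hs i j]
  ring

lemma HasWeakGrad.neg {V : Plane → Plane} {G : Plane → Mat2} (h : HasWeakGrad V G) :
    HasWeakGrad (fun x => -V x) (fun x => -G x) := by
  refine ⟨h.1.neg, fun i j => (h.2.1 i j).neg, fun φ hφ hs i j => ?_⟩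
  simp only [PiLp.neg_apply, Matrix.neg_apply, neg_mul]
  rw [integral_neg, integral_neg, h.2.2 φ hφ hs i j]

lemma HasWeakGrad.sub {V V' : Plane → Plane} {G G' : Plane → Mat2} (h : HasWeakGrad V G)
    (h' : HasWeakGrad V' G') :
    HasWeakGrad (fun x => V x - V' x) (fun x => G x - G' x) := by
  simpa only [sub_eq_add_neg] using h.add h'.neg

lemma HasWeakGrad.isW11 {V : Plane → Plane} {G : Plane → Mat2} (h : HasWeakGrad V G)
    {Ω : Set Plane} (hb : Bornology.IsBounded Ω) : IsW11WithGrad Ω V G := by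
  have hcl := hb.isCompact_closure
  refine ⟨(h.1.continuousOn.integrableOn_compact hcl).mono_set subset_closure, fun i j =>
    ⟨((h.2.1 i j).integrableOn_isCompact hcl).mono_set subset_closure, fun φ hφ => ?_⟩⟩
  rw [setIntegral_eq_integral_of_forall_compl_eq_zero fun x hx => by
      rw [hφ.fderiv_eq_zero hx]; simp,
    setIntegral_eq_integral_of_forall_compl_eq_zero fun x hx => by rw [hφ.eq_zero hx, mul_zero]]
  exact h.2.2 φ hφ.1 hφ.2.1 i j

lemma matVec_apply (F : Mat2) (x : Plane) (i : Fin 2) :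
    matVec F x i = F i 0 * x 0 + F i 1 * x 1 := by
  show (F *ᵥ x.ofLp) i = _
  rw [Matrix.mulVec, dotProduct, Fin.sum_univ_two]

/-- The affine map `x ↦ Q x + b`. -/
def affine (Q : Mat2) (b : Plane) (x : Plane) : Plane := matVec Q x + b

/-- Integration by parts for Lipschitz functions, with the derivative along `v` known almost
everywhere; applied to affine functions and to their positive parts. -/
lemma integral_mul_fderiv_of_lipschitz {f g : Plane → ℝ} {K : NNReal} (hf : LipschitzWith K f)
    {v : Plane} (hg : ∀ᵐ x, HasLineDerivAt ℝ f (g x) x v) {φ : Plane → ℝ}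
    (hφ : ContDiff ℝ ∞ φ) (hs : HasCompactSupport φ) :
    ∫ x, f x * fderiv ℝ φ x v = - ∫ x, g x * φ x := by
  obtain ⟨D, hD⟩ := hφ.lipschitzWith_of_hasCompactSupport hs (by simp)
  have h := LipschitzWith.integral_lineDeriv_mul_eq (μ := volume) hf hD hs v
  have h1 : ∫ x, lineDeriv ℝ f x v * φ x = ∫ x, g x * φ x := by
    apply integral_congr_ae
    filter_upwards [hg] with x hx
    rw [hx.lineDeriv]
  have h2 : ∫ x, lineDeriv ℝ φ x (-v) * f x = - ∫ x, f x * fderiv ℝ φ x v := by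
    rw [← integral_neg]
    congr 1; ext x
    rw [((hφ.differentiable (by simp)) x).lineDeriv_eq_fderiv, map_neg]; ring
  rw [← h1, h, h2, neg_neg]

lemma hasWeakGrad_affine (Q : Mat2) (b : Plane) : HasWeakGrad (affine Q b) fun _ => Q := by
  refine ⟨?_, fun i j => (continuous_const).locallyIntegrable, fun φ hφ hs i j => ?_⟩
  · unfold affine matVec; fun_prop
  have hlip : LipschitzWith (‖(Q i 0) • (EuclideanSpace.proj 0 : Plane →L[ℝ] ℝ) +
      (Q i 1) • (EuclideanSpace.proj 1 : Plane →L[ℝ] ℝ)‖₊) fun x : Plane => affine Q b x i := by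
    have := ((Q i 0) • (EuclideanSpace.proj 0 : Plane →L[ℝ] ℝ) +
      (Q i 1) • (EuclideanSpace.proj 1 : Plane →L[ℝ] ℝ)).lipschitz
    refine LipschitzWith.of_dist_le_mul fun x y => ?_
    have h := this.dist_le_mul x y
    simp only [affine, PiLp.add_apply, matVec_apply, dist_add_right]
    simpa using h
  refine integral_mul_fderiv_of_lipschitz hlip (Eventually.of_forall fun x => ?_) hφ hs
  unfold HasLineDerivAt
  simp only [affine, PiLp.add_apply, matVec_apply, PiLp.smul_apply, smul_eq_mul]
  have : ∀ t : ℝ, Q i 0 * (x 0 + t * (unitVec j) 0) + Q i 1 * (x 1 + t * (unitVec j) 1) + b i =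
      Q i j * t + (Q i 0 * x 0 + Q i 1 * x 1 + b i) := by
    intro t; fin_cases j <;> simp <;> ring
  simp_rw [this]
  simpa using ((hasDerivAt_id (0 : ℝ)).const_mul (Q i j)).add_const
    (Q i 0 * x 0 + Q i 1 * x 1 + b i)

/-- The positive part of an affine function. -/
def hinge (n : Fin 2 → ℝ) (c : ℝ) (x : Plane) : ℝ := max 0 (n 0 * x 0 + n 1 * x 1 + c)

lemma lipschitz_affineForm (n : Fin 2 → ℝ) (c : ℝ) :
    ∃ K, LipschitzWith K fun x : Plane => n 0 * x 0 + n 1 * x 1 + c := by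
  refine ⟨_, LipschitzWith.of_dist_le_mul (K := ‖(n 0) • (EuclideanSpace.proj 0 : Plane →L[ℝ] ℝ) +
      (n 1) • (EuclideanSpace.proj 1 : Plane →L[ℝ] ℝ)‖₊) fun x y => ?_⟩
  have h := ((n 0) • (EuclideanSpace.proj 0 : Plane →L[ℝ] ℝ) +
      (n 1) • (EuclideanSpace.proj 1 : Plane →L[ℝ] ℝ)).lipschitz.dist_le_mul x y
  rw [dist_add_right]
  simpa using h

/-- The zero set is the preimage of a point under a surjective linear form, hence null. -/
lemma ae_affineForm_ne_zero {n : Fin 2 → ℝ} (hn : n ≠ 0) (c : ℝ) :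
    ∀ᵐ x : Plane, n 0 * x 0 + n 1 * x 1 + c ≠ 0 := by
  set L : Plane →ₗ[ℝ] ℝ := ((n 0) • (EuclideanSpace.proj 0 : Plane →L[ℝ] ℝ) +
      (n 1) • (EuclideanSpace.proj 1 : Plane →L[ℝ] ℝ)).toLinearMap with hL
  have hLx : ∀ x, L x = n 0 * x 0 + n 1 * x 1 := fun x => by simp [hL]
  have hsurj : Function.Surjective L := by
    apply LinearMap.surjective
    intro h0
    apply hn
    ext i
    have := LinearMap.congr_fun h0 (unitVec i)
    rw [hLx] at this
    fin_cases i <;> simpa using this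
  have := (ae_comp_linearMap_mem_iff (μ := (volume : Measure Plane)) (ν := (volume : Measure ℝ))
    (L := L) hsurj (s := {-c}ᶜ) (measurableSet_singleton _).compl).2
    (by simpa using Measure.ae_ne (volume : Measure ℝ) (-c))
  filter_upwards [this] with x hx h0
  apply hx
  rw [mem_singleton_iff, hLx]; linarith

/-- On the line of the kink the gradient takes the value of the upper side. This convention lets
`Connects` prescribe the gradient at every point, with half-open strips. -/
lemma hasWeakGrad_hinge {n : Fin 2 → ℝ} (hn : n ≠ 0) (c : ℝ) (z : Plane) :
    HasWeakGrad (fun x => hinge n c x • z)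
      (fun x => if 0 ≤ n 0 * x 0 + n 1 * x 1 + c then Matrix.of fun i j => z i * n j else 0) := by
  obtain ⟨K, hK⟩ := lipschitz_affineForm n c
  have hKm : LipschitzWith K (hinge n c) := by
    have := hK.max_const 0
    unfold hinge
    simpa only [max_comm] using this
  refine ⟨hKm.continuous.smul continuous_const, fun i j => ?_, fun φ hφ hs i j => ?_⟩
  · refine (locallyIntegrable_const |z i * n j|).mono ?_ (Eventually.of_forall fun x => ?_)
    · have hm : MeasurableSet {x : Plane | 0 ≤ n 0 * x 0 + n 1 * x 1 + c} :=
        (isClosed_le continuous_const hK.continuous).measurableSet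
      have : (fun x : Plane => (if 0 ≤ n 0 * x 0 + n 1 * x 1 + c then
          (Matrix.of fun i j => z i * n j : Mat2) else 0) i j) =
          {x : Plane | 0 ≤ n 0 * x 0 + n 1 * x 1 + c}.indicator fun _ => z i * n j := by
        ext x
        by_cases h : 0 ≤ n 0 * x 0 + n 1 * x 1 + c <;> simp [h]
      rw [this]
      exact (measurable_const.indicator hm).aestronglyMeasurable
    · by_cases h : 0 ≤ n 0 * x 0 + n 1 * x 1 + c
      · simp [h]
      · simp [h]; positivity
  · have h := integral_mul_fderiv_of_lipschitz (v := unitVec j) hKm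
      (g := fun x => if 0 ≤ n 0 * x 0 + n 1 * x 1 + c then n j else 0) ?_ hφ hs
    · have e1 : ∀ x, (hinge n c x • z) i * fderiv ℝ φ x (unitVec j) =
          z i * (hinge n c x * fderiv ℝ φ x (unitVec j)) := fun x => by
        simp only [PiLp.smul_apply, smul_eq_mul]; ring
      have e2 : ∀ x : Plane, (if 0 ≤ n 0 * x 0 + n 1 * x 1 + c then
          (Matrix.of fun i j => z i * n j : Mat2) else 0) i j * φ x =
          z i * ((if 0 ≤ n 0 * x 0 + n 1 * x 1 + c then n j else 0) * φ x) := fun x => by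
        by_cases h : 0 ≤ n 0 * x 0 + n 1 * x 1 + c <;> simp [h, mul_assoc]
      simp_rw [e1, e2]
      rw [integral_const_mul, integral_const_mul, h]; ring
    · filter_upwards [ae_affineForm_ne_zero hn c] with x hx
      have hlin : HasLineDerivAt ℝ (fun x : Plane => n 0 * x 0 + n 1 * x 1 + c) (n j) x
          (unitVec j) := by
        unfold HasLineDerivAt
        have : ∀ t : ℝ, n 0 * (x + t • unitVec j) 0 + n 1 * (x + t • unitVec j) 1 + c =
            n j * t + (n 0 * x 0 + n 1 * x 1 + c) := by
          intro t; fin_cases j <;> simp <;> ring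
        simp_rw [this]
        simpa using ((hasDerivAt_id (0 : ℝ)).const_mul (n j)).add_const
          (n 0 * x 0 + n 1 * x 1 + c)
      rcases lt_or_gt_of_ne hx with h | h
      · rw [if_neg (not_le.2 h)]
        refine HasLineDerivAt.congr_of_eventuallyEq (f := fun _ => (0 : ℝ))
          (by unfold HasLineDerivAt; exact hasDerivAt_const _ _) ?_
        filter_upwards [hK.continuous.continuousAt.eventually (gt_mem_nhds h)] with y hy
        exact max_eq_left (le_of_lt hy)
      · rw [if_pos h.le]
        refine hlin.congr_of_eventuallyEq ?_
        filter_upwards [hK.continuous.continuousAt.eventually (lt_mem_nhds h)] with y hy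
        exact max_eq_right (le_of_lt hy)

end WeakGradients

/-! ### Gluing maps in adjacent horizontal strips. -/

section Connections

/-- In the strip `|x₁| ≤ M` there is a map with weak gradient that is equal to the affine map
`x ↦ Q x + b` below the height `y` and to `x ↦ Q' x + b'` above the height `y'`, and that satisfies
`P` in between. -/
def Connects (M y y' : ℝ) (Q : Mat2) (b : Plane) (Q' : Mat2) (b' : Plane)
    (P : Plane → Plane → Mat2 → Prop) : Prop :=
  ∃ V G, HasWeakGrad V G ∧ ∀ x : Plane, |x 0| ≤ M →
    (x 1 < y → V x = affine Q b x ∧ G x = Q) ∧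
    (y ≤ x 1 → x 1 < y' → P x (V x) (G x)) ∧
    (y' ≤ x 1 → V x = affine Q' b' x ∧ G x = Q')

variable {M y y' y'' : ℝ} {Q Q' Q'' : Mat2} {b b' b'' : Plane}
  {P P' : Plane → Plane → Mat2 → Prop}

lemma Connects.mono (h : Connects M y y' Q b Q' b' P)
    (hP : ∀ x v g, y ≤ x 1 → x 1 < y' → P x v g → P' x v g) : Connects M y y' Q b Q' b' P' := by
  obtain ⟨V, G, hVG, hx⟩ := h
  exact ⟨V, G, hVG, fun x hxM => ⟨(hx x hxM).1,
    fun h1 h2 => hP _ _ _ h1 h2 ((hx x hxM).2.1 h1 h2), (hx x hxM).2.2⟩⟩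

lemma Connects.refl (Q : Mat2) (b : Plane)
    (hP : ∀ x, y ≤ x 1 → x 1 < y' → P x (affine Q b x) Q) : Connects M y y' Q b Q b P :=
  ⟨_, _, hasWeakGrad_affine Q b, fun x _ => ⟨fun _ => ⟨rfl, rfl⟩, fun h1 h2 => hP x h1 h2,
    fun _ => ⟨rfl, rfl⟩⟩⟩

lemma Connects.trans (hy : y ≤ y') (hy' : y' ≤ y'') (h : Connects M y y' Q b Q' b' P)
    (h' : Connects M y' y'' Q' b' Q'' b'' P) : Connects M y y'' Q b Q'' b'' P := by
  obtain ⟨V, G, hVG, hx⟩ := h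
  obtain ⟨V', G', hVG', hx'⟩ := h'
  -- The glued map is `V + V'` minus the common affine map: below `y'` the latter cancels `V'`,
  -- above `y'` it cancels `V`.
  refine ⟨_, _, (hVG.add hVG').sub (hasWeakGrad_affine Q' b'), fun x hxM => ?_⟩
  obtain ⟨a1, a2, a3⟩ := hx x hxM
  obtain ⟨c1, c2, c3⟩ := hx' x hxM
  refine ⟨fun h1 => ?_, fun h1 h2 => ?_, fun h1 => ?_⟩
  · rw [(a1 h1).1, (a1 h1).2, (c1 (h1.trans_le hy)).1, (c1 (h1.trans_le hy)).2]
    simp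
  · rcases lt_or_ge (x 1) y' with h | h
    · rw [(c1 h).1, (c1 h).2, add_sub_cancel_right, add_sub_cancel_right]
      exact a2 h1 h
    · rw [(a3 h).1, (a3 h).2, add_sub_cancel_left, add_sub_cancel_left]
      exact c2 h h2
  · rw [(a3 (hy'.trans h1)).1, (a3 (hy'.trans h1)).2, (c3 h1).1, (c3 h1).2]
    simp

lemma Connects.chain {y : ℕ → ℝ} (hy : Monotone y) {Q : ℕ → Mat2} {b : ℕ → Plane} (n : ℕ)
    (h : ∀ m < n, Connects M (y m) (y (m + 1)) (Q m) (b m) (Q (m + 1)) (b (m + 1)) P) :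
    Connects M (y 0) (y n) (Q 0) (b 0) (Q n) (b n) P := by
  induction n with
  | zero => exact Connects.refl _ _ fun x h1 h2 => absurd h2 (not_lt.2 h1)
  | succ n ih =>
    exact (ih fun m hm => h m (hm.trans (Nat.lt_succ_self n))).trans (hy (Nat.zero_le n))
      (hy (Nat.le_succ n)) (h n (Nat.lt_succ_self n))

end Connections

end LayeredBV
end

open scoped ENNReal

noncomputable section

namespace LayeredBV

/-! ### Rotations and sheared rotations. -/

section Rotations

/-- The rotation by the angle `θ`. -/
def rot (θ : ℝ) : Mat2 := !![Real.cos θ, -Real.sin θ; Real.sin θ, Real.cos θ]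

lemma mem_SO2_iff (R : Mat2) :
    R ∈ SO2 ↔ R 1 1 = R 0 0 ∧ R 0 1 = -R 1 0 ∧ R 0 0 ^ 2 + R 1 0 ^ 2 = 1 := by
  simp only [SO2, mem_ofPred_eq, Matrix.mem_specialOrthogonalGroup_iff,
    Matrix.mem_orthogonalGroup_iff, Matrix.det_fin_two]
  constructor
  · rintro ⟨h, hd⟩
    have h00 := congrFun (congrFun h 0) 0
    have h01 := congrFun (congrFun h 0) 1
    have h11 := congrFun (congrFun h 1) 1
    simp [Matrix.mul_apply, Fin.sum_univ_two] at h00 h01 h11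
    refine ⟨?_, ?_, ?_⟩
    · linear_combination (-R 1 1) * h00 + R 0 1 * h01 + R 0 0 * hd
    · linear_combination (-R 0 1) * h11 + R 1 1 * h01 - R 1 0 * hd
    · have e1 : R 1 1 = R 0 0 := by
        linear_combination (-R 1 1) * h00 + R 0 1 * h01 + R 0 0 * hd
      have e2 : R 0 1 = -R 1 0 := by
        linear_combination (-R 0 1) * h11 + R 1 1 * h01 - R 1 0 * hd
      rw [e1, e2] at hd
      linarith
  · rintro ⟨h1, h2, h3⟩
    refine ⟨?_, ?_⟩
    · ext i j
      fin_cases i <;> fin_cases j <;>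
        simp [Matrix.mul_apply, Fin.sum_univ_two, h1, h2] <;> linarith
    · rw [h1, h2]; linarith

lemma rot_mem_SO2 (θ : ℝ) : rot θ ∈ SO2 := by
  rw [mem_SO2_iff]
  simp [rot]

lemma exists_eq_rot {R : Mat2} (hR : R ∈ SO2) : ∃ θ, |θ| ≤ Real.pi ∧ R = rot θ := by
  obtain ⟨h1, h2, h3⟩ := (mem_SO2_iff R).1 hR
  set z : ℂ := ⟨R 0 0, R 1 0⟩ with hz
  have hn : ‖z‖ = 1 := by
    rw [← sq_eq_sq₀ (norm_nonneg _) zero_le_one, Complex.sq_norm, Complex.normSq_apply]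
    simp only [hz]; linarith
  have hz0 : z ≠ 0 := by rw [← norm_ne_zero_iff, hn]; exact one_ne_zero
  refine ⟨z.arg, Complex.abs_arg_le_pi z, ?_⟩
  have hc : Real.cos z.arg = R 0 0 := by rw [Complex.cos_arg hz0, hn, div_one]
  have hs : Real.sin z.arg = R 1 0 := by rw [Complex.sin_arg, hn, div_one]
  ext i j
  fin_cases i <;> fin_cases j <;> simp [rot, hc, hs, h1, h2]

lemma norm_sq_plane (x : Plane) : ‖x‖ ^ 2 = x 0 ^ 2 + x 1 ^ 2 := by
  rw [EuclideanSpace.norm_sq_eq, Fin.sum_univ_two, Real.norm_eq_abs, Real.norm_eq_abs, sq_abs,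
    sq_abs]

lemma norm_matVec_of_mem_SO2 {R : Mat2} (hR : R ∈ SO2) (x : Plane) : ‖matVec R x‖ = ‖x‖ := by
  obtain ⟨h1, h2, h3⟩ := (mem_SO2_iff R).1 hR
  rw [← sq_eq_sq₀ (norm_nonneg _) (norm_nonneg _), norm_sq_plane, norm_sq_plane, matVec_apply,
    matVec_apply, h1, h2]
  linear_combination (x 0 ^ 2 + x 1 ^ 2) * h3

lemma abs_entry_le_one {R : Mat2} (hR : R ∈ SO2) (i j : Fin 2) : |R i j| ≤ 1 := by
  obtain ⟨h1, h2, h3⟩ := (mem_SO2_iff R).1 hR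
  have e0 : |R 0 0| ≤ 1 := by rw [abs_le_one_iff_mul_self_le_one]; nlinarith [sq_nonneg (R 1 0)]
  have e1 : |R 1 0| ≤ 1 := by rw [abs_le_one_iff_mul_self_le_one]; nlinarith [sq_nonneg (R 0 0)]
  fin_cases i <;> fin_cases j <;> simp [h1, h2, e0, e1]

/-- The first column of a matrix. -/
def col₁ (Q : Mat2) : Plane := matVec Q (unitVec 0)

lemma col₁_apply (Q : Mat2) (i : Fin 2) : col₁ Q i = Q i 0 := by
  simp [col₁, matVec_apply]

lemma norm_col₁ {Q : Mat2} (hQ : Q ∈ SO2) : ‖col₁ Q‖ = 1 := by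
  rw [col₁, norm_matVec_of_mem_SO2 hQ]; simp

/-- The gradient `Q (I + γ e₁ ⊗ e₂)` of a simple shear followed by a rotation. -/
def shear (Q : Mat2) (γ : ℝ) : Mat2 :=
  Matrix.of fun i j => Q i j + γ * Q i 0 * (if j = 1 then 1 else 0)

lemma shear_mem_slipMatrices {Q : Mat2} (hQ : Q ∈ SO2) (γ : ℝ) : shear Q γ ∈ slipMatrices := by
  obtain ⟨h1, h2, h3⟩ := (mem_SO2_iff Q).1 hQ
  refine ⟨?_, ?_⟩
  · rw [Matrix.det_fin_two]; simp [shear]; rw [h1, h2]; linear_combination h3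
  · rw [← sq_eq_sq₀ (norm_nonneg _) zero_le_one, norm_sq_plane, matVec_apply, matVec_apply]
    simp [shear]; linarith

lemma SO2_subset_slipMatrices {Q : Mat2} (hQ : Q ∈ SO2) : Q ∈ slipMatrices := by
  have : Q = shear Q 0 := by ext i j; simp [shear]
  rw [this]; exact shear_mem_slipMatrices hQ 0

lemma abs_shear_le {Q : Mat2} (hQ : Q ∈ SO2) (γ : ℝ) (i j : Fin 2) :
    |shear Q γ i j| ≤ 1 + |γ| := by
  have h1 := abs_entry_le_one hQ i j
  have h2 := abs_entry_le_one hQ i 0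
  simp only [shear, Matrix.of_apply]
  refine (abs_add_le _ _).trans (add_le_add h1 ?_)
  rw [abs_mul, abs_mul]
  calc |γ| * |Q i 0| * |if j = 1 then (1 : ℝ) else 0| ≤ |γ| * 1 * 1 := by
        gcongr
        split_ifs <;> simp
    _ = |γ| := by ring

end Rotations

/-! ### Transitions inside one soft layer. -/

section Cells

variable {M : ℝ}

/-- A shear in a horizontal layer produces a translation in the direction `Q e₁`. -/
lemma connects_shear {y h : ℝ} (hh : 0 < h) {Q : Mat2} (hQ : Q ∈ SO2) (b : Plane) (s : ℝ) :
    Connects M y (y + h) Q b Q (b + s • col₁ Q) fun x v g =>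
      g ∈ slipMatrices ∧ (∀ i j, |g i j| ≤ 1 + |s| / h) ∧
      ∃ τ ∈ Icc (0 : ℝ) 1, v = affine Q b x + (τ * s) • col₁ Q := by
  set n : Fin 2 → ℝ := ![0, 1] with hn
  have hn0 : n ≠ 0 := fun h => by simpa [hn] using congrFun h 1
  set z : Plane := (s / h) • col₁ Q with hz
  -- One hinge switches the shear on at height `y`, the other switches it off at `y + h`.
  refine ⟨_, _, ((hasWeakGrad_affine Q b).add (hasWeakGrad_hinge hn0 (-y) z)).sub
    (hasWeakGrad_hinge hn0 (-(y + h)) z), fun x hxM => ?_⟩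
  have e : ∀ c, n 0 * x 0 + n 1 * x 1 + c = x 1 + c := fun c => by simp [hn]
  have hsh : ∀ g : Mat2, g = shear Q (s / h) → g ∈ slipMatrices ∧ ∀ i j, |g i j| ≤ 1 + |s| / h := by
    rintro g rfl
    refine ⟨shear_mem_slipMatrices hQ _, fun i j => (abs_shear_le hQ _ i j).trans ?_⟩
    rw [abs_div, abs_of_pos hh]
  simp only [hinge, e]
  refine ⟨fun h1 => ?_, fun h1 h2 => ?_, fun h1 => ?_⟩
  · rw [if_neg (by linarith), if_neg (by linarith), max_eq_left (by linarith),
      max_eq_left (by linarith)]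
    simp
  · rw [if_pos (by linarith), if_neg (by linarith), max_eq_right (by linarith),
      max_eq_left (by linarith)]
    obtain ⟨h3, h4⟩ := hsh (Q + (Matrix.of fun i j => z i * n j) - 0) (by
      ext i j
      fin_cases j <;> simp [shear, hz, hn, col₁_apply])
    refine ⟨h3, h4, (x 1 - y) / h, ⟨by apply div_nonneg <;> linarith, ?_⟩, ?_⟩
    · rw [div_le_one hh]; linarith
    · rw [zero_smul, sub_zero, hz, smul_smul]
      congr 2; field_simp; ring
  · rw [if_pos (by linarith), if_pos (by linarith), max_eq_right (by linarith),
      max_eq_right (by linarith)]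
    refine ⟨?_, by simp⟩
    rw [hz, smul_smul, smul_smul, affine, affine, add_sub_assoc, ← sub_smul, add_assoc]
    congr 3; field_simp; ring

/-- One component of the map of `connects_rotation` above the layer. It shows that the translation
`d` chosen there is the constant term; `key` is the compatibility of the two rotations. -/
lemma rotation_transition_identity {h : ℝ} (hh : h ≠ 0) {M q A₀ A₁ B₀ B₁ : ℝ}
    (key : A₁ + q * A₀ = B₁ - q * B₀) (x₀ x₁ y b : ℝ) :
    A₀ * x₀ + A₁ * x₁ + b + (x₁ + -y) * ((q - 2 * M / h) * A₀) +
      ((x₁ - y) * (2 * M) - (x₀ + M) * h) * ((A₀ - B₀) / h) -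
      (x₁ + -(y + h)) * ((-q - 2 * M / h) * B₀) =
    B₀ * x₀ + B₁ * x₁ + (b + (-(y * q) * (A₀ + B₀) - M * (A₀ - B₀) +
      (-q - 2 * M / h) * h * B₀)) := by
  field_simp
  linear_combination (h * x₁) * key

set_option maxHeartbeats 800000 in
/-- In a horizontal layer one can pass from one rotation to another one, up to an
angle of `π / 2`, along a diagonal interface. -/
lemma connects_rotation {Y y h : ℝ} (hM : 0 < M) (hh : 0 < h) (h1 : h ≤ 1) (hy : |y| ≤ Y)
    {θ θ' : ℝ} (hθ : |θ' - θ| ≤ Real.pi / 2) :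
    ∃ d : Plane, ‖d‖ ≤ 2 * Y + 8 * M + 1 ∧ ∀ b, Connects M y (y + h) (rot θ) b (rot θ') (b + d)
      fun x v g => g ∈ slipMatrices ∧ (∀ i j, |g i j| ≤ (2 * M + 2) / h) ∧
        (‖x‖ ≤ M → ‖v - b‖ ≤ 8 * M + 1) := by
  set δ := θ' - θ with hδ
  have hcδ : 0 ≤ Real.cos δ := Real.cos_nonneg_of_mem_Icc (abs_le.1 hθ)
  have hden : 0 < 1 + Real.cos δ := by linarith
  -- This is `-tan (δ/2)`; the restriction of the angle gives `cos δ ≥ 0` and therefore `|q| ≤ 1`.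
  set q := -Real.sin δ / (1 + Real.cos δ) with hq
  have hqe : q * (1 + Real.cos δ) = -Real.sin δ := by rw [hq]; field_simp
  have hqabs : |q| ≤ 1 := by
    rw [hq, abs_div, abs_of_pos hden, div_le_one hden, abs_neg]
    linarith [Real.abs_sin_le_one δ]
  have hpyδ := Real.sin_sq_add_cos_sq δ
  have hθ' : θ' = θ + δ := by rw [hδ]; ring
  have hcos' : Real.cos θ' = Real.cos θ * Real.cos δ - Real.sin θ * Real.sin δ := by
    rw [hθ', Real.cos_add]
  have hsin' : Real.sin θ' = Real.sin θ * Real.cos δ + Real.cos θ * Real.sin δ := by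
    rw [hθ', Real.sin_add]
  -- `id1` and `id2` are the two components of `Q e₂ + q Q e₁ = Q' e₂ - q Q' e₁`.
  have id1 : Real.sin θ - Real.sin θ' = q * (Real.cos θ' + Real.cos θ) := by
    apply mul_right_cancel₀ hden.ne'
    rw [mul_right_comm, hqe, hcos', hsin']
    linear_combination -Real.sin θ * hpyδ
  have id2 : Real.cos θ' - Real.cos θ = q * (Real.sin θ' + Real.sin θ) := by
    apply mul_right_cancel₀ hden.ne'
    rw [mul_right_comm, hqe, hcos', hsin']
    linear_combination Real.cos θ * hpyδ
  set Q := rot θ with hQd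
  set Q' := rot θ' with hQ'd
  have hQ : Q ∈ SO2 := rot_mem_SO2 θ
  have hQ' : Q' ∈ SO2 := rot_mem_SO2 θ'
  set p := col₁ Q with hp
  set p' := col₁ Q' with hp'
  have hpn : ‖p‖ = 1 := norm_col₁ hQ
  have hpn' : ‖p'‖ = 1 := norm_col₁ hQ'
  -- With these amounts of shear the difference of `shear Q' γ₂` and `shear Q γ₁` is `z ⊗ m`, where
  -- `m = (-h, 2M)` is normal to the diagonal of the cell: the first column forces `z = (p - p') /
  -- h`, and the second is the relation above.
  set γ₁ := q - 2 * M / h with hγ₁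
  set γ₂ := -q - 2 * M / h with hγ₂
  have hγ₁h : γ₁ * h = q * h - 2 * M := by rw [hγ₁]; field_simp
  have hγ₂h : γ₂ * h = -q * h - 2 * M := by rw [hγ₂]; field_simp
  have hMh : 0 < 2 * M / h := by positivity
  have hγ₁a : |γ₁| ≤ 1 + 2 * M / h := by
    refine (abs_sub _ _).trans ?_
    rw [abs_of_pos hMh]; linarith
  have hγ₂a : |γ₂| ≤ 1 + 2 * M / h := by
    refine (abs_sub _ _).trans ?_
    rw [abs_of_pos hMh, abs_neg]; linarith
  have hbound : ∀ γ, |γ| ≤ 1 + 2 * M / h → 1 + |γ| ≤ (2 * M + 2) / h := by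
    intro γ hγ
    have : 2 ≤ 2 / h := by rw [le_div_iff₀ hh]; linarith
    rw [add_div]; linarith
  set z : Plane := h⁻¹ • (p - p') with hz
  have hzn : h * ‖z‖ ≤ 2 := by
    rw [hz, norm_smul, Real.norm_of_nonneg (inv_nonneg.2 hh.le), ← mul_assoc,
      mul_inv_cancel₀ hh.ne', one_mul]
    refine (norm_sub_le _ _).trans ?_
    rw [hpn, hpn']; norm_num
  -- The constant that remains above the layer once the linear part is `Q'`. It does not depend on
  -- `b`, so it can be compensated in advance.
  set d : Plane := (-(y * q)) • (p + p') - M • (p - p') + (γ₂ * h) • p' with hd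
  have hdn : ‖d‖ ≤ 2 * Y + 8 * M + 1 := by
    have a1 : ‖(-(y * q)) • (p + p')‖ ≤ 2 * Y := by
      rw [norm_smul, norm_neg, norm_mul, Real.norm_eq_abs, Real.norm_eq_abs]
      have : ‖p + p'‖ ≤ 2 := (norm_add_le _ _).trans (by rw [hpn, hpn']; norm_num)
      have hY : 0 ≤ Y := (abs_nonneg y).trans hy
      calc |y| * |q| * ‖p + p'‖ ≤ Y * 1 * 2 := by gcongr
        _ = 2 * Y := by ring
    have a2 : ‖M • (p - p')‖ ≤ 2 * M := by
      rw [norm_smul, Real.norm_of_nonneg hM.le]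
      have : ‖p - p'‖ ≤ 2 := (norm_sub_le _ _).trans (by rw [hpn, hpn']; norm_num)
      nlinarith
    have a3 : ‖(γ₂ * h) • p'‖ ≤ 1 + 2 * M := by
      rw [norm_smul, hpn', mul_one, Real.norm_eq_abs, abs_mul, abs_of_pos hh]
      calc |γ₂| * h ≤ (1 + 2 * M / h) * h := by gcongr
        _ = h + 2 * M := by field_simp
        _ ≤ _ := by linarith
    have := norm_add_le ((-(y * q)) • (p + p') - M • (p - p')) ((γ₂ * h) • p')
    have := norm_sub_le ((-(y * q)) • (p + p')) (M • (p - p'))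
    rw [hd]; linarith
  refine ⟨d, hdn, fun b => ?_⟩
  set n : Fin 2 → ℝ := ![0, 1] with hn
  -- The interface runs from `(-M, y)` to `(M, y + h)`. For `|x₁| > M` its line leaves the layer,
  -- which is why `Connects` is confined to a vertical strip.
  set m : Fin 2 → ℝ := ![-h, 2 * M] with hm
  have hn0 : n ≠ 0 := fun h => by simpa [hn] using congrFun h 1
  have hm0 : m ≠ 0 := fun h => by
    have := congrFun h 1
    simp [hm] at this; linarith
  -- The three hinges switch on the shear of `Q`, replace it across the diagonal by the sheared
  -- `Q'`, and switch off the shear of `Q'`.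
  refine ⟨_, _, (((hasWeakGrad_affine Q b).add (hasWeakGrad_hinge hn0 (-y) (γ₁ • p))).add
    (hasWeakGrad_hinge hm0 (-(2 * M * y) - M * h) z)).sub
    (hasWeakGrad_hinge hn0 (-(y + h)) (γ₂ • p')), fun x hxM => ?_⟩
  have e : ∀ c, n 0 * x 0 + n 1 * x 1 + c = x 1 + c := fun c => by simp [hn]
  have e' : m 0 * x 0 + m 1 * x 1 + (-(2 * M * y) - M * h) =
      (x 1 - y) * (2 * M) - (x 0 + M) * h := by simp [hm]; ring
  obtain ⟨hxM1, hxM2⟩ := abs_le.1 hxM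
  simp only [hinge, e, e']
  have hg1 : Q + (Matrix.of fun i j => (γ₁ • p) i * n j) = shear Q γ₁ := by
    ext i j
    fin_cases j <;> simp [shear, hn, hp, col₁_apply]
  have hjump : Q + (Matrix.of fun i j => (γ₁ • p) i * n j) + (Matrix.of fun i j => z i * m j) =
      shear Q' γ₂ := by
    have hz' : ∀ i, z i * h = p i - p' i := fun i => by
      simp [hz]; field_simp
    ext i j
    fin_cases j
    · have := hz' i
      simp [shear, hn, hm, hp, hp', col₁_apply] at this ⊢
      linarith
    · have := hz' i
      have key : Q i 1 + q * Q i 0 = Q' i 1 - q * Q' i 0 := by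
        fin_cases i
        · simp [hQd, hQ'd, rot]; linarith
        · simp [hQd, hQ'd, rot]; linarith
      have hzz : z i * (2 * M) = 2 * M / h * (Q i 0 - Q' i 0) := by
        have : z i = (Q i 0 - Q' i 0) / h := by
          rw [eq_div_iff hh.ne', this, hp, hp', col₁_apply, col₁_apply]
        rw [this]; ring
      simp [shear, hn, hm, hp, col₁_apply]
      rw [hzz, hγ₁, hγ₂]
      linear_combination key
  refine ⟨fun h2 => ?_, fun h2 h3 => ?_, fun h2 => ?_⟩
  · have : (x 1 - y) * (2 * M) - (x 0 + M) * h < 0 := by nlinarith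
    rw [if_neg (by linarith), if_neg (by linarith), if_neg (by linarith),
      max_eq_left (by linarith), max_eq_left (by linarith), max_eq_left (by linarith)]
    simp
  · rw [if_pos (by linarith : 0 ≤ x 1 + -y), if_neg (by linarith : ¬ 0 ≤ x 1 + -(y + h)),
      max_eq_right (by linarith : 0 ≤ x 1 + -y), max_eq_left (by linarith : x 1 + -(y + h) ≤ 0),
      zero_smul, sub_zero, sub_zero]
    have hgrad : ∀ g : Mat2, (g = shear Q γ₁ ∨ g = shear Q' γ₂) →
        g ∈ slipMatrices ∧ ∀ i j, |g i j| ≤ (2 * M + 2) / h := by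
      rintro g (rfl | rfl)
      · exact ⟨shear_mem_slipMatrices hQ _, fun i j =>
          (abs_shear_le hQ _ i j).trans (hbound _ hγ₁a)⟩
      · exact ⟨shear_mem_slipMatrices hQ' _, fun i j =>
          (abs_shear_le hQ' _ i j).trans (hbound _ hγ₂a)⟩
    refine and_assoc.1 ⟨?_, fun hx => ?_⟩
    · apply hgrad
      by_cases h4 : 0 ≤ (x 1 - y) * (2 * M) - (x 0 + M) * h
      · right; rw [if_pos h4]; exact hjump
      · left; rw [if_neg h4, add_zero]; exact hg1
    · set L := max 0 ((x 1 - y) * (2 * M) - (x 0 + M) * h) with hL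
      have hL0 : 0 ≤ L := le_max_left _ _
      have hL1 : L ≤ 2 * M * h := by
        apply max_le (by positivity)
        have : 0 ≤ (x 0 + M) * h := by apply mul_nonneg <;> linarith
        nlinarith
      have b1 : ‖matVec Q x‖ ≤ M := by rw [norm_matVec_of_mem_SO2 hQ]; exact hx
      have b2 : ‖(x 1 + -y) • γ₁ • p‖ ≤ 1 + 2 * M := by
        rw [norm_smul, norm_smul, hpn, mul_one, Real.norm_of_nonneg (by linarith),
          Real.norm_eq_abs]
        calc (x 1 + -y) * |γ₁| ≤ h * (1 + 2 * M / h) := by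
              apply mul_le_mul _ hγ₁a (abs_nonneg _) hh.le
              linarith
          _ = h + 2 * M := by field_simp
          _ ≤ _ := by linarith
      have b3 : ‖L • z‖ ≤ 4 * M := by
        rw [norm_smul, Real.norm_of_nonneg hL0]
        calc L * ‖z‖ ≤ 2 * M * h * ‖z‖ := by gcongr
          _ = 2 * M * (h * ‖z‖) := by ring
          _ ≤ 2 * M * 2 := by gcongr
          _ = 4 * M := by ring
      have : affine Q b x + (x 1 + -y) • γ₁ • p + L • z - b =
          matVec Q x + (x 1 + -y) • γ₁ • p + L • z := by rw [affine]; abel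
      rw [this]
      have := norm_add₃_le (a := matVec Q x) (b := (x 1 + -y) • γ₁ • p) (c := L • z)
      linarith
  · have h3 : 0 ≤ (x 1 - y) * (2 * M) - (x 0 + M) * h := by nlinarith
    rw [if_pos (by linarith : 0 ≤ x 1 + -y), if_pos h3,
      if_pos (by linarith : 0 ≤ x 1 + -(y + h)), max_eq_right (by linarith : 0 ≤ x 1 + -y),
      max_eq_right h3, max_eq_right (by linarith : 0 ≤ x 1 + -(y + h)), hjump]
    refine ⟨?_, ?_⟩
    · have hz' : ∀ i, z i = (Q i 0 - Q' i 0) / h := fun i => by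
        simp [hz, hp, hp', col₁_apply]; field_simp
      ext i
      have key : Q i 1 + q * Q i 0 = Q' i 1 - q * Q' i 0 := by
        fin_cases i
        · simp [hQd, hQ'd, rot]; linarith
        · simp [hQd, hQ'd, rot]; linarith
      simp only [affine, PiLp.add_apply, PiLp.sub_apply, PiLp.smul_apply, smul_eq_mul,
        matVec_apply, hz', hd, hp, hp', col₁_apply]
      exact rotation_transition_identity hh.ne' key _ _ _ _
    · ext i j
      fin_cases j <;> simp [shear, hn, hp', col₁_apply]

end Cells

end LayeredBV
end

open scoped ENNReal

noncomputable section

namespace LayeredBV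

/-! ### Transitions over whole layers, respecting the rigid parts. -/

section Layers

/-- The pointwise constraints on the gradients of admissible maps. -/
def Layered (lam ε : ℝ) (x : Plane) (g : Mat2) : Prop :=
  g ∈ slipMatrices ∧ (lam ≤ Int.fract (x 1 / ε) → g ∈ SO2)

variable {M lam ε y : ℝ}

lemma layered_of_mem_SO2 {x : Plane} {g : Mat2} (hg : g ∈ SO2) : Layered lam ε x g :=
  ⟨SO2_subset_slipMatrices hg, fun _ => hg⟩

/-- The layer starts at a multiple of `ε` with its soft part of height `lam * ε`, which hosts the
transition; the rigid part above it carries the final rigid motion. -/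
lemma Connects.to_layer (hlam : lam ∈ Ioo (0 : ℝ) 1) (hε : 0 < ε) {k : ℤ} (hy : y = k * ε)
    {Q Q' : Mat2} {b b' : Plane} {P : Plane → Plane → Mat2 → Prop} (hQ' : Q' ∈ SO2)
    (h : Connects M y (y + lam * ε) Q b Q' b' P) (hslip : ∀ x v g, P x v g → g ∈ slipMatrices)
    (hrig : ∀ x, P x (affine Q' b' x) Q') :
    Connects M y (y + ε) Q b Q' b' fun x v g => Layered lam ε x g ∧ P x v g := by
  have hle : 0 < lam * ε := mul_pos hlam.1 hε
  have hle' : lam * ε < ε := by nlinarith [hlam.2]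
  refine Connects.trans (y' := y + lam * ε) (by linarith) (by linarith)
    (h.mono fun x v g h1 h2 hP => ⟨⟨hslip _ _ _ hP, fun h3 => ?_⟩, hP⟩)
    (Connects.refl _ _ fun x _ _ => ⟨layered_of_mem_SO2 hQ', hrig x⟩)
  exfalso
  have hfl : ⌊x 1 / ε⌋ = k := by
    rw [Int.floor_eq_iff]
    constructor
    · rw [le_div_iff₀ hε]; linarith
    · rw [div_lt_iff₀ hε]; linarith
  rw [← Int.self_sub_floor, hfl, le_sub_iff_add_le, le_div_iff₀ hε] at h3
  linarith

lemma layer_shear (hlam : lam ∈ Ioo (0 : ℝ) 1) (hε : 0 < ε) {k : ℤ} (hy : y = k * ε)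
    {Q : Mat2} (hQ : Q ∈ SO2) (b : Plane) (s : ℝ) :
    Connects M y (y + ε) Q b Q (b + s • col₁ Q) fun x v g =>
      Layered lam ε x g ∧ (∀ i j, |g i j| ≤ 1 + |s| / (lam * ε)) ∧
      ‖v - affine Q b x‖ ≤ |s| := by
  have hle : 0 < lam * ε := mul_pos hlam.1 hε
  have h := (connects_shear (M := M) (y := y) hle hQ b s).to_layer hlam hε hy hQ
    (fun x v g hP => hP.1) (fun x => ⟨SO2_subset_slipMatrices hQ, fun i j =>
      (abs_entry_le_one hQ i j).trans (by linarith [div_nonneg (abs_nonneg s) hle.le]),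
      1, by simp, by rw [affine, affine, one_mul, add_assoc]⟩)
  refine h.mono fun x v g _ _ hP => ⟨hP.1, hP.2.2.1, ?_⟩
  obtain ⟨τ, hτ, rfl⟩ := hP.2.2.2
  rw [add_sub_cancel_left, norm_smul, norm_col₁ hQ, mul_one, Real.norm_eq_abs, abs_mul,
    abs_of_nonneg hτ.1]
  nlinarith [hτ.2, abs_nonneg s]

lemma layer_shear_bound (hlam : lam ∈ Ioo (0 : ℝ) 1) (hε : 0 < ε) (hε1 : ε ≤ 1) {k : ℤ}
    (hy : y = k * ε) {Q : Mat2} (hQ : Q ∈ SO2) {b : Plane} {s β S K : ℝ} (hb : ‖b‖ ≤ β)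
    (hs : |s| ≤ S) (hK : M + β + S ≤ K) (hK' : 1 + S ≤ K) :
    Connects M y (y + ε) Q b Q (b + s • col₁ Q) fun x v g =>
      Layered lam ε x g ∧ (∀ i j, |g i j| ≤ K / (lam * ε)) ∧ (‖x‖ ≤ M → ‖v‖ ≤ K) := by
  have hle : 0 < lam * ε := mul_pos hlam.1 hε
  have hle1 : lam * ε ≤ 1 := by nlinarith [hlam.1, hlam.2]
  refine (layer_shear hlam hε hy hQ b s).mono fun x v g _ _ hP =>
    ⟨hP.1, fun i j => (hP.2.1 i j).trans ?_, fun hx => ?_⟩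
  · rw [le_div_iff₀ hle, add_mul, one_mul, div_mul_cancel₀ _ hle.ne']
    linarith
  · have h1 : ‖affine Q b x‖ ≤ M + β :=
      (norm_add_le _ _).trans (add_le_add (by rwa [norm_matVec_of_mem_SO2 hQ]) hb)
    have := norm_add_le (v - affine Q b x) (affine Q b x)
    rw [sub_add_cancel] at this
    linarith [hP.2.2]

/-- The displacement `d` is fixed before `b`, so that the displacements of several rotations can be
added up before the compensating shears are chosen. -/
lemma layer_rotation {Y : ℝ} (hM : 0 < M) (hlam : lam ∈ Ioo (0 : ℝ) 1) (hε : 0 < ε)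
    (hε1 : ε ≤ 1) {k : ℤ} (hy : y = k * ε) (hY : |y| ≤ Y) {θ θ' : ℝ}
    (hθ : |θ' - θ| ≤ Real.pi / 2) :
    ∃ d : Plane, ‖d‖ ≤ 2 * Y + 9 * M + 1 ∧ ∀ (b : Plane) (β K : ℝ), ‖b‖ ≤ β →
      β + (2 * Y + 9 * M + 1) ≤ K → 2 * M + 2 ≤ K →
      Connects M y (y + ε) (rot θ) b (rot θ') (b + d) fun x v g =>
        Layered lam ε x g ∧ (∀ i j, |g i j| ≤ K / (lam * ε)) ∧ (‖x‖ ≤ M → ‖v‖ ≤ K) := by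
  have hle : 0 < lam * ε := mul_pos hlam.1 hε
  have hle1 : lam * ε ≤ 1 := by nlinarith [hlam.1, hlam.2]
  have hY0 : 0 ≤ Y := (abs_nonneg y).trans hY
  obtain ⟨d, hd, hconn⟩ := connects_rotation hM hle hle1 hY hθ
  refine ⟨d, by linarith, fun b β K hb hK hK' => ?_⟩
  have hR := rot_mem_SO2 θ'
  refine (Connects.to_layer hlam hε hy hR (P := fun x v g => g ∈ slipMatrices ∧
    (∀ i j, |g i j| ≤ K / (lam * ε)) ∧ (‖x‖ ≤ M → ‖v‖ ≤ K)) ?_ (fun x v g hP => hP.1) ?_).mono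
    fun x v g _ _ hP => ⟨hP.1, hP.2.2⟩
  · refine (hconn b).mono fun x v g _ _ hP => ⟨hP.1, fun i j => (hP.2.1 i j).trans ?_, fun hx => ?_⟩
    · gcongr
    · have := norm_add_le (v - b) b
      rw [sub_add_cancel] at this
      linarith [hP.2.2 hx]
  · refine fun x => ⟨SO2_subset_slipMatrices hR, fun i j =>
      (abs_entry_le_one hR i j).trans ?_, fun hx => ?_⟩
    · rw [le_div_iff₀ hle]; linarith
    · have h1 : ‖affine (rot θ') (b + d) x‖ ≤ ‖x‖ + (‖b‖ + ‖d‖) :=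
        (norm_add_le _ _).trans (add_le_add (norm_matVec_of_mem_SO2 hR x).le (norm_add_le _ _))
      linarith

lemma Connects.of_eq {y y' z z' : ℝ} {Q Q' R R' : Mat2} {b b' c c' : Plane}
    {P : Plane → Plane → Mat2 → Prop} (h : Connects M y y' Q b Q' b' P) (h1 : y = z)
    (h2 : y' = z') (h3 : Q = R) (h4 : b = c) (h5 : Q' = R') (h6 : b' = c') :
    Connects M z z' R c R' c' P := by
  subst h1 h2 h3 h4 h5 h6; exact h

/-- Eight layers suffice to pass from an arbitrary rigid motion to another one. -/
lemma layers_jump {Y B : ℝ} (hM : 0 < M) (hlam : lam ∈ Ioo (0 : ℝ) 1) (hε : 0 < ε)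
    (hε1 : ε ≤ 1) {k : ℤ} (hy : y = k * ε) (hY : |y| + 8 ≤ Y) {Q Q' : Mat2} (hQ : Q ∈ SO2)
    (hQ' : Q' ∈ SO2) {b b' : Plane} (hb : ‖b‖ ≤ B) (hb' : ‖b'‖ ≤ B) :
    Connects M y (y + 8 * ε) Q b Q' b' fun x v g =>
      Layered lam ε x g ∧ (∀ i j, |g i j| ≤ (9 * B + 40 * (2 * Y + 9 * M + 1)) / (lam * ε)) ∧
        (‖x‖ ≤ M → ‖v‖ ≤ 9 * B + 40 * (2 * Y + 9 * M + 1)) := by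
  have hY0 : 0 ≤ Y := by linarith [abs_nonneg y]
  have hB : 0 ≤ B := (norm_nonneg b).trans hb
  set C := 2 * Y + 9 * M + 1 with hC
  set K := 9 * B + 40 * C with hK
  obtain ⟨θ, hθ, rfl⟩ := exists_eq_rot hQ
  obtain ⟨θ', hθ', rfl⟩ := exists_eq_rot hQ'
  have hyj : ∀ j : ℕ, j ≤ 8 → |y + j * ε| ≤ Y := fun j hj => by
    have hj' : (j : ℝ) ≤ 8 := by exact_mod_cast hj
    have h2 : |(j : ℝ) * ε| ≤ 8 := by
      rw [abs_of_nonneg (by positivity)]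
      nlinarith [Nat.cast_nonneg (α := ℝ) j]
    exact (abs_add_le _ _).trans (by linarith)
  have hkj : ∀ j : ℕ, y + j * ε = ((k + j : ℤ) : ℝ) * ε := fun j => by
    rw [hy]; push_cast; ring
  -- Both angles lie in `[-π, π]`, so four equal steps are each at most `π/2`.
  set φ := (θ' - θ) / 4 with hφ
  have hφa : |φ| ≤ Real.pi / 2 := by
    rw [hφ, abs_div, abs_of_pos (by norm_num : (0 : ℝ) < 4), div_le_iff₀ (by norm_num)]
    refine (abs_sub _ _).trans ?_
    linarith
  have hstep : ∀ (j : ℕ) (α : ℝ), j ≤ 8 → ∃ d : Plane, ‖d‖ ≤ C ∧ ∀ (b : Plane) (β : ℝ),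
      ‖b‖ ≤ β → β + C ≤ K → Connects M (y + j * ε) (y + j * ε + ε) (rot α) b (rot (α + φ)) (b + d)
        fun x v g => Layered lam ε x g ∧ (∀ i j, |g i j| ≤ K / (lam * ε)) ∧
          (‖x‖ ≤ M → ‖v‖ ≤ K) := by
    intro j α hj
    obtain ⟨d, hd, h⟩ := layer_rotation hM hlam hε hε1 (hkj j) (hyj j hj)
      (θ := α) (θ' := α + φ) (by rw [add_sub_cancel_left]; exact hφa)
    exact ⟨d, hd, fun b β h1 h2 => h b β K h1 h2 (by linarith)⟩
  obtain ⟨d₁, hd₁, h₁⟩ := layer_rotation hM hlam hε hε1 (hkj 1) (hyj 1 (by norm_num))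
    (θ := θ) (θ' := θ + Real.pi / 2)
    (by rw [add_sub_cancel_left, abs_of_pos (by positivity)])
  obtain ⟨d₃, hd₃, h₃⟩ := layer_rotation hM hlam hε hε1 (hkj 3) (hyj 3 (by norm_num))
    (θ := θ + Real.pi / 2) (θ' := θ)
    (by rw [sub_add_cancel_left, abs_neg, abs_of_pos (by positivity)])
  obtain ⟨d₄, hd₄, h₄⟩ := hstep 4 θ (by norm_num)
  obtain ⟨d₅, hd₅, h₅⟩ := hstep 5 (θ + φ) (by norm_num)
  obtain ⟨d₆, hd₆, h₆⟩ := hstep 6 (θ + φ + φ) (by norm_num)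
  obtain ⟨d₇, hd₇, h₇⟩ := hstep 7 (θ + φ + φ + φ) (by norm_num)
  -- The layers are: shear along `p`, quarter turn, shear along the orthogonal `p'`, turn back, four
  -- rotations by `φ`. The two shears must supply what the six rotations leave of `b' - b`, so `w`
  -- is expanded in the basis `p, p'`.
  set w : Plane := b' - b - (d₁ + d₃ + d₄ + d₅ + d₆ + d₇) with hw
  have hwn : ‖w‖ ≤ 2 * B + 6 * C := by
    have e1 := norm_sub_le (b' - b) (d₁ + d₃ + d₄ + d₅ + d₆ + d₇)
    have e2 := norm_sub_le b' b
    have e3 := norm_add_le (d₁ + d₃ + d₄ + d₅ + d₆) d₇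
    have e4 := norm_add_le (d₁ + d₃ + d₄ + d₅) d₆
    have e5 := norm_add_le (d₁ + d₃ + d₄) d₅
    have e6 := norm_add_le (d₁ + d₃) d₄
    have e7 := norm_add_le d₁ d₃
    rw [hw]; linarith
  set s₁ := w 0 * Real.cos θ + w 1 * Real.sin θ with hs₁
  set s₂ := -(w 0 * Real.sin θ) + w 1 * Real.cos θ with hs₂
  set S := 4 * B + 12 * C with hS
  have hw0 := abs_apply_le_norm w 0
  have hw1 := abs_apply_le_norm w 1
  have hmul : ∀ a c : ℝ, |a| ≤ ‖w‖ → |c| ≤ 1 → |a * c| ≤ ‖w‖ := fun a c h1 h2 => by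
    rw [abs_mul]; nlinarith [abs_nonneg a, abs_nonneg c]
  have hs₁S : |s₁| ≤ S := by
    have e1 := hmul _ _ hw0 (Real.abs_cos_le_one θ)
    have e2 := hmul _ _ hw1 (Real.abs_sin_le_one θ)
    refine (abs_add_le _ _).trans ?_
    linarith
  have hs₂S : |s₂| ≤ S := by
    have e1 := hmul _ _ hw0 (Real.abs_sin_le_one θ)
    have e2 := hmul _ _ hw1 (Real.abs_cos_le_one θ)
    refine (abs_add_le _ _).trans ?_
    rw [abs_neg]; linarith
  set p := col₁ (rot θ) with hp
  set p' := col₁ (rot (θ + Real.pi / 2)) with hp'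
  have hdec : s₁ • p + s₂ • p' = w := by
    have hpy := Real.sin_sq_add_cos_sq θ
    ext i
    fin_cases i
    · simp [hp, hp', col₁_apply, rot, Real.cos_add_pi_div_two, hs₁, hs₂]
      linear_combination w 0 * hpy
    · simp [hp, hp', col₁_apply, rot, Real.sin_add_pi_div_two, hs₁, hs₂]
      linear_combination w 1 * hpy
  have hps : ∀ (s : ℝ) (α : ℝ), |s| ≤ S → ‖s • col₁ (rot α)‖ ≤ S := fun s α h => by
    rwa [norm_smul, norm_col₁ (rot_mem_SO2 α), mul_one]
  have hp1 := hps s₁ θ hs₁S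
  have hp2 := hps s₂ (θ + Real.pi / 2) hs₂S
  rw [← hp] at hp1
  rw [← hp'] at hp2
  have g0 := layer_shear_bound (M := M) (K := K) hlam hε hε1 (hkj 0) (rot_mem_SO2 θ) hb hs₁S
    (by linarith) (by linarith)
  set b₁ := b + s₁ • p with hb₁
  have n1 : ‖b₁‖ ≤ B + S := (norm_add_le _ _).trans (by linarith)
  have g1 := h₁ b₁ (B + S) K n1 (by linarith) (by linarith)
  set b₂ := b₁ + d₁ with hb₂
  have n2 : ‖b₂‖ ≤ B + S + C := (norm_add_le _ _).trans (by linarith)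
  have g2 := layer_shear_bound (M := M) (K := K) hlam hε hε1 (hkj 2)
    (rot_mem_SO2 (θ + Real.pi / 2)) n2 hs₂S (by linarith) (by linarith)
  set b₃ := b₂ + s₂ • p' with hb₃
  have n3 : ‖b₃‖ ≤ B + 2 * S + C := (norm_add_le _ _).trans (by linarith)
  have g3 := h₃ b₃ _ K n3 (by linarith) (by linarith)
  set b₄ := b₃ + d₃ with hb₄
  have n4 : ‖b₄‖ ≤ B + 2 * S + 2 * C := (norm_add_le _ _).trans (by linarith)
  have g4 := h₄ b₄ _ n4 (by linarith)
  set b₅ := b₄ + d₄ with hb₅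
  have n5 : ‖b₅‖ ≤ B + 2 * S + 3 * C := (norm_add_le _ _).trans (by linarith)
  have g5 := h₅ b₅ _ n5 (by linarith)
  set b₆ := b₅ + d₅ with hb₆
  have n6 : ‖b₆‖ ≤ B + 2 * S + 4 * C := (norm_add_le _ _).trans (by linarith)
  have g6 := h₆ b₆ _ n6 (by linarith)
  set b₇ := b₆ + d₆ with hb₇
  have n7 : ‖b₇‖ ≤ B + 2 * S + 5 * C := (norm_add_le _ _).trans (by linarith)
  have g7 := h₇ b₇ _ n7 (by linarith)
  have hend : b₇ + d₇ = b' := by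
    have : b₇ + d₇ = b + (s₁ • p + s₂ • p') + (d₁ + d₃ + d₄ + d₅ + d₆ + d₇) := by
      rw [hb₇, hb₆, hb₅, hb₄, hb₃, hb₂, hb₁]; abel
    rw [this, hdec, hw]; abel
  have hang : θ + φ + φ + φ + φ = θ' := by rw [hφ]; ring
  rw [hang, hend] at g7
  have cast : ∀ (i j : ℕ), j = i + 1 → y + (i : ℝ) * ε + ε = y + (j : ℝ) * ε := by
    rintro i j rfl; push_cast; ring
  rw [cast 0 1 rfl] at g0
  rw [cast 1 2 rfl] at g1
  rw [cast 2 3 rfl] at g2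
  rw [cast 3 4 rfl] at g3
  rw [cast 4 5 rfl] at g4
  rw [cast 5 6 rfl] at g5
  rw [cast 6 7 rfl] at g6
  rw [cast 7 8 rfl] at g7
  have mono : ∀ i j : ℕ, i ≤ j → y + (i : ℝ) * ε ≤ y + (j : ℝ) * ε := fun i j hij => by
    have : (i : ℝ) ≤ j := by exact_mod_cast hij
    gcongr
  have t6 := g6.trans (mono 6 7 (by norm_num)) (mono 7 8 (by norm_num)) g7
  have t5 := g5.trans (mono 5 6 (by norm_num)) (mono 6 8 (by norm_num)) t6
  have t4 := g4.trans (mono 4 5 (by norm_num)) (mono 5 8 (by norm_num)) t5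
  have t3 := g3.trans (mono 3 4 (by norm_num)) (mono 4 8 (by norm_num)) t4
  have t2 := g2.trans (mono 2 3 (by norm_num)) (mono 3 8 (by norm_num)) t3
  have t1 := g1.trans (mono 1 2 (by norm_num)) (mono 2 8 (by norm_num)) t2
  have t0 := g0.trans (mono 0 1 (by norm_num)) (mono 1 8 (by norm_num)) t1
  exact t0.of_eq (by simp) (by norm_num) rfl rfl rfl rfl

/-- A shear distributed over eight layers of which only the first one is used. -/
lemma layers_shear (hlam : lam ∈ Ioo (0 : ℝ) 1) (hε : 0 < ε) {k : ℤ} (hy : y = k * ε)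
    {Q : Mat2} (hQ : Q ∈ SO2) (b : Plane) (s : ℝ) :
    Connects M y (y + 8 * ε) Q b Q (b + s • col₁ Q) fun x v g =>
      Layered lam ε x g ∧ (∀ i j, |g i j| ≤ 1 + |s| / (lam * ε)) ∧
      ‖v - affine Q b x‖ ≤ |s| := by
  have hle : 0 < lam * ε := mul_pos hlam.1 hε
  refine (layer_shear hlam hε hy hQ b s).trans (by linarith) (by linarith)
    (Connects.refl _ _ fun x _ _ => ⟨layered_of_mem_SO2 hQ, fun i j =>
      (abs_entry_le_one hQ i j).trans (by linarith [div_nonneg (abs_nonneg s) hle.le]), ?_⟩)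
  rw [affine, affine, ← add_assoc, add_sub_cancel_left, norm_smul, norm_col₁ hQ, mul_one,
    Real.norm_eq_abs]

end Layers

end LayeredBV
end

open scoped ENNReal

noncomputable section

namespace LayeredBV

/-! ### Areas of horizontal strips. -/

section Fubini

lemma measurePreserving_coords :
    MeasurePreserving (fun x : Plane => (x 0, x 1)) volume volume :=
  (volume_preserving_finTwoArrow ℝ).comp (PiLp.volume_preserving_ofLp (Fin 2))

lemma measurePreserving_mk :
    MeasurePreserving (fun p : ℝ × ℝ => (!₂[p.1, p.2] : Plane)) volume volume :=
  (PiLp.volume_preserving_toLp (Fin 2)).comp (volume_preserving_finTwoArrow ℝ).symm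

lemma measurableSet_strip (y y' : ℝ) : MeasurableSet {x : Plane | y ≤ x 1 ∧ x 1 < y'} := by
  have h : Measurable fun x : Plane => x 1 := by fun_prop
  exact h measurableSet_Ico

/-- The area of a horizontal strip of a set is at most its height times the maximal width. -/
lemma volume_strip_le {Ω : Set Plane} (hΩ : IsOpen Ω) {y y' : ℝ} {W : ℝ≥0∞}
    (hW : ∀ t ∈ Ico y y', width Ω t ≤ W) :
    volume (Ω ∩ {x | y ≤ x 1 ∧ x 1 < y'}) ≤ ENNReal.ofReal (y' - y) * W := by
  have hm := hΩ.measurableSet.inter (measurableSet_strip y y')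
  rw [← measurePreserving_mk.measure_preimage hm.nullMeasurableSet, Measure.volume_eq_prod,
    Measure.prod_apply_symm (measurePreserving_mk.measurable hm)]
  calc _ ≤ ∫⁻ t, (Ico y y').indicator (fun _ => W) t := by
        refine lintegral_mono fun t => ?_
        by_cases ht : t ∈ Ico y y'
        · rw [indicator_of_mem ht]
          exact (measure_mono fun s hs => hs.1).trans (hW t ht)
        · rw [indicator_of_notMem ht]
          refine le_of_eq (measure_mono_null (t := ∅) (fun s hs => ht ?_) measure_empty)
          exact hs.2
    _ = _ := by
        rw [lintegral_indicator measurableSet_Ico, setLIntegral_const, Real.volume_Ico, mul_comm]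

end Fubini

/-! ### Profiles and the block construction. -/

section Construction

/-- The maps `t ↦ R t` and `t ↦ ψ t` change in a controlled way: on each interval of heights either
they change only by a translation in direction `R e₁`, or the variation `F` exceeds the width of the
domain at some height in the interval. -/
structure IsProfile (Ω : Set Plane) (R : ℝ → Mat2) (ψ : ℝ → Plane) (F : ℝ → ℝ) (B : ℝ) :
    Prop where
  rotation : ∀ t, R t ∈ SO2
  norm_le : ∀ t, ‖ψ t‖ ≤ B
  mono : Monotone F
  bounded : ∀ t, |F t| ≤ B
  norm_sub_le : ∀ s ∈ heightInterval Ω, ∀ t ∈ heightInterval Ω, s ≤ t → ‖ψ t - ψ s‖ ≤ F t - F s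
  step : ∀ s ∈ heightInterval Ω, ∀ t ∈ heightInterval Ω, s < t →
    (R t = R s ∧ ∃ r : ℝ, ψ t = ψ s + r • col₁ (R s)) ∨
      ∃ τ ∈ Ioc s t, width Ω τ ≤ ENNReal.ofReal (F t - F s)

/-- The height, at distance at most `δ` from `t` and in the direction of `c`, at which the profile
is sampled. -/
def sampleHeight (c δ t : ℝ) : ℝ := min (t + δ) (max c (t - δ))

variable {c δ t t' : ℝ}

lemma sampleHeight_mono (h : t ≤ t') : sampleHeight c δ t ≤ sampleHeight c δ t' :=
  min_le_min (by linarith) (max_le_max le_rfl (by linarith))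

lemma abs_sampleHeight_sub_le (hδ : 0 ≤ δ) : |sampleHeight c δ t - t| ≤ δ := by
  rw [abs_le]
  constructor
  · have : t - δ ≤ sampleHeight c δ t := le_min (by linarith) (le_max_right _ _)
    linarith
  · have : sampleHeight c δ t ≤ t + δ := min_le_left _ _
    linarith

/-- Sample heights lie between `c` and every height `t'` of the block, hence in the height interval
as soon as the block meets `Ω`. -/
lemma sampleHeight_mem_uIcc (h : t ≤ t') (h' : t' ≤ t + δ) :
    sampleHeight c δ t ∈ uIcc t' c := by
  rw [mem_uIcc]; unfold sampleHeight
  grind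

lemma sampleHeight_add_mem_uIcc (h : t ≤ t') (h' : t' ≤ t + δ) :
    sampleHeight c δ (t + δ) ∈ uIcc t' c := by
  rw [mem_uIcc]; unfold sampleHeight
  grind

/-- Because sampling is shifted towards `c`, each height `τ` between the two sample heights lies
between `c` and `t'`. Thus the width at `τ` controls all widths in the block. -/
lemma sampleHeight_interval (h : t ≤ t') (h' : t' ≤ t + δ) {τ : ℝ}
    (hτ : τ ∈ Ioc (sampleHeight c δ t) (sampleHeight c δ (t + δ))) :
    (c ≤ τ ∧ τ ≤ t') ∨ (τ ≤ c ∧ t' ≤ τ) := by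
  obtain ⟨h1, h2⟩ := hτ
  unfold sampleHeight at h1 h2
  grind

lemma norm_affine_le {Q : Mat2} (hQ : Q ∈ SO2) (b x : Plane) : ‖affine Q b x‖ ≤ ‖x‖ + ‖b‖ := by
  unfold affine
  exact (norm_add_le _ _).trans (by rw [norm_matVec_of_mem_SO2 hQ])

/-- The properties of the approximating maps at a point. -/
def Approximates (Ω : Set Plane) (lam ε K : ℝ) (R : ℝ → Mat2) (ψ : ℝ → Plane) (F : ℝ → ℝ)
    (s s' : ℝ) (x v : Plane) (g : Mat2) : Prop :=
  Layered lam ε x g ∧ (x ∈ Ω → ‖v‖ ≤ K ∧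
    ((R s' = R s ∧ ∃ r : ℝ, ψ s' = ψ s + r • col₁ (R s)) →
      ‖v - affine (R s) (ψ s) x‖ ≤ F s' - F s))

/-- The number `a` bounds the excess of the gradient over `1`. In its bound `16 * M` pays for a
cheap block, of area at most `8ε · 2M`, and `8 * K * C` for an expensive one. -/
lemma IsProfile.exists_layer {Ω : Set Plane} {R : ℝ → Mat2} {ψ : ℝ → Plane} {F : ℝ → ℝ}
    {B M lam ε : ℝ} (hp : IsProfile Ω R ψ F B) (hΩ : IsOpen Ω) (hb : Bornology.IsBounded Ω)
    (hM : 0 < M) (hMΩ : ∀ x ∈ Ω, ‖x‖ ≤ M) {C : ℝ} (hC0 : 0 ≤ C) (hc : c ∈ heightInterval Ω)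
    (hC : ∀ t ∈ heightInterval Ω, ∀ t' ∈ heightInterval Ω,
      (c ≤ t ∧ t ≤ t') ∨ (t ≤ c ∧ t' ≤ t) → width Ω t' ≤ ENNReal.ofReal C * width Ω t)
    (hlam : lam ∈ Ioo (0 : ℝ) 1) (hε : 0 < ε) (hε1 : ε ≤ 1) {k : ℤ} {y Y K : ℝ}
    (hy : y = k * ε) (hY : |y| + 8 ≤ Y) (hK : K = 9 * B + 40 * (2 * Y + 9 * M + 1)) :
    ∃ a : ℝ, 0 ≤ a ∧
      a * volume.real (Ω ∩ {x | y ≤ x 1 ∧ x 1 < y + 8 * ε}) ≤ (16 * M + 8 * K * C) / lam *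
        (F (sampleHeight c (8 * ε) (y + 8 * ε)) - F (sampleHeight c (8 * ε) y)) ∧
      Connects M y (y + 8 * ε) (R (sampleHeight c (8 * ε) y)) (ψ (sampleHeight c (8 * ε) y))
        (R (sampleHeight c (8 * ε) (y + 8 * ε))) (ψ (sampleHeight c (8 * ε) (y + 8 * ε)))
        fun x v g => Approximates Ω lam ε K R ψ F (sampleHeight c (8 * ε) y)
          (sampleHeight c (8 * ε) (y + 8 * ε)) x v g ∧ (x ∈ Ω → ∀ i j, |g i j| ≤ 1 + a) := by
  have hB : 0 ≤ B := (norm_nonneg _).trans (hp.norm_le 0)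
  have hY0 : 8 ≤ Y := by linarith [abs_nonneg y]
  have hK0 : 0 ≤ K := by rw [hK]; positivity
  have hl0 := hlam.1
  set S := Ω ∩ {x : Plane | y ≤ x 1 ∧ x 1 < y + 8 * ε} with hS
  have hle : sampleHeight c (8 * ε) y ≤ sampleHeight c (8 * ε) (y + 8 * ε) :=
    sampleHeight_mono (by linarith)
  have hin : ∀ x ∈ S, sampleHeight c (8 * ε) y ∈ uIcc (x 1) c ∧
      sampleHeight c (8 * ε) (y + 8 * ε) ∈ uIcc (x 1) c := fun x hx =>
    ⟨sampleHeight_mem_uIcc hx.2.1 hx.2.2.le, sampleHeight_add_mem_uIcc hx.2.1 hx.2.2.le⟩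
  have hcmp : ∀ t' ∈ Ico y (y + 8 * ε),
      ∀ τ ∈ Ioc (sampleHeight c (8 * ε) y) (sampleHeight c (8 * ε) (y + 8 * ε)),
      (c ≤ τ ∧ τ ≤ t') ∨ (τ ≤ c ∧ t' ≤ τ) := fun t' ht' τ hτ =>
    sampleHeight_interval ht'.1 ht'.2.le hτ
  set s := sampleHeight c (8 * ε) y
  set s' := sampleHeight c (8 * ε) (y + 8 * ε)
  have hF := hp.mono hle
  have hjump := layers_jump hM hlam hε hε1 hy hY (hp.rotation s) (hp.rotation s')
    (hp.norm_le s) (hp.norm_le s')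
  rw [← hK] at hjump
  have hI : ∀ x ∈ S, s ∈ heightInterval Ω ∧ s' ∈ heightInterval Ω := fun x hx => by
    have := ordConnected_Ioo.uIcc_subset (mem_heightInterval hΩ hb hx.1) hc
    exact ⟨this (hin x hx).1, this (hin x hx).2⟩
  -- If the block misses `Ω`, its sample heights may lie outside the height interval and `hp.step`
  -- is not available, but no estimate is needed either; the general transition keeps the chain
  -- going.
  rcases S.eq_empty_or_nonempty with hSe | ⟨x₀, hx₀⟩
  · refine ⟨0, le_rfl, by rw [zero_mul]; exact mul_nonneg (by positivity) (by linarith),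
      hjump.mono fun x v g h1 h2 h => ?_⟩
    have hx : x ∉ Ω := fun hx => hSe.subset (⟨hx, h1, h2⟩ : x ∈ S)
    exact ⟨⟨h.1, fun h => absurd h hx⟩, fun h => absurd h hx⟩
  obtain ⟨hs, hs'⟩ := hI x₀ hx₀
  by_cases hgood : R s' = R s ∧ ∃ r : ℝ, ψ s' = ψ s + r • col₁ (R s)
  · obtain ⟨hR, r, hr⟩ := hgood
    have hrF : |r| ≤ F s' - F s := by
      have := hp.norm_sub_le s hs s' hs' hle
      rwa [hr, add_sub_cancel_left, norm_smul, norm_col₁ (hp.rotation s), mul_one,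
        Real.norm_eq_abs] at this
    refine ⟨|r| / (lam * ε), by positivity, ?_, ?_⟩
    · have hvol : volume.real S ≤ 8 * ε * (2 * M) := by
        refine ENNReal.toReal_le_of_le_ofReal (by positivity) ?_
        refine (volume_strip_le hΩ fun t _ => width_le hMΩ t).trans (le_of_eq ?_)
        rw [← ENNReal.ofReal_mul (by linarith)]; congr 1; ring
      calc |r| / (lam * ε) * volume.real S ≤ |r| / (lam * ε) * (8 * ε * (2 * M)) := by gcongr
        _ = 16 * M / lam * |r| := by field_simp; ring
        _ ≤ (16 * M + 8 * K * C) / lam * (F s' - F s) := by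
          gcongr
          have : 0 ≤ 8 * K * C := by positivity
          linarith
    · rw [hR, hr]
      refine (layers_shear hlam hε hy (hp.rotation s) (ψ s) r).mono
        fun x v g h1 h2 ⟨h3, h4, h5⟩ => ⟨⟨h3, fun hx => ⟨?_, fun _ => h5.trans hrF⟩⟩, fun _ => h4⟩
      have h6 : ‖v‖ ≤ ‖v - affine (R s) (ψ s) x‖ + ‖affine (R s) (ψ s) x‖ := by
        simpa using norm_add_le (v - affine (R s) (ψ s) x) (affine (R s) (ψ s) x)
      have h7 := norm_affine_le (hp.rotation s) (ψ s) x
      have h8 := hMΩ x hx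
      have h9 := hp.norm_le s
      have h10 := (abs_le.1 (hp.bounded s)).1
      have h11 := (abs_le.1 (hp.bounded s')).2
      rw [hK]
      linarith
  · have hlt : s < s' := lt_of_le_of_ne hle fun h => hgood ⟨by rw [h], 0, by rw [h]; simp⟩
    -- In an expensive block the increment of `F` dominates the width at some `τ`, hence up to `C`
    -- all widths of the block; the factor `8ε` in the area cancels the `1/ε` in the gradient.
    obtain ⟨τ, hτ, hw⟩ := (hp.step s hs s' hs' hlt).resolve_left hgood
    have hτI : τ ∈ heightInterval Ω := ordConnected_Ioo.out hs hs' ⟨hτ.1.le, hτ.2⟩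
    refine ⟨K / (lam * ε), by positivity, ?_, hjump.mono fun x v g h1 h2 ⟨h3, h4, h5⟩ =>
      ⟨⟨h3, fun hx => ⟨h5 (hMΩ x hx), fun h => absurd h hgood⟩⟩, fun _ i j => ?_⟩⟩
    · have hvol : volume.real S ≤ 8 * ε * (C * (F s' - F s)) := by
        refine ENNReal.toReal_le_of_le_ofReal (by have := sub_nonneg.2 hF; positivity) ?_
        have hsub : ∀ t ∈ Ico y (y + 8 * ε), width Ω t ≤ ENNReal.ofReal (C * (F s' - F s)) := by
          intro t ht
          rw [ENNReal.ofReal_mul hC0]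
          rcases (slice Ω t).eq_empty_or_nonempty with he | ⟨z, hz⟩
          · rw [width, he]; simp
          · have htI : t ∈ heightInterval Ω := by
              simpa using mem_heightInterval hΩ hb (show !₂[z, t] ∈ Ω from hz)
            exact (hC τ hτI t htI (hcmp t ht τ hτ)).trans (by gcongr)
        refine (volume_strip_le hΩ hsub).trans (le_of_eq ?_)
        rw [← ENNReal.ofReal_mul (by linarith)]; congr 1; ring
      calc K / (lam * ε) * volume.real S ≤ K / (lam * ε) * (8 * ε * (C * (F s' - F s))) := by
            gcongr
        _ = 8 * K * C / lam * (F s' - F s) := by field_simp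
        _ ≤ _ := by
          gcongr
          linarith
    · exact (h4 i j).trans (by linarith)

lemma IsProfile.exists_map {Ω : Set Plane} {R : ℝ → Mat2} {ψ : ℝ → Plane} {F : ℝ → ℝ}
    {B M lam ε : ℝ} (hp : IsProfile Ω R ψ F B) (hΩ : IsOpen Ω) (hb : Bornology.IsBounded Ω)
    (hM : 0 < M) (hMΩ : ∀ x ∈ Ω, ‖x‖ ≤ M) {C : ℝ} (hC0 : 0 ≤ C) (hc : c ∈ heightInterval Ω)
    (hC : ∀ t ∈ heightInterval Ω, ∀ t' ∈ heightInterval Ω,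
      (c ≤ t ∧ t ≤ t') ∨ (t ≤ c ∧ t' ≤ t) → width Ω t' ≤ ENNReal.ofReal C * width Ω t)
    (hlam : lam ∈ Ioo (0 : ℝ) 1) (hε : 0 < ε) (hε1 : ε ≤ 1) {K : ℝ}
    (hK : K = 9 * B + 40 * (2 * (M + 24) + 9 * M + 1)) :
    ∃ V G, HasWeakGrad V G ∧
      (∀ x ∈ Ω, ∃ s ∈ heightInterval Ω, ∃ s' ∈ heightInterval Ω, s ≤ s' ∧
        |s - x 1| ≤ 16 * ε ∧ |s' - x 1| ≤ 16 * ε ∧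
        Approximates Ω lam ε K R ψ F s s' x (V x) (G x)) ∧
      ∀ i j, ∫ x in Ω, |G x i j| ≤
        volume.real Ω + (16 * M + 8 * K * C) / lam * (2 * B) := by
  have hB : 0 ≤ B := (norm_nonneg _).trans (hp.norm_le 0)
  have hK0 : 0 ≤ K := by rw [hK]; positivity
  have hl0 := hlam.1
  set N : ℕ := ⌊M / (8 * ε)⌋₊ + 1 with hN
  have hN1 : M < 8 * ε * N := by
    have := Nat.lt_floor_add_one (M / (8 * ε))
    rw [div_lt_iff₀ (by positivity)] at this
    rw [hN]; push_cast; linarith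
  have hN2 : 8 * ε * N ≤ M + 8 := by
    have := Nat.floor_le (a := M / (8 * ε)) (by positivity)
    rw [le_div_iff₀ (by positivity)] at this
    rw [hN]; push_cast; linarith
  -- Block boundaries are multiples of `8ε`, so they match the layers; `2 * N` blocks cover the
  -- heights in `[-M, M]`.
  set y : ℕ → ℝ := fun m => ((8 * ((m : ℤ) - N) : ℤ) : ℝ) * ε with hy
  have hysucc : ∀ m, y (m + 1) = y m + 8 * ε := fun m => by simp only [hy]; push_cast; ring
  have hyeq : ∀ m, y m = 8 * ε * m - 8 * ε * N := fun m => by simp only [hy]; push_cast; ring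
  set σ : ℕ → ℝ := fun m => sampleHeight c (8 * ε) (y m) with hσ
  have hlayer : ∀ m < 2 * N, ∃ a : ℝ, 0 ≤ a ∧
      a * volume.real (Ω ∩ {x | y m ≤ x 1 ∧ x 1 < y (m + 1)}) ≤ (16 * M + 8 * K * C) / lam *
        (F (σ (m + 1)) - F (σ m)) ∧
      Connects M (y m) (y (m + 1)) (R (σ m)) (ψ (σ m)) (R (σ (m + 1))) (ψ (σ (m + 1)))
        fun x v g => Approximates Ω lam ε K R ψ F (σ m) (σ (m + 1)) x v g ∧
          (x ∈ Ω → ∀ i j, |g i j| ≤ 1 + a) := by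
    intro m hm
    have hY : |y m| + 8 ≤ M + 24 := by
      have h1 : (m : ℝ) ≤ 2 * N := by exact_mod_cast hm.le
      have h2 : 8 * ε * m ≤ 8 * ε * (2 * N) := by gcongr
      have h3 : 0 ≤ 8 * ε * m := by positivity
      have : |y m| ≤ M + 8 := by rw [hyeq, abs_le]; constructor <;> linarith
      linarith
    have := hp.exists_layer hΩ hb hM hMΩ hC0 hc hC hlam hε hε1 (k := 8 * ((m : ℤ) - N)) rfl hY hK
    simp only [hσ, hysucc]
    exact this
  choose! a ha0 ha hconn using hlayer
  have hymono : Monotone y := monotone_nat_of_le_succ fun m => by rw [hysucc]; linarith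
  obtain ⟨V, G, hVG, hP⟩ := Connects.chain (M := M) (y := y) hymono
    (Q := fun m => R (σ m)) (b := fun m => ψ (σ m))
    (P := fun x v g => ∃ m < 2 * N, y m ≤ x 1 ∧ x 1 < y (m + 1) ∧
      Approximates Ω lam ε K R ψ F (σ m) (σ (m + 1)) x v g ∧ (x ∈ Ω → ∀ i j, |g i j| ≤ 1 + a m))
    (2 * N) fun m hm => (hconn m hm).mono fun x v g h1 h2 h => ⟨m, hm, h1, h2, h⟩
  have hmain : ∀ x ∈ Ω, ∃ m < 2 * N, y m ≤ x 1 ∧ x 1 < y (m + 1) ∧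
      Approximates Ω lam ε K R ψ F (σ m) (σ (m + 1)) x (V x) (G x) ∧
      (x ∈ Ω → ∀ i j, |G x i j| ≤ 1 + a m) := by
    intro x hx
    have h0 := (abs_apply_le_norm x 0).trans (hMΩ x hx)
    have h1 := abs_le.1 ((abs_apply_le_norm x 1).trans (hMΩ x hx))
    refine (hP x h0).2.1 ?_ ?_
    · rw [hyeq]; push_cast; linarith
    · rw [hyeq]; push_cast; linarith
  refine ⟨V, G, hVG, fun x hx => ?_, fun i j => ?_⟩
  · obtain ⟨m, -, h1, h2, h3, -⟩ := hmain x hx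
    have hsub := ordConnected_Ioo.uIcc_subset (mem_heightInterval hΩ hb hx) hc
    have hd : ∀ k, |σ k - y k| ≤ 8 * ε := fun k => abs_sampleHeight_sub_le (by linarith)
    have hd1 := abs_le.1 (hd m)
    have hd2 := abs_le.1 (hd (m + 1))
    rw [hysucc] at h2
    have hI := hsub (sampleHeight_mem_uIcc (c := c) (δ := 8 * ε) h1 h2.le)
    have hI' := hsub (sampleHeight_add_mem_uIcc (c := c) (δ := 8 * ε) h1 h2.le)
    rw [← hysucc] at hI'
    rw [hysucc] at hd2
    refine ⟨σ m, hI, σ (m + 1), hI', sampleHeight_mono (hymono m.le_succ), ?_, ?_, h3⟩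
    · rw [abs_le]; constructor <;> linarith
    · rw [abs_le]; constructor <;> linarith
  · have hint : IntegrableOn (fun x => G x i j) Ω := ((hVG.isW11 hb).2 i j).1
    have hfin : volume Ω ≠ ⊤ := hb.measure_lt_top.ne
    set S : ℕ → Set Plane := fun m => {x | y m ≤ x 1 ∧ x 1 < y (m + 1)} with hS
    have hSm : ∀ m, MeasurableSet (S m) := fun m => measurableSet_strip _ _
    have : IsFiniteMeasure (volume.restrict Ω) := ⟨by simpa using hb.measure_lt_top⟩
    have hi : ∀ m, Integrable ((S m).indicator fun _ => a m) (volume.restrict Ω) := fun m =>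
      (integrable_const _).indicator (hSm m)
    calc ∫ x in Ω, |G x i j|
        ≤ ∫ x in Ω, (1 + ∑ m ∈ Finset.range (2 * N), (S m).indicator (fun _ => a m) x) := by
          refine setIntegral_mono_on hint.abs
            ((integrable_const _).add (integrable_finsetSum _ fun m _ => hi m))
            hΩ.measurableSet fun x hx => ?_
          obtain ⟨m, hm, h1, h2, -, h3⟩ := hmain x hx
          refine (h3 hx i j).trans (add_le_add le_rfl ?_)
          have h4 : (S m).indicator (fun _ => a m) x = a m :=
            indicator_of_mem (show x ∈ S m from ⟨h1, h2⟩) _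
          rw [← h4]
          exact Finset.single_le_sum
            (f := fun m => (S m).indicator (fun _ => a m) x)
            (fun k hk => indicator_nonneg (fun _ _ => ha0 k (Finset.mem_range.1 hk)) _)
            (Finset.mem_range.2 hm)
      _ = volume.real Ω + ∑ m ∈ Finset.range (2 * N), a m * volume.real (Ω ∩ S m) := by
          rw [integral_add (integrable_const _) (integrable_finsetSum _ fun m _ => hi m),
            integral_finsetSum _ fun m _ => hi m]
          congr 1
          · simp
          · refine Finset.sum_congr rfl fun m _ => ?_
            rw [integral_indicator_const _ (hSm m), smul_eq_mul, mul_comm,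
              measureReal_restrict_apply (hSm m), inter_comm]
      _ ≤ volume.real Ω + ∑ m ∈ Finset.range (2 * N), (16 * M + 8 * K * C) / lam *
            (F (σ (m + 1)) - F (σ m)) := by
          exact add_le_add le_rfl (Finset.sum_le_sum fun m hm => ha m (Finset.mem_range.1 hm))
      -- Consecutive blocks share a sample height, so the increments of `F` telescope.
      _ = volume.real Ω + (16 * M + 8 * K * C) / lam * (F (σ (2 * N)) - F (σ 0)) := by
          rw [← Finset.mul_sum, Finset.sum_range_sub fun m => F (σ m)]
      _ ≤ _ := by
          gcongr
          have h1 := abs_le.1 (hp.bounded (σ (2 * N)))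
          have h2 := abs_le.1 (hp.bounded (σ 0))
          linarith

end Construction

end LayeredBV
end

open scoped ENNReal

noncomputable section

namespace LayeredBV

/-! ### Almost every height and almost every point. -/

section Heights

lemma quasiMeasurePreserving_height :
    Measure.QuasiMeasurePreserving (fun x : Plane => x 1) volume volume :=
  (Measure.quasiMeasurePreserving_snd (μ := (volume : Measure ℝ))
    (ν := (volume : Measure ℝ))).comp measurePreserving_coords.quasiMeasurePreserving

lemma ae_restrict_height {Ω : Set Plane} (hΩ : IsOpen Ω) (hb : Bornology.IsBounded Ω)
    {p : ℝ → Prop} (h : ∀ᵐ t ∂volume.restrict (heightInterval Ω), p t) :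
    ∀ᵐ x ∂volume.restrict Ω, p (x 1) := by
  rw [ae_restrict_iff' hΩ.measurableSet]
  rw [heightInterval, ae_restrict_iff' measurableSet_Ioo] at h
  filter_upwards [quasiMeasurePreserving_height.ae h] with x hx hxΩ
  exact hx (mem_heightInterval hΩ hb hxΩ)

lemma lowerHeight_lt_upperHeight {Ω : Set Plane} (hΩ : IsOpen Ω) (hconn : IsConnected Ω)
    (hb : Bornology.IsBounded Ω) : lowerHeight Ω < upperHeight Ω := by
  obtain ⟨x, hx⟩ := hconn.nonempty
  have := mem_heightInterval hΩ hb hx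
  exact this.1.trans this.2

end Heights

/-! ### Convergence of the constructed maps. -/

section Approximation

variable {Ω : Set Plane} {R : ℝ → Mat2} {ψ : ℝ → Plane} {F : ℝ → ℝ} {B : ℝ}

/-- Near `t` all widths are at least `w`, while by continuity `F` varies by less than `w`; the
second alternative of `step` is impossible. -/
lemma IsProfile.eventually_eq (hp : IsProfile Ω R ψ F B) (hΩ : IsOpen Ω) (hconn : IsConnected Ω)
    {t : ℝ} (ht : t ∈ heightInterval Ω) (hF : ContinuousAt F t) :
    ∃ r > 0, ∀ s ∈ heightInterval Ω, ∀ s' ∈ heightInterval Ω, |s - t| < r → |s' - t| < r → s ≤ s' →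
      R s' = R s ∧ ∃ r : ℝ, ψ s' = ψ s + r • col₁ (R s) := by
  obtain ⟨w, hw, r, hr, hwidth⟩ := exists_width_lower_bound_near hΩ hconn ht
  obtain ⟨ρ, hρ, hFρ⟩ := Metric.continuousAt_iff.1 hF (w / 2) (by positivity)
  refine ⟨min r ρ, lt_min hr hρ, fun s hs s' hs' h h' hss => ?_⟩
  rcases hss.eq_or_lt with rfl | hlt
  · exact ⟨rfl, 0, by simp⟩
  refine (hp.step s hs s' hs' hlt).resolve_right ?_
  rintro ⟨τ, hτ, hle⟩
  have h1 := abs_lt.1 (h.trans_le (min_le_left _ _))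
  have h2 := abs_lt.1 (h'.trans_le (min_le_left _ _))
  have h3 := (hwidth τ (by rw [abs_lt]; constructor <;> linarith [hτ.1, hτ.2])).trans hle
  have h4 := abs_lt.1 (hFρ (show dist s t < ρ from h.trans_le (min_le_right _ _)))
  have h5 := abs_lt.1 (hFρ (show dist s' t < ρ from h'.trans_le (min_le_right _ _)))
  have h6 : F s' - F s < w := by linarith
  exact absurd h3 (not_le.2 (ENNReal.ofReal_lt_ofReal_iff hw |>.2 h6))

/-- Near a continuity point all blocks are cheap, so the error is bounded by the increment of `F`
over the block plus the distance of `ψ` at the sample height from `ψ (x 1)`. -/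
lemma IsProfile.tendsto (hp : IsProfile Ω R ψ F B) (hΩ : IsOpen Ω) (hconn : IsConnected Ω)
    (hb : Bornology.IsBounded Ω) {lam K : ℝ} {V : ℝ → Plane → Plane} {G : ℝ → Plane → Mat2}
    {x : Plane} (hx : x ∈ Ω) (hF : ContinuousAt F (x 1))
    (hV : ∀ᶠ ε in 𝓝[>] (0 : ℝ), ∃ s ∈ heightInterval Ω, ∃ s' ∈ heightInterval Ω, s ≤ s' ∧
        |s - x 1| ≤ 16 * ε ∧ |s' - x 1| ≤ 16 * ε ∧
        Approximates Ω lam ε K R ψ F s s' x (V ε x) (G ε x)) :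
    Tendsto (fun ε => V ε x) (𝓝[>] 0) (𝓝 (affine (R (x 1)) (ψ (x 1)) x)) := by
  have hI := mem_heightInterval hΩ hb hx
  obtain ⟨r, hr, hgood⟩ := hp.eventually_eq hΩ hconn hI hF
  rw [Metric.tendsto_nhds]
  intro η hη
  obtain ⟨ρ, hρ, hFρ⟩ := Metric.continuousAt_iff.1 hF (η / 3) (by positivity)
  have hsmall : ∀ᶠ ε in 𝓝[>] (0 : ℝ), ε < min r ρ / 16 :=
    mem_nhdsWithin_of_mem_nhds (Iio_mem_nhds (by have := lt_min hr hρ; positivity))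
  filter_upwards [hV, hsmall] with ε ⟨s, hs, s', hs', hss, h1, h2, h3⟩ hε
  have h1r : |s - x 1| < r := by linarith [min_le_left r ρ]
  have h2r : |s' - x 1| < r := by linarith [min_le_left r ρ]
  have h1ρ := abs_lt.1 (hFρ (show dist s (x 1) < ρ from by
    rw [Real.dist_eq]; linarith [min_le_right r ρ]))
  have h2ρ := abs_lt.1 (hFρ (show dist s' (x 1) < ρ from by
    rw [Real.dist_eq]; linarith [min_le_right r ρ]))
  have h4 := (h3.2 hx).2 (hgood s hs s' hs' h1r h2r hss)
  have h5 : R s = R (x 1) ∧ ‖ψ s - ψ (x 1)‖ < η / 3 := by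
    rcases le_total s (x 1) with hle | hle
    · refine ⟨(hgood s hs _ hI h1r (by simpa using hr) hle).1.symm, ?_⟩
      rw [norm_sub_rev]
      exact (hp.norm_sub_le s hs _ hI hle).trans_lt (by linarith)
    · exact ⟨(hgood _ hI s hs (by simpa using hr) h1r hle).1,
        (hp.norm_sub_le _ hI s hs hle).trans_lt (by linarith)⟩
  have h6 : V ε x - affine (R (x 1)) (ψ (x 1)) x
      = (V ε x - affine (R s) (ψ s) x) + (ψ s - ψ (x 1)) := by
    unfold affine; rw [h5.1]; abel
  rw [dist_eq_norm, h6]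
  exact (norm_add_le _ _).trans_lt (by linarith [h5.2])

theorem IsProfile.exists_approximation (hp : IsProfile Ω R ψ F B) (hΩ : IsOpen Ω)
    (hconn : IsConnected Ω) (hb : Bornology.IsBounded Ω) (hlip : HasLipschitzBoundary Ω)
    (hx1 : IsX1Connected Ω) {lam : ℝ} (hlam : lam ∈ Ioo (0 : ℝ) 1) {u : Plane → Plane}
    {Du : Fin 2 → Fin 2 → SignedMeasure Plane} (hu : IsBVWithDeriv Ω u Du)
    (hrep : ∀ᵐ x ∂volume.restrict Ω, u x = affine (R (x 1)) (ψ (x 1)) x) :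
    ∃ v : ℝ → Plane → Plane, (∀ ε : ℝ, 0 < ε → v ε ∈ admissible Ω lam ε) ∧
      WeakStarTendstoBV Ω v (𝓝[>] 0) u := by
  obtain ⟨M', hM'⟩ := hb.exists_norm_le
  obtain ⟨M, hM, hMΩ⟩ : ∃ M : ℝ, 0 < M ∧ ∀ x ∈ Ω, ‖x‖ ≤ M :=
    ⟨max M' 1, by positivity, fun x hx => (hM' x hx).trans (le_max_left _ _)⟩
  obtain ⟨c, hc, C, hCtop, hC⟩ := exists_width_comparison hΩ hconn hb hlip hx1
  set K : ℝ := 9 * B + 40 * (2 * (M + 24) + 9 * M + 1) with hK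
  -- The estimates matter only as `ε → 0`: for `ε > 1` a fixed rotation is admissible, and for `ε ≤
  -- 0` nothing is required.
  have hex : ∀ ε : ℝ, ∃ V G, 0 < ε → HasWeakGrad V G ∧ (∀ x, Layered lam ε x (G x) ∨ x ∉ Ω) ∧
      (ε ≤ 1 → (∀ x ∈ Ω, ∃ s ∈ heightInterval Ω, ∃ s' ∈ heightInterval Ω, s ≤ s' ∧
        |s - x 1| ≤ 16 * ε ∧ |s' - x 1| ≤ 16 * ε ∧
        Approximates Ω lam ε K R ψ F s s' x (V x) (G x)) ∧
      ∀ i j, ∫ x in Ω, |G x i j| ≤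
        volume.real Ω + (16 * M + 8 * K * C.toReal) / lam * (2 * B)) := by
    intro ε
    by_cases hε : 0 < ε
    · rcases le_or_gt ε 1 with hε1 | hε1
      · obtain ⟨V, G, h1, h2, h3⟩ := hp.exists_map hΩ hb hM hMΩ ENNReal.toReal_nonneg hc
          (by rwa [ENNReal.ofReal_toReal hCtop]) hlam hε hε1 hK
        refine ⟨V, G, fun _ => ⟨h1, fun x => ?_, fun _ => ⟨h2, h3⟩⟩⟩
        by_cases hx : x ∈ Ω
        · obtain ⟨s, -, s', -, -, -, -, h⟩ := h2 x hx
          exact .inl h.1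
        · exact .inr hx
      · exact ⟨affine (R 0) 0, fun _ => R 0, fun _ => ⟨hasWeakGrad_affine _ _,
          fun x => .inl (layered_of_mem_SO2 (hp.rotation 0)), fun h => absurd h (not_le.2 hε1)⟩⟩
    · exact ⟨0, 0, fun h => absurd h hε⟩
  choose V G hVG using hex
  have hsmall : ∀ᶠ ε in 𝓝[>] (0 : ℝ), 0 < ε ∧ ε ≤ 1 := by
    filter_upwards [self_mem_nhdsWithin, mem_nhdsWithin_of_mem_nhds (Iic_mem_nhds one_pos)]
      with ε h1 h2 using ⟨h1, h2⟩
  have hW : ∀ ε, 0 < ε → IsW11WithGrad Ω (V ε) (G ε) := fun ε hε => (hVG ε hε).1.isW11 hb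
  refine ⟨V, fun ε hε => ⟨G ε, hW ε hε, ?_, ?_⟩, ?_⟩
  · filter_upwards [ae_restrict_mem hΩ.measurableSet] with x hx
    exact (((hVG ε hε).2.1 x).resolve_right fun h => h hx).1
  · have hmeas : MeasurableSet (rigidLayers lam ε ∩ Ω) := by
      refine MeasurableSet.inter ?_ hΩ.measurableSet
      exact measurableSet_le measurable_const
        (measurable_fract.comp (by fun_prop : Measurable fun x : Plane => x 1 / ε))
    filter_upwards [ae_restrict_mem hmeas] with x hx
    exact (((hVG ε hε).2.1 x).resolve_right fun h => h hx.2).2 hx.1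
  refine weakStarTendstoBV_of_bound hΩ hu (G := G)
    (hsmall.mono fun ε hε => hW ε hε.1) (C := _)
    (hsmall.mono fun ε hε => ((hVG ε hε.1).2.2 hε.2).2) ?_
  -- A monotone function has countably many discontinuities, and the corresponding horizontal lines
  -- form a null set.
  have hae : ∀ᵐ x ∂volume.restrict Ω, ContinuousAt F (x 1) := by
    refine ae_restrict_of_ae ?_
    have h0 : ∀ᵐ t : ℝ, ContinuousAt F t := by
      filter_upwards [hp.mono.countable_not_continuousAt.ae_notMem volume] with t ht
      simpa using ht
    exact quasiMeasurePreserving_height.ae h0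
  have : IsFiniteMeasure (volume.restrict Ω) := ⟨by simpa using hb.measure_lt_top⟩
  simp only [eLpNorm_one_eq_lintegral_enorm]
  have hlim : Tendsto (fun ε => ∫⁻ x in Ω, ‖V ε x - u x‖ₑ) (𝓝[>] 0) (𝓝 (∫⁻ _ in Ω, 0)) := by
    refine tendsto_lintegral_filter_of_dominated_convergence'
      (fun _ => ENNReal.ofReal (K + (M + B))) ?_ ?_ ?_ ?_
    · filter_upwards [hsmall] with ε hε
      exact ((hW ε hε.1).1.sub hu.1).aestronglyMeasurable.enorm
    · filter_upwards [hsmall] with ε hε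
      filter_upwards [hrep, ae_restrict_mem hΩ.measurableSet] with x hx hxΩ
      obtain ⟨s, -, s', -, -, -, -, h⟩ := ((hVG ε hε.1).2.2 hε.2).1 x hxΩ
      rw [← ofReal_norm]
      refine ENNReal.ofReal_le_ofReal ((_root_.norm_sub_le _ _).trans (add_le_add (h.2 hxΩ).1 ?_))
      rw [hx]
      exact (norm_affine_le (hp.rotation _) _ _).trans (add_le_add (hMΩ x hxΩ) (hp.norm_le _))
    · simpa using ENNReal.mul_lt_top ENNReal.ofReal_lt_top hb.measure_lt_top |>.ne
    · filter_upwards [hrep, ae_restrict_mem hΩ.measurableSet, hae] with x hx hxΩ hxF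
      have := hp.tendsto hΩ hconn hb hxΩ hxF (lam := lam) (K := K) (V := V) (G := G)
        (hsmall.mono fun ε hε => ((hVG ε hε.1).2.2 hε.2).1 x hxΩ)
      rw [← hx] at this
      have h2 := (this.sub_const (u x)).enorm
      simpa using h2
  simpa using hlim

end Approximation

end LayeredBV
end

open scoped ENNReal

noncomputable section

namespace LayeredBV

/-! ### The class `𝒜^∥`. -/

section Parallel

lemma abs_cumulative_le (μ : SignedMeasure ℝ) (t : ℝ) :
    |μ (Iic t)| ≤ μ.variation.real univ :=
  (abs_signedMeasure_le μ _).trans (measureReal_mono (subset_univ _))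

/-- The rotation is constant, so the first alternative of `step` always holds and `F` is the
distribution function of the variation of `Dϑ`. -/
theorem exists_approximation_of_mem_classAPar {Ω : Set Plane} (hΩ : IsOpen Ω)
    (hconn : IsConnected Ω) (hb : Bornology.IsBounded Ω) (hlip : HasLipschitzBoundary Ω)
    (hx1 : IsX1Connected Ω) {lam : ℝ} (hlam : lam ∈ Ioo (0 : ℝ) 1) {u : Plane → Plane}
    (hu : u ∈ classAPar Ω) :
    ∃ v : ℝ → Plane → Plane, (∀ ε : ℝ, 0 < ε → v ε ∈ admissible Ω lam ε) ∧
      WeakStarTendstoBV Ω v (𝓝[>] 0) u := by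
  obtain ⟨⟨Du, hDu⟩, Q, hQ, ϑ, c, ⟨hϑ, μ, hμ⟩, hrep⟩ := hu
  obtain ⟨d, hd⟩ := IsDistribDeriv.exists_ae_eq_cumulative
    (lowerHeight_lt_upperHeight hΩ hconn hb) hϑ hμ
  have hsub : ∀ s t, (c + (d + μ (Iic t)) • col₁ Q) - (c + (d + μ (Iic s)) • col₁ Q)
      = (μ (Iic t) - μ (Iic s)) • col₁ Q := fun s t => by module
  have hp : IsProfile Ω (fun _ => Q) (fun t => c + (d + μ (Iic t)) • col₁ Q)
      (fun t => μ.variation.real (Iic t)) (‖c‖ + |d| + μ.variation.real univ) := by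
    refine ⟨fun _ => hQ, fun t => ?_, fun s t hst => measureReal_mono (Iic_subset_Iic.2 hst),
      fun t => ?_, fun s _ t _ hst => ?_, fun s _ t _ _ => .inl ⟨rfl, μ (Iic t) - μ (Iic s), ?_⟩⟩
    · refine (norm_add_le _ _).trans ?_
      rw [norm_smul, norm_col₁ hQ, mul_one, Real.norm_eq_abs]
      linarith [abs_add_le d (μ (Iic t)), abs_cumulative_le μ t]
    · rw [abs_of_nonneg measureReal_nonneg]
      have : μ.variation.real (Iic t) ≤ μ.variation.real univ := measureReal_mono (subset_univ _)
      linarith [norm_nonneg c, abs_nonneg d]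
    · rw [hsub, norm_smul, norm_col₁ hQ, mul_one, Real.norm_eq_abs]
      exact abs_cumulative_sub_le μ hst
    · rw [← hsub]; abel
  refine hp.exists_approximation hΩ hconn hb hlip hx1 hlam hDu ?_
  filter_upwards [hrep, ae_restrict_height hΩ hb hd] with x h1 h2
  rw [h1, h2]
  unfold affine col₁
  abel

end Parallel

end LayeredBV
end

open scoped ENNReal

noncomputable section

namespace LayeredBV

/-! ### The density of `Du`. -/

section AbsolutelyContinuousPart

/-- Intersecting `U` with the two sets of a Hahn decomposition shows that both Jordan parts vanish
on `U`. -/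
lemma signedIntegral_eq_zero_of_forall_subset {X : Type*} [MeasurableSpace X]
    {μ : SignedMeasure X} {U : Set X} (hU : MeasurableSet U)
    (h : ∀ B, MeasurableSet B → B ⊆ U → μ B = 0) {φ : X → ℝ} (hφ : Integrable φ μ.variation)
    (h0 : ∀ x, x ∉ U → φ x = 0) : ∫ᵛ x, φ x ∂•μ = 0 := by
  obtain ⟨P, hP, h1, h2, hpos, hneg⟩ := μ.toJordanDecomposition_spec
  have hae : ∀ ν : Measure X, ν U = 0 → ∫ x, φ x ∂ν = 0 := fun ν hν =>
    integral_eq_zero_of_ae (by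
      filter_upwards [measure_eq_zero_iff_ae_notMem.1 hν] with x hx using h0 x hx)
  rw [signedIntegral_eq_sub _ hφ, hae _ ?_, hae _ ?_, sub_zero]
  · rw [hneg, SignedMeasure.toMeasureOfLEZero_apply _ _ _ hU]
    simp only [ENNReal.coe_eq_zero]
    ext
    simp [h _ (hP.compl.inter hU) inter_subset_right]
  · rw [hpos, SignedMeasure.toMeasureOfZeroLE_apply _ _ _ hU]
    simp only [ENNReal.coe_eq_zero]
    ext
    simp [h _ (hP.inter hU) inter_subset_right]

/-- Where the singular part vanishes, integration against a measure is integration against its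
density. -/
lemma signedIntegral_eq_integral_rnDeriv {μ : SignedMeasure Plane} {U : Set Plane}
    (hU : MeasurableSet U) (h : ∀ B, MeasurableSet B → B ⊆ U → μ.singularPart volume B = 0)
    {φ : Plane → ℝ} (hφ : Measurable φ) {C : ℝ} (hC : ∀ x, |φ x| ≤ C)
    (h0 : ∀ x, x ∉ U → φ x = 0) :
    ∫ᵛ x, φ x ∂•μ = ∫ x, μ.rnDeriv volume x * φ x := by
  conv_lhs => rw [← μ.singularPart_add_withDensity_rnDeriv_eq volume]
  rw [VectorMeasure.integral_add_vectorMeasure (signedIntegrable_of_bounded _ hφ hC)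
      (signedIntegrable_of_bounded _ hφ hC),
    signedIntegral_eq_zero_of_forall_subset hU h (signedIntegrable_of_bounded _ hφ hC) h0,
    signedIntegral_withDensity (SignedMeasure.integrable_rnDeriv _ _) hφ hC, zero_add]

lemma locallyIntegrable_height {a : ℝ → ℝ} (ha : Measurable a) {C : ℝ} (hC : ∀ t, |a t| ≤ C) :
    LocallyIntegrable fun x : Plane => a (x 1) := by
  refine (continuous_const (y := C)).locallyIntegrable.mono
    (ha.comp (by fun_prop : Measurable fun x : Plane => x 1)).aestronglyMeasurable
    (ae_of_all _ fun x => ?_)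
  rw [Real.norm_eq_abs, Real.norm_eq_abs]
  exact (hC _).trans (le_abs_self _)

lemma locallyIntegrable_height_mul {a : ℝ → ℝ} (ha : Measurable a) {C : ℝ}
    (hC : ∀ t, |a t| ≤ C) (i : Fin 2) : LocallyIntegrable fun x : Plane => a (x 1) * x i := by
  have hc : Continuous fun x : Plane => C * x i := by fun_prop
  have hm : Measurable fun x : Plane => a (x 1) * x i := by
    have := ha.comp (by fun_prop : Measurable fun x : Plane => x 1)
    exact this.mul (by fun_prop)
  refine hc.locallyIntegrable.mono hm.aestronglyMeasurable (ae_of_all _ fun x => ?_)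
  rw [norm_mul, norm_mul]
  exact mul_le_mul_of_nonneg_right ((hC _).trans (le_abs_self _)) (norm_nonneg _)

variable {Ω : Set Plane} {f : Plane → ℝ} {a d b : ℝ → ℝ} {C : ℝ}

lemma locallyIntegrable_layered (ha : Measurable a) (haC : ∀ t, |a t| ≤ C) (hd : Measurable d)
    (hdC : ∀ t, |d t| ≤ C) (hb : Measurable b) (hbC : ∀ t, |b t| ≤ C) :
    LocallyIntegrable fun x : Plane => a (x 1) * x 0 + d (x 1) * x 1 + b (x 1) :=
  ((locallyIntegrable_height_mul ha haC 0).add (locallyIntegrable_height_mul hd hdC 1)).add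
    (locallyIntegrable_height hb hbC)

/-- The horizontal derivative of a map that is affine on each horizontal line. -/
lemma isWeakDerivL1_layered (hΩb : Bornology.IsBounded Ω)
    (ha : Measurable a) (haC : ∀ t, |a t| ≤ C)
    (hd : Measurable d) (hdC : ∀ t, |d t| ≤ C) (hb : Measurable b) (hbC : ∀ t, |b t| ≤ C)
    (hf : ∀ᵐ x ∂volume.restrict Ω, f x = a (x 1) * x 0 + d (x 1) * x 1 + b (x 1)) :
    IsWeakDerivL1 Ω f (unitVec 0) fun x => a (x 1) := by
  refine ⟨((locallyIntegrable_height ha haC).integrableOn_isCompact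
    hΩb.isCompact_closure).mono_set subset_closure, fun φ hφ => ?_⟩
  have hcont := hφ.continuous_fderiv_apply (unitVec 0)
  have hsupp : HasCompactSupport fun x => fderiv ℝ φ x (unitVec 0) :=
    hφ.2.1.fderiv_apply (𝕜 := ℝ) (unitVec 0)
  have hL := locallyIntegrable_layered ha haC hd hdC hb hbC
  have h1 : ∫ x in Ω, f x * fderiv ℝ φ x (unitVec 0) =
      ∫ x in Ω, (a (x 1) * x 0 + d (x 1) * x 1 + b (x 1)) * fderiv ℝ φ x (unitVec 0) :=
    integral_congr_ae (by filter_upwards [hf] with x hx; rw [hx])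
  rw [h1, setIntegral_eq_integral_of_forall_compl_eq_zero fun x hx => by
      rw [hφ.fderiv_eq_zero hx]; simp,
    setIntegral_eq_integral_of_forall_compl_eq_zero fun x hx => by rw [hφ.eq_zero hx, mul_zero]]
  have := integral_bilinear_hasLineDerivAt_right_eq_neg_left_of_integrable
    (μ := (volume : Measure Plane)) (B := ContinuousLinearMap.mul ℝ ℝ)
    (f := fun x : Plane => a (x 1) * x 0 + d (x 1) * x 1 + b (x 1)) (f' := fun x => a (x 1))
    (g := φ) (g' := fun x => fderiv ℝ φ x (unitVec 0)) (v := unitVec 0)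
    (integrable_mul_of_locallyIntegrable (locallyIntegrable_height ha haC) hφ.1.continuous hφ.2.1)
    (integrable_mul_of_locallyIntegrable hL hcont hsupp)
    (integrable_mul_of_locallyIntegrable hL hφ.1.continuous hφ.2.1)
    (fun x _ => ?_) (fun x _ => ?_)
  · simpa only [ContinuousLinearMap.mul_apply'] using this
  · unfold HasLineDerivAt
    have h2 : (fun t : ℝ => a ((x + t • unitVec 0 : Plane) 1) * (x + t • unitVec 0 : Plane) 0 +
        d ((x + t • unitVec 0 : Plane) 1) * (x + t • unitVec 0 : Plane) 1 +
        b ((x + t • unitVec 0 : Plane) 1)) =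
        fun t => a (x 1) * (x 0 + t) + d (x 1) * x 1 + b (x 1) := by
      ext t; simp
    rw [h2]
    have h3 := ((((hasDerivAt_id (0 : ℝ)).const_add (x 0)).const_mul (a (x 1))).add_const
      (d (x 1) * x 1)).add_const (b (x 1))
    simpa using h3
  · have h4 := ((hφ.1.differentiable (by simp)) x).hasFDerivAt.hasLineDerivAt (unitVec 0)
    exact h4

/-- The horizontal derivative is absolutely continuous with density `a (x 1)`; uniqueness of the
derivative and of the Lebesgue decomposition identify it with `rnDeriv`. Hence `∇u e₁ = R e₁`. -/
lemma rnDeriv_layered (hΩb : Bornology.IsBounded Ω) (hΩ : IsOpen Ω)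
    (ha : Measurable a) (haC : ∀ t, |a t| ≤ C)
    (hd : Measurable d) (hdC : ∀ t, |d t| ≤ C) (hb : Measurable b) (hbC : ∀ t, |b t| ≤ C)
    (hf : ∀ᵐ x ∂volume.restrict Ω, f x = a (x 1) * x 0 + d (x 1) * x 1 + b (x 1))
    {μ : SignedMeasure Plane} (hμ : IsDistribDeriv Ω f (unitVec 0) μ) :
    ∀ᵐ x ∂volume.restrict Ω, μ.rnDeriv volume x = a (x 1) := by
  have hw := isWeakDerivL1_layered hΩb ha haC hd hdC hb hbC hf
  have hi : Integrable (Ω.indicator fun x : Plane => a (x 1)) :=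
    hw.1.integrable_indicator hΩ.measurableSet
  have hμ' : μ = 0 + (volume : Measure Plane).withDensityᵥ (Ω.indicator fun x => a (x 1)) := by
    rw [zero_add, hμ.unique hΩ hΩb hw.isDistribDeriv]
    ext B hB
    rw [withDensityᵥ_apply hw.1 hB, withDensityᵥ_apply hi hB, Measure.restrict_restrict hB,
      setIntegral_indicator hΩ.measurableSet]
  have := SignedMeasure.eq_rnDeriv 0 _ hi VectorMeasure.MutuallySingular.zero_left hμ'
  filter_upwards [ae_restrict_of_ae this, ae_restrict_mem hΩ.measurableSet] with x hx hxΩ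
  rw [← hx, indicator_of_mem hxΩ]

end AbsolutelyContinuousPart

/-! ### Approximate limits and jump points. -/

section ApproximateLimits

variable {Ω T : Set Plane} {u w : Plane → Plane} {x p : Plane}

/-- The set `T` is the region of approach: the plane for approximate limits, an open half plane for
one-sided ones. -/
lemma tendsto_average_of_tendsto (hΩ : IsOpen Ω) (hx : x ∈ Ω)
    (hae : ∀ᵐ y ∂volume.restrict Ω, u y = w y) {A : ℝ → Set Plane}
    (hAm : ∀ r, MeasurableSet (A r)) (hA : ∀ r, A r ⊆ Metric.ball x r) (hAT : ∀ r, A r ⊆ T)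
    (hw : Tendsto w (𝓝[T] x) (𝓝 p)) :
    Tendsto (fun r : ℝ => ⨍ y in A r, ‖u y - p‖) (𝓝[>] 0) (𝓝 0) := by
  rw [Metric.tendsto_nhds]
  intro η hη
  have h1 : ∀ᶠ y in 𝓝[T] x, dist (w y) p < η / 2 :=
    (Metric.tendsto_nhds.1 hw) _ (by positivity)
  have h2 := h1.and (mem_nhdsWithin_of_mem_nhds (hΩ.mem_nhds hx))
  rw [eventually_iff, Metric.mem_nhdsWithin_iff] at h2
  obtain ⟨ρ, hρ, h3⟩ := h2
  filter_upwards [mem_nhdsWithin_of_mem_nhds (Iio_mem_nhds hρ)] with r hr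
  have h4 : ∀ y ∈ A r, dist (w y) p < η / 2 ∧ y ∈ Ω := fun y hy =>
    h3 ⟨Metric.ball_subset_ball (le_of_lt hr) (hA r hy), hAT r hy⟩
  have hfin : volume (A r) < ⊤ := (measure_mono (hA r)).trans_lt measure_ball_lt_top
  have h5 : ‖∫ y in A r, ‖u y - p‖‖ ≤ η / 2 * volume.real (A r) := by
    refine norm_setIntegral_le_of_norm_le_const_ae hfin ?_
    rw [ae_restrict_iff' hΩ.measurableSet] at hae
    rw [ae_restrict_iff' (hAm r)]
    filter_upwards [hae] with y hy hyA
    have := h4 y hyA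
    rw [norm_norm, hy this.2, ← dist_eq_norm]
    exact this.1.le
  rw [dist_zero_right, setAverage_eq, norm_smul, norm_inv, Real.norm_eq_abs,
    abs_of_nonneg measureReal_nonneg]
  calc (volume.real (A r))⁻¹ * ‖∫ y in A r, ‖u y - p‖‖
      ≤ (volume.real (A r))⁻¹ * (η / 2 * volume.real (A r)) := by gcongr
    _ = η / 2 * ((volume.real (A r))⁻¹ * volume.real (A r)) := by ring
    _ ≤ η / 2 * 1 := by gcongr; exact inv_mul_le_one
    _ < η := by linarith

lemma hasApproxLimit_of_continuousAt (hΩ : IsOpen Ω) (hx : x ∈ Ω)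
    (hae : ∀ᵐ y ∂volume.restrict Ω, u y = w y) (hw : ContinuousAt w x) : HasApproxLimit u x :=
  ⟨w x, tendsto_average_of_tendsto (T := univ) hΩ hx hae (fun _ => Metric.isOpen_ball.measurableSet)
    (fun _ => subset_rfl) (fun _ => subset_univ _) (by rwa [nhdsWithin_univ])⟩

lemma measurableSet_halfBall (x ν : Plane) (r : ℝ) : MeasurableSet (halfBall x ν r) := by
  refine MeasurableSet.inter Metric.isOpen_ball.measurableSet ?_
  have : Continuous fun y : Plane => inner ℝ (y - x) ν := by fun_prop
  exact measurableSet_lt measurable_const this.measurable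

/-- A point with different limits from above and from below belongs to the jump set. -/
lemma mem_jumpSet_of_tendsto {q : Plane} (hΩ : IsOpen Ω) (hx : x ∈ Ω)
    (hae : ∀ᵐ y ∂volume.restrict Ω, u y = w y) (hpq : p ≠ q)
    (hp : Tendsto w (𝓝[{y | x 1 < y 1}] x) (𝓝 p)) (hq : Tendsto w (𝓝[{y | y 1 < x 1}] x) (𝓝 q)) :
    x ∈ jumpSet Ω u := by
  refine ⟨hx, p, q, unitVec 1, hpq, by simp, ?_, ?_⟩
  · refine tendsto_average_of_tendsto hΩ hx hae (measurableSet_halfBall _ _)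
      (fun r y hy => hy.1) (fun r y hy => ?_) hp
    have := hy.2
    simpa [EuclideanSpace.inner_single_right] using this
  · refine tendsto_average_of_tendsto hΩ hx hae (measurableSet_halfBall _ _)
      (fun r y hy => hy.1) (fun r y hy => ?_) hq
    have := hy.2
    simpa [EuclideanSpace.inner_single_right] using this

end ApproximateLimits

end LayeredBV
end

open scoped ENNReal

noncomputable section

namespace LayeredBV

/-! ### Weak derivatives of curves. -/

section OneDimensional

variable {p q : ℝ}

/-- A continuous function with an integrable weak derivative is an indefinite integral. -/
lemma IsWeakDerivL1.eq_integral (hpq : p < q) {f ρ : ℝ → ℝ}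
    (h : IsWeakDerivL1 (Ioo p q) f 1 ρ) (hf : ContinuousOn f (Ioo p q))
    (hfi : IntegrableOn f (Ioo p q)) {t₀ t : ℝ} (ht₀ : t₀ ∈ Ioo p q) (ht : t ∈ Ioo p q) :
    f t = f t₀ + ∫ s in t₀..t, (Ioo p q).indicator ρ s := by
  have hρ : Integrable ((Ioo p q).indicator ρ) := h.1.integrable_indicator measurableSet_Ioo
  obtain ⟨c, hc⟩ := IsDistribDeriv.exists_ae_eq_cumulative hpq hfi h.isDistribDeriv
  have hcum : ∀ t, ((volume.restrict (Ioo p q)).withDensityᵥ ρ) (Iic t) =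
      (∫ s in Iic t₀, (Ioo p q).indicator ρ s) + ∫ s in t₀..t, (Ioo p q).indicator ρ s := by
    intro t
    rw [withDensityᵥ_apply h.1 measurableSet_Iic, Measure.restrict_restrict measurableSet_Iic,
      ← setIntegral_indicator measurableSet_Ioo,
      ← intervalIntegral.integral_Iic_sub_Iic hρ.integrableOn hρ.integrableOn]
    ring
  have hprim := intervalIntegral.continuous_primitive
    (fun a b => hρ.intervalIntegrable (a := a) (b := b)) t₀
  have heq := Measure.eqOn_open_of_ae_eq (g := fun t => c +
      ((∫ s in Iic t₀, (Ioo p q).indicator ρ s) + ∫ s in t₀..t, (Ioo p q).indicator ρ s))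
    (by filter_upwards [hc] with t ht; rw [ht, hcum]) isOpen_Ioo hf
    (by fun_prop)
  rw [heq ht, heq ht₀]
  simp only [intervalIntegral.integral_same]
  ring

lemma IsWeakDerivL1.ae_hasDerivAt (hpq : p < q) {f ρ : ℝ → ℝ}
    (h : IsWeakDerivL1 (Ioo p q) f 1 ρ) (hf : ContinuousOn f (Ioo p q))
    (hfi : IntegrableOn f (Ioo p q)) :
    ∀ᵐ t ∂volume.restrict (Ioo p q), HasDerivAt f (ρ t) t := by
  have hρ : Integrable ((Ioo p q).indicator ρ) := h.1.integrable_indicator measurableSet_Ioo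
  obtain ⟨t₀, ht₀⟩ := nonempty_Ioo.2 hpq
  rw [ae_restrict_iff' measurableSet_Ioo]
  filter_upwards [_root_.LocallyIntegrable.ae_hasDerivAt_integral hρ.locallyIntegrable] with t ht htI
  have h1 := (ht t₀).const_add (f t₀)
  rw [indicator_of_mem htI] at h1
  refine h1.congr_of_eventuallyEq ?_
  filter_upwards [isOpen_Ioo.mem_nhds htI] with s hs using h.eq_integral hpq hf hfi ht₀ hs

/-- A continuous curve in the unit circle is constant if its weak derivative is everywhere parallel
to the curve. -/
lemma const_of_weakDeriv_parallel (hpq : p < q) {w ρ : Fin 2 → ℝ → ℝ}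
    (h : ∀ i, IsWeakDerivL1 (Ioo p q) (w i) 1 (ρ i)) (hw : ∀ i, ContinuousOn (w i) (Ioo p q))
    (hwi : ∀ i, IntegrableOn (w i) (Ioo p q))
    (hunit : ∀ t ∈ Ioo p q, w 0 t ^ 2 + w 1 t ^ 2 = 1)
    (hpar : ∀ᵐ t ∂volume.restrict (Ioo p q), w 0 t * ρ 1 t - w 1 t * ρ 0 t = 0)
    {s t : ℝ} (hs : s ∈ Ioo p q) (ht : t ∈ Ioo p q) (i : Fin 2) : w i s = w i t := by
  have hzero : ∀ᵐ t ∂volume.restrict (Ioo p q), ∀ i, ρ i t = 0 := by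
    filter_upwards [hpar, (h 0).ae_hasDerivAt hpq (hw 0) (hwi 0),
      (h 1).ae_hasDerivAt hpq (hw 1) (hwi 1), ae_restrict_mem measurableSet_Ioo]
      with t h1 h2 h3 htI
    -- Differentiating `|w|² = 1` makes the derivative orthogonal to `w`; being also parallel to the
    -- unit vector `w`, it vanishes.
    have h4 := (h2.pow 2).add (h3.pow 2)
    have h5 : HasDerivAt (w 0 ^ 2 + w 1 ^ 2) 0 t := by
      refine (hasDerivAt_const t (1 : ℝ)).congr_of_eventuallyEq ?_
      filter_upwards [isOpen_Ioo.mem_nhds htI] with s hs using hunit s hs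
    have h6 := h4.unique h5
    have h7 := hunit t htI
    have h8 : w 0 t * ρ 0 t + w 1 t * ρ 1 t = 0 := by
      simp at h6; linarith
    intro i
    fin_cases i
    · show ρ 0 t = 0
      linear_combination (-ρ 0 t) * h7 + w 0 t * h8 - w 1 t * h1
    · show ρ 1 t = 0
      linear_combination (-ρ 1 t) * h7 + w 1 t * h8 + w 0 t * h1
  rw [(h i).eq_integral hpq (hw i) (hwi i) ht hs]
  have : (∫ x in t..s, (Ioo p q).indicator (ρ i) x) = 0 := by
    refine intervalIntegral.integral_zero_ae ?_
    rw [ae_restrict_iff' measurableSet_Ioo] at hzero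
    filter_upwards [hzero] with x hx _
    by_cases hxI : x ∈ Ioo p q
    · rw [indicator_of_mem hxI, hx hxI]
    · rw [indicator_of_notMem hxI]
  rw [this, add_zero]

end OneDimensional

/-! ### Product test functions on boxes. -/

section ProductTest

variable {Ω : Set Plane} {α β : ℝ → ℝ} {l r p q : ℝ}

lemma isTestFunction_mul (hα : IsTestFunction (Ioo l r) α) (hβ : IsTestFunction (Ioo p q) β)
    (hbox : ∀ s ∈ Ioo l r, ∀ t ∈ Ioo p q, !₂[s, t] ∈ Ω) :
    IsTestFunction Ω fun x : Plane => α (x 0) * β (x 1) := by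
  have hK : IsCompact ((fun z : ℝ × ℝ => (!₂[z.1, z.2] : Plane)) '' (tsupport α ×ˢ tsupport β)) :=
    (hα.2.1.isCompact.prod hβ.2.1.isCompact).image (by fun_prop)
  have h0 : ∀ x : Plane,
      x ∉ (fun z : ℝ × ℝ => (!₂[z.1, z.2] : Plane)) '' (tsupport α ×ˢ tsupport β) →
      α (x 0) * β (x 1) = 0 := by
    intro x hx
    by_contra h
    refine hx ⟨(x 0, x 1), ⟨subset_tsupport _ ?_, subset_tsupport _ ?_⟩, mk_apply_self x⟩
    · exact left_ne_zero_of_mul h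
    · exact right_ne_zero_of_mul h
  refine ⟨?_, HasCompactSupport.intro hK h0, ?_⟩
  · have h1 : ContDiff ℝ ∞ fun x : Plane => x 0 := by fun_prop
    have h2 : ContDiff ℝ ∞ fun x : Plane => x 1 := by fun_prop
    exact (hα.1.comp h1).mul (hβ.1.comp h2)
  · refine (closure_minimal (fun x hx => ?_) hK.isClosed).trans ?_
    · by_contra h
      exact hx (h0 x h)
    · rintro _ ⟨z, hz, rfl⟩
      exact hbox _ (hα.2.2 hz.1) _ (hβ.2.2 hz.2)

lemma fderiv_mul_vertical (hα : IsTestFunction (Ioo l r) α) (hβ : IsTestFunction (Ioo p q) β)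
    (x : Plane) :
    fderiv ℝ (fun x : Plane => α (x 0) * β (x 1)) x (unitVec 1) = α (x 0) * deriv β (x 1) := by
  have h := isTestFunction_mul (Ω := univ) hα hβ fun _ _ _ _ => mem_univ _
  have h1 := ((h.1.differentiable (by simp)) x).hasFDerivAt.hasLineDerivAt (unitVec 1)
  have h2 : HasLineDerivAt ℝ (fun x : Plane => α (x 0) * β (x 1)) (α (x 0) * deriv β (x 1)) x
      (unitVec 1) := by
    unfold HasLineDerivAt
    have h3 : HasDerivAt β (deriv β (x 1)) (x 1 + 0) := by
      rw [add_zero]; exact ((hβ.1.differentiable (by simp)) _).hasDerivAt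
    have h4 := ((HasDerivAt.comp_const_add (x 1) 0 h3)).const_mul (α (x 0))
    simpa using h4
  exact h1.lineDeriv.symm.trans h2.lineDeriv

lemma integral_plane_eq (h : Plane → ℝ) (hi : Integrable h) :
    ∫ x, h x = ∫ t, ∫ s, h !₂[s, t] := by
  have hi' : Integrable (fun z : ℝ × ℝ => h !₂[z.1, z.2]) (volume.prod volume) :=
    measurePreserving_mk.integrable_comp_of_integrable hi
  rw [← integral_prod_symm _ hi']
  have := measurePreserving_mk.map_eq
  rw [← this, integral_map measurePreserving_mk.measurable.aemeasurable
    (by rw [this]; exact hi.aestronglyMeasurable)]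
  rfl

end ProductTest

end LayeredBV
end

open scoped ENNReal

noncomputable section

namespace LayeredBV

/-! ### Averaging the vertical derivative in the horizontal direction. -/

section ProductFormula

variable {Ω : Set Plane} {f : Plane → ℝ} {a d b α β : ℝ → ℝ} {C l r p q : ℝ}
  {μ : SignedMeasure Plane}

lemma IsTestFunction.continuous {E : Type*} [NormedAddCommGroup E] [NormedSpace ℝ E] {Ω : Set E}
    {φ : E → ℝ} (hφ : IsTestFunction Ω φ) : Continuous φ := hφ.1.continuous

lemma IsTestFunction.id_mul {l r : ℝ} {α : ℝ → ℝ} (hα : IsTestFunction (Ioo l r) α) :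
    Integrable fun s => s * α s :=
  (continuous_id.mul hα.continuous).integrable_of_hasCompactSupport hα.2.1.mul_left

/-- The density of a measure, averaged in the horizontal direction. -/
def averagedDensity (μ : SignedMeasure Plane) (α : ℝ → ℝ) (t : ℝ) : ℝ :=
  ∫ s, α s * μ.rnDeriv volume !₂[s, t]

lemma integrable_mul_rnDeriv (hα : IsTestFunction (Ioo l r) α) :
    Integrable (fun z : ℝ × ℝ => α z.1 * μ.rnDeriv volume !₂[z.1, z.2])
      (volume.prod volume) := by
  have h1 : Integrable (fun z : ℝ × ℝ => μ.rnDeriv volume !₂[z.1, z.2]) (volume.prod volume) :=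
    measurePreserving_mk.integrable_comp_of_integrable (SignedMeasure.integrable_rnDeriv μ volume)
  obtain ⟨C, hC⟩ := hα.isC0.bounded
  exact h1.bdd_mul (c := C) (hα.continuous.comp continuous_fst).aestronglyMeasurable
    (ae_of_all _ fun z => hC _)

lemma integrable_averagedDensity (hα : IsTestFunction (Ioo l r) α) :
    Integrable (averagedDensity μ α) := (integrable_mul_rnDeriv hα).integral_prod_right

/-- Fubini reduces `f` to the two moments of `α`. Choosing `α` with one or the other moment zero or
one separates the first column of the rotation from the translation. -/
lemma integral_layered_mul (ha : Measurable a) (haC : ∀ t, |a t| ≤ C) (hd : Measurable d)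
    (hdC : ∀ t, |d t| ≤ C) (hb : Measurable b) (hbC : ∀ t, |b t| ≤ C)
    (hμ : IsDistribDeriv Ω f (unitVec 1) μ)
    (hf : ∀ᵐ x ∂volume.restrict Ω, f x = a (x 1) * x 0 + d (x 1) * x 1 + b (x 1))
    (hΩ : IsOpen Ω)
    (hsing : ∀ B, MeasurableSet B → B ⊆ Ω ∩ {x | p < x 1 ∧ x 1 < q} →
      μ.singularPart volume B = 0)
    (hα : IsTestFunction (Ioo l r) α) (hβ : IsTestFunction (Ioo p q) β)
    (hbox : ∀ s ∈ Ioo l r, ∀ t ∈ Ioo p q, !₂[s, t] ∈ Ω) :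
    ∫ t, ((∫ s, s * α s) * a t + (∫ s, α s) * (d t * t + b t)) * deriv β t =
      - ∫ t, averagedDensity μ α t * β t := by
  have hφ := isTestFunction_mul hα hβ hbox
  have h1 := hμ.2 _ hφ
  have hL := locallyIntegrable_layered ha haC hd hdC hb hbC
  have hφ' := isTestFunction_mul hα hβ.deriv_one hbox
  have h2 : ∫ x in Ω, f x * fderiv ℝ (fun x : Plane => α (x 0) * β (x 1)) x (unitVec 1) =
      ∫ t, ((∫ s, s * α s) * a t + (∫ s, α s) * (d t * t + b t)) * deriv β t := by
    have h3 : ∫ x in Ω, f x * fderiv ℝ (fun x : Plane => α (x 0) * β (x 1)) x (unitVec 1) =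
        ∫ x in Ω, (a (x 1) * x 0 + d (x 1) * x 1 + b (x 1)) * (α (x 0) * deriv β (x 1)) :=
      integral_congr_ae (by
        filter_upwards [hf] with x hx; rw [hx, fderiv_mul_vertical hα hβ])
    rw [h3, setIntegral_eq_integral_of_forall_compl_eq_zero fun x hx => by
        rw [hφ'.eq_zero hx, mul_zero],
      integral_plane_eq _ (integrable_mul_of_locallyIntegrable hL hφ'.1.continuous hφ'.2.1)]
    refine integral_congr_ae (ae_of_all _ fun t => ?_)
    show ∫ s, (a t * s + d t * t + b t) * (α s * deriv β t) = _
    have h4 : (fun s => (a t * s + d t * t + b t) * (α s * deriv β t)) = fun s =>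
        (a t * deriv β t) * (s * α s) + ((d t * t + b t) * deriv β t) * α s := by
      ext s; ring
    rw [h4, integral_add (hα.id_mul.const_mul _) (hα.integrable.const_mul _),
      integral_const_mul, integral_const_mul]
    ring
  have hU : MeasurableSet (Ω ∩ {x : Plane | p < x 1 ∧ x 1 < q}) :=
    hΩ.measurableSet.inter
      ((by fun_prop : Measurable fun x : Plane => x 1) measurableSet_Ioo)
  obtain ⟨C', hC'⟩ := hφ.isC0.bounded
  have h5 : ∀ x : Plane, x ∉ Ω ∩ {x : Plane | p < x 1 ∧ x 1 < q} → α (x 0) * β (x 1) = 0 := by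
    intro x hx
    by_cases hxΩ : x ∈ Ω
    · rw [hβ.eq_zero (x := x 1) fun h => hx ⟨hxΩ, h⟩, mul_zero]
    · exact hφ.eq_zero hxΩ
  rw [h2, signedIntegral_eq_integral_rnDeriv hU hsing hφ.continuous.measurable hC' h5] at h1
  rw [h1, integral_plane_eq _
    ((SignedMeasure.integrable_rnDeriv μ volume).mul_bdd (c := C')
      hφ.continuous.aestronglyMeasurable (ae_of_all _ hC'))]
  congr 1
  refine integral_congr_ae (ae_of_all _ fun t => ?_)
  show ∫ s, μ.rnDeriv volume !₂[s, t] * (α s * β t) = averagedDensity μ α t * β t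
  rw [averagedDensity, ← integral_mul_const]
  congr 1
  ext s; ring

/-- A linear relation between densities passes to the averaged densities. -/
lemma ae_averagedDensity_eq {μ₀ μ₁ : SignedMeasure Plane} (hα : IsTestFunction (Ioo l r) α)
    (hbox : ∀ s ∈ Ioo l r, ∀ t ∈ Ioo p q, !₂[s, t] ∈ Ω) (hΩ : IsOpen Ω)
    (h : ∀ᵐ x ∂volume.restrict Ω,
      a (x 1) * μ₁.rnDeriv volume x - b (x 1) * μ₀.rnDeriv volume x = 1) :
    ∀ᵐ t ∂volume.restrict (Ioo p q),
      a t * averagedDensity μ₁ α t - b t * averagedDensity μ₀ α t = ∫ s, α s := by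
  rw [ae_restrict_iff' hΩ.measurableSet] at h
  have h1 : ∀ᵐ z : ℝ × ℝ ∂(volume.prod volume), !₂[z.1, z.2] ∈ Ω →
      a z.2 * μ₁.rnDeriv volume !₂[z.1, z.2] - b z.2 * μ₀.rnDeriv volume !₂[z.1, z.2] = 1 :=
    measurePreserving_mk.quasiMeasurePreserving.ae h
  have h2 : ∀ᵐ z : ℝ × ℝ ∂(volume.prod volume), !₂[z.2, z.1] ∈ Ω →
      a z.1 * μ₁.rnDeriv volume !₂[z.2, z.1] - b z.1 * μ₀.rnDeriv volume !₂[z.2, z.1] = 1 :=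
    Measure.measurePreserving_swap.quasiMeasurePreserving.ae h1
  have h3 := Measure.ae_ae_of_ae_prod h2
  rw [ae_restrict_iff' measurableSet_Ioo]
  filter_upwards [h3, (integrable_mul_rnDeriv (μ := μ₀) hα).prod_left_ae,
    (integrable_mul_rnDeriv (μ := μ₁) hα).prod_left_ae] with t h4 h5 h6 ht
  rw [averagedDensity, averagedDensity, ← integral_const_mul, ← integral_const_mul,
    ← integral_sub (h6.const_mul _) (h5.const_mul _)]
  refine integral_congr_ae ?_
  filter_upwards [h4] with s hs
  by_cases hsI : s ∈ Ioo l r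
  · have := hs (hbox s hsI t ht)
    linear_combination α s * this
  · rw [hα.eq_zero hsI]; ring

end ProductFormula

end LayeredBV
end

open scoped ENNReal

noncomputable section

namespace LayeredBV

/-! ### The determinant condition between jumps. -/

section LocalStructure

variable {l r p q : ℝ}

lemma IsTestFunction.integral_mul_deriv {β : ℝ → ℝ} (hβ : IsTestFunction (Ioo p q) β) :
    ∫ t, t * deriv β t = - ∫ t, β t := by
  have := integral_mul_deriv_eq_deriv_mul_of_integrable (u := fun t : ℝ => t) (u' := fun _ => 1)
    (v := β) (v' := deriv β) (fun x _ => hasDerivAt_id x)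
    (fun x _ => ((hβ.1.differentiable (by simp)) x).hasDerivAt)
    hβ.deriv_one.id_mul (by simpa [Pi.mul_def] using hβ.integrable) hβ.id_mul
  simpa using this

lemma IsTestFunction.integral_deriv {β : ℝ → ℝ} (hβ : IsTestFunction (Ioo p q) β) :
    ∫ t, deriv β t = 0 :=
  integral_eq_zero_of_hasDerivAt_of_integrable
    (fun x => ((hβ.1.differentiable (by simp)) x).hasDerivAt) hβ.deriv_one.integrable hβ.integrable

/-- A deformation `u(x) = R(x₂) x + ψ(x₂)` of bounded variation, with `R` valued in the rotations
and `det ∇u = 1`. -/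
structure IsLayered (Ω : Set Plane) (u : Plane → Plane)
    (Du : Fin 2 → Fin 2 → SignedMeasure Plane) (R : ℝ → Mat2) (ψ : ℝ → Plane) (C : ℝ) : Prop where
  isBV : IsBVWithDeriv Ω u Du
  rep : ∀ᵐ x ∂volume.restrict Ω, u x = affine (R (x 1)) (ψ (x 1)) x
  measurable_rotation : ∀ i j, Measurable fun t => R t i j
  measurable_translation : ∀ i, Measurable fun t => ψ t i
  rotation : ∀ t, R t ∈ SO2
  one_le : 1 ≤ C
  bounded : ∀ t i, |ψ t i| ≤ C
  det : ∀ᵐ x ∂volume.restrict Ω, (gradDensity Du x).det = 1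

variable {Ω : Set Plane} {u : Plane → Plane} {Du : Fin 2 → Fin 2 → SignedMeasure Plane}
  {R : ℝ → Mat2} {ψ : ℝ → Plane} {C : ℝ}

lemma IsLayered.abs_rotation_le (h : IsLayered Ω u Du R ψ C) (t : ℝ) (i j : Fin 2) :
    |R t i j| ≤ C :=
  (abs_entry_le_one (h.rotation t) i j).trans h.one_le

lemma IsLayered.rep_apply (h : IsLayered Ω u Du R ψ C) (i : Fin 2) :
    ∀ᵐ x ∂volume.restrict Ω,
      u x i = R (x 1) i 0 * x 0 + R (x 1) i 1 * x 1 + ψ (x 1) i := by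
  filter_upwards [h.rep] with x hx
  rw [hx, affine, PiLp.add_apply, matVec_apply]

/-- Since the first column of `∇u` is `R e₁`, the determinant condition is linear in the vertical
densities and can be averaged. -/
lemma IsLayered.det_eq (h : IsLayered Ω u Du R ψ C) (hΩ : IsOpen Ω)
    (hb : Bornology.IsBounded Ω) :
    ∀ᵐ x ∂volume.restrict Ω, R (x 1) 0 0 * (Du 1 1).rnDeriv volume x -
      R (x 1) 1 0 * (Du 0 1).rnDeriv volume x = 1 := by
  have hcol : ∀ i, ∀ᵐ x ∂volume.restrict Ω, (Du i 0).rnDeriv volume x = R (x 1) i 0 := fun i =>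
    rnDeriv_layered (C := C) hb hΩ (a := fun t => R t i 0) (d := fun t => R t i 1)
      (b := fun t => ψ t i) (h.measurable_rotation i 0)
      (fun t => h.abs_rotation_le t i 0) (h.measurable_rotation i 1)
      (fun t => h.abs_rotation_le t i 1) (h.measurable_translation i) (fun t => h.bounded t i)
      (h.rep_apply i) (h.isBV.2 i 0)
  filter_upwards [h.det, hcol 0, hcol 1] with x h1 h2 h3
  rw [Matrix.det_fin_two] at h1
  simp only [gradDensity, Matrix.of_apply, h2, h3] at h1
  linarith

lemma IsLayered.integral_product (h : IsLayered Ω u Du R ψ C) (hΩ : IsOpen Ω)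
    (hsing : ∀ i, ∀ B, MeasurableSet B → B ⊆ Ω ∩ {x | p < x 1 ∧ x 1 < q} →
      (Du i 1).singularPart volume B = 0) {α β : ℝ → ℝ}
    (hα : IsTestFunction (Ioo l r) α) (hβ : IsTestFunction (Ioo p q) β)
    (hbox : ∀ s ∈ Ioo l r, ∀ t ∈ Ioo p q, !₂[s, t] ∈ Ω) (i : Fin 2) :
    ∫ t, ((∫ s, s * α s) * R t i 0 + (∫ s, α s) * (R t i 1 * t + ψ t i)) * deriv β t =
      - ∫ t, averagedDensity (Du i 1) α t * β t :=
  integral_layered_mul (a := fun t => R t i 0) (d := fun t => R t i 1)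
    (b := fun t => ψ t i) (h.measurable_rotation i 0)
    (fun t => h.abs_rotation_le t i 0) (h.measurable_rotation i 1)
    (fun t => h.abs_rotation_le t i 1) (h.measurable_translation i) (fun t => h.bounded t i)
    (h.isBV.2 i 1) (h.rep_apply i) hΩ (hsing i) hα hβ hbox

/-- Between two jumps the rotation does not change. -/
lemma IsLayered.rotation_eq (h : IsLayered Ω u Du R ψ C) (hΩ : IsOpen Ω)
    (hb : Bornology.IsBounded Ω) (hlr : l < r) (hpq : p < q)
    (hbox : ∀ s ∈ Ioo l r, ∀ t ∈ Ioo p q, !₂[s, t] ∈ Ω)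
    (hsing : ∀ i, ∀ B, MeasurableSet B → B ⊆ Ω ∩ {x | p < x 1 ∧ x 1 < q} →
      (Du i 1).singularPart volume B = 0)
    (hcont : ∀ i, ContinuousOn (fun t => R t i 0) (Ioo p q)) {s t : ℝ} (hs : s ∈ Ioo p q)
    (ht : t ∈ Ioo p q) : R s = R t := by
  obtain ⟨α, hα, hα1⟩ := exists_isTestFunction_integral_eq_one hlr
  -- Testing with the derivative of `α`, of mean `0` and first moment `-1`, removes `ψ` and `R e₂`
  -- and isolates `R e₁`. The averaged determinant condition has right-hand side `0`, so the weak
  -- derivative of `R e₁` is parallel to `R e₁`.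
  have hα' := hα.deriv_one
  have hm : ∫ s, s * deriv α s = -1 := by rw [hα.integral_mul_deriv, hα1]
  have h0 : ∫ s, deriv α s = 0 := hα.integral_deriv
  have hint : ∀ i, IntegrableOn (fun t => R t i 0) (Ioo p q) := fun i =>
    IntegrableOn.of_bound (C := C) (by simp) (h.measurable_rotation i 0).aestronglyMeasurable
      (ae_of_all _ fun t => h.abs_rotation_le t i 0)
  have hw : ∀ i, IsWeakDerivL1 (Ioo p q) (fun t => R t i 0) 1
      fun t => - averagedDensity (Du i 1) (deriv α) t := by
    refine fun i => ⟨(integrable_averagedDensity hα').neg.integrableOn, fun β hβ => ?_⟩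
    have h1 := h.integral_product hΩ hsing hα' hβ hbox i
    rw [hm, h0] at h1
    rw [setIntegral_eq_integral_of_forall_compl_eq_zero fun x hx => by
        rw [hβ.fderiv_eq_zero hx]; simp,
      setIntegral_eq_integral_of_forall_compl_eq_zero fun x hx => by rw [hβ.eq_zero hx, mul_zero]]
    have h2 : ∀ t, fderiv ℝ β t 1 = deriv β t := fun t => rfl
    have h3 : ∀ t, (-1 * R t i 0 + 0 * (R t i 1 * t + ψ t i)) * deriv β t =
        - (R t i 0 * deriv β t) := fun t => by ring
    simp only [h3, integral_neg, neg_inj] at h1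
    simp only [h2, neg_mul, integral_neg, neg_neg]
    rw [h1]
  have hpar := ae_averagedDensity_eq (a := fun t => R t 0 0) (b := fun t => R t 1 0) hα' hbox hΩ
    (h.det_eq hΩ hb)
  have hconst := const_of_weakDeriv_parallel hpq hw hcont hint
    (fun t _ => ((mem_SO2_iff _).1 (h.rotation t)).2.2)
    (by
      filter_upwards [hpar] with t ht
      rw [h0] at ht
      linear_combination -ht) hs ht
  obtain ⟨h1, h2, -⟩ := (mem_SO2_iff _).1 (h.rotation s)
  obtain ⟨h3, h4, -⟩ := (mem_SO2_iff _).1 (h.rotation t)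
  have e0 := hconst 0
  have e1 := hconst 1
  ext i j
  fin_cases i <;> fin_cases j <;> simp_all

/-- Between two jumps the translation changes only in the direction of the first column. -/
lemma IsLayered.translation_eq (h : IsLayered Ω u Du R ψ C) (hΩ : IsOpen Ω)
    (hb : Bornology.IsBounded Ω) (hlr : l < r) (hpq : p < q)
    (hbox : ∀ s ∈ Ioo l r, ∀ t ∈ Ioo p q, !₂[s, t] ∈ Ω)
    (hsing : ∀ i, ∀ B, MeasurableSet B → B ⊆ Ω ∩ {x | p < x 1 ∧ x 1 < q} →
      (Du i 1).singularPart volume B = 0) {Q : Mat2} (hQ : ∀ t ∈ Ioo p q, R t = Q)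
    (hcont : ∀ i, ContinuousOn (fun t => ψ t i) (Ioo p q)) {s t : ℝ} (hs : s ∈ Ioo p q)
    (ht : t ∈ Ioo p q) :
    Q 0 0 * ψ s 1 - Q 1 0 * ψ s 0 = Q 0 0 * ψ t 1 - Q 1 0 * ψ t 0 := by
  obtain ⟨α, hα, hα1⟩ := exists_isTestFunction_integral_eq_one hlr
  have hQSO : Q ∈ SO2 := hQ s hs ▸ h.rotation s
  obtain ⟨q1, q2, q3⟩ := (mem_SO2_iff _).1 hQSO
  have hpar := ae_averagedDensity_eq (a := fun t => R t 0 0) (b := fun t => R t 1 0) hα hbox hΩ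
    (h.det_eq hΩ hb)
  rw [hα1, ae_restrict_iff' measurableSet_Ioo] at hpar
  have hψ : ∀ i, Integrable (fun t => ψ t i) (volume.restrict (Ioo p q)) := fun i =>
    Integrable.of_bound (C := C) (h.measurable_translation i).aestronglyMeasurable
      (ae_of_all _ fun t => h.bounded t i)
  have hmul : ∀ {β : ℝ → ℝ}, IsTestFunction (Ioo p q) β → ∀ {f : ℝ → ℝ}, Measurable f →
      (∀ t, |f t| ≤ C) → Integrable fun t => f t * β t := fun hβ f hf hfC =>
    hβ.integrable.bdd_mul (c := C) hf.aestronglyMeasurable (ae_of_all _ hfC)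
  have hidmul : ∀ {β : ℝ → ℝ}, IsTestFunction (Ioo p q) β → ∀ {f : ℝ → ℝ}, Measurable f →
      (∀ t, |f t| ≤ C) → Integrable fun t => f t * (t * β t) := fun hβ f hf hfC =>
    hβ.id_mul.bdd_mul (c := C) hf.aestronglyMeasurable (ae_of_all _ hfC)
  have hzero : ∀ β, IsTestFunction (Ioo p q) β →
      ∫ t in Ioo p q, (Q 0 0 * ψ t 1 - Q 1 0 * ψ t 0) * deriv β t = 0 := by
    intro β hβ
    have hβ' := hβ.deriv_one
    have e : ∀ i, ∫ t, ((∫ s, s * α s) * R t i 0 + 1 * (R t i 1 * t + ψ t i)) * deriv β t =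
        - ∫ t, averagedDensity (Du i 1) α t * β t := fun i => by
      have := h.integral_product hΩ hsing hα hβ hbox i
      rwa [hα1] at this
    have hi : ∀ i, Integrable fun t =>
        ((∫ s, s * α s) * R t i 0 + 1 * (R t i 1 * t + ψ t i)) * deriv β t := fun i => by
      have h1 := (hmul hβ' (h.measurable_rotation i 0)
        (fun t => h.abs_rotation_le t i 0)).const_mul (∫ s, s * α s)
      have h2 := hidmul hβ' (h.measurable_rotation i 1) (fun t => h.abs_rotation_le t i 1)
      have h3 := hmul hβ' (h.measurable_translation i) (fun t => h.bounded t i)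
      refine ((h1.add h2).add h3).congr (ae_of_all _ fun t => ?_)
      simp only [Pi.add_apply]; ring
    have hρ : ∀ i, Integrable fun t => averagedDensity (Du i 1) α t * β t := fun i => by
      obtain ⟨c, hc⟩ := hβ.isC0.bounded
      exact (integrable_averagedDensity hα).mul_bdd (c := c) hβ.continuous.aestronglyMeasurable
        (ae_of_all _ hc)
    -- Take the cross product with `Q e₁`: the `Q e₁` term drops out, and `Q e₂ t` contributes `t`,
    -- whose derivative `1` already accounts for `det ∇u = 1`. Nothing is left for the cross product
    -- of `Q e₁` and `ψ`.
    have hdiff : ∫ t, (t * deriv β t + (Q 0 0 * ψ t 1 - Q 1 0 * ψ t 0) * deriv β t) =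
        - ∫ t, β t := by
      calc _ = ∫ t, (Q 0 0 * (((∫ s, s * α s) * R t 1 0 + 1 * (R t 1 1 * t + ψ t 1)) * deriv β t) -
            Q 1 0 * (((∫ s, s * α s) * R t 0 0 + 1 * (R t 0 1 * t + ψ t 0)) * deriv β t)) := by
            refine integral_congr_ae (ae_of_all _ fun t => ?_)
            by_cases htI : t ∈ Ioo p q
            · simp only [hQ t htI, q1, q2]
              linear_combination (-t * deriv β t) * q3
            · simp only [hβ'.eq_zero htI]; ring
        _ = - ∫ t, (Q 0 0 * (averagedDensity (Du 1 1) α t * β t) -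
            Q 1 0 * (averagedDensity (Du 0 1) α t * β t)) := by
            rw [integral_sub ((hi 1).const_mul _) ((hi 0).const_mul _), integral_const_mul,
              integral_const_mul, e, e, integral_sub ((hρ 1).const_mul _) ((hρ 0).const_mul _),
              integral_const_mul, integral_const_mul]
            ring
        _ = _ := by
            congr 1
            refine integral_congr_ae ?_
            filter_upwards [hpar] with t ht
            by_cases htI : t ∈ Ioo p q
            · have h1 := ht htI
              rw [hQ t htI] at h1
              linear_combination β t * h1
            · rw [hβ.eq_zero htI]; ring
    have hiψ : Integrable fun t => (Q 0 0 * ψ t 1 - Q 1 0 * ψ t 0) * deriv β t := by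
      refine (((hmul hβ' (h.measurable_translation 1) (fun t => h.bounded t 1)).const_mul
        (Q 0 0)).sub ((hmul hβ' (h.measurable_translation 0)
          (fun t => h.bounded t 0)).const_mul (Q 1 0))).congr (ae_of_all _ fun t => ?_)
      simp only [Pi.sub_apply]; ring
    rw [integral_add hβ'.id_mul hiψ, hβ.integral_mul_deriv] at hdiff
    rw [setIntegral_eq_integral_of_forall_compl_eq_zero fun x hx => by
      rw [hβ'.eq_zero hx, mul_zero]]
    linarith
  obtain ⟨c, hc⟩ := ae_eq_const_of_integral_mul_deriv_eq_zero hpq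
    (((hψ 1).const_mul (Q 0 0)).sub ((hψ 0).const_mul (Q 1 0))) hzero
  have heq := Measure.eqOn_open_of_ae_eq (f := fun t => Q 0 0 * ψ t 1 - Q 1 0 * ψ t 0)
    (g := fun _ => c) hc isOpen_Ioo
    ((continuousOn_const.mul (hcont 1)).sub (continuousOn_const.mul (hcont 0))) continuousOn_const
  exact (heq hs).trans (heq ht).symm

end LocalStructure

end LayeredBV
end

open scoped ENNReal

noncomputable section

namespace LayeredBV

/-! ### Jump heights and the structure between them. -/

section Jumps

/-- `R` and `ψ` are continuous from the right on `I`, with limits `L` and `χ` from the left. -/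
structure HasOneSidedLimits (I : Set ℝ) (R L : ℝ → Mat2) (ψ χ : ℝ → Plane) : Prop where
  rotation_right : ∀ t ∈ I, Tendsto R (𝓝[>] t) (𝓝 (R t))
  rotation_left : ∀ t ∈ I, Tendsto R (𝓝[<] t) (𝓝 (L t))
  translation_right : ∀ t ∈ I, Tendsto ψ (𝓝[>] t) (𝓝 (ψ t))
  translation_left : ∀ t ∈ I, Tendsto ψ (𝓝[<] t) (𝓝 (χ t))

/-- The heights at which `R` or `ψ` jumps. -/
def jumpHeights (I : Set ℝ) (R L : ℝ → Mat2) (ψ χ : ℝ → Plane) : Set ℝ :=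
  {t ∈ I | L t ≠ R t ∨ χ t ≠ ψ t}

variable {Ω : Set Plane} {u : Plane → Plane} {Du : Fin 2 → Fin 2 → SignedMeasure Plane}
  {R L : ℝ → Mat2} {ψ χ : ℝ → Plane} {C : ℝ} {I : Set ℝ}

lemma HasOneSidedLimits.continuousAt (h : HasOneSidedLimits I R L ψ χ) {t : ℝ} (ht : t ∈ I)
    (hj : t ∉ jumpHeights I R L ψ χ) : ContinuousAt R t ∧ ContinuousAt ψ t := by
  have hj' : L t = R t ∧ χ t = ψ t := by
    by_contra hc
    exact hj ⟨ht, by tauto⟩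
  have h1 := h.rotation_left t ht
  have h2 := h.translation_left t ht
  rw [hj'.1] at h1
  rw [hj'.2] at h2
  exact ⟨continuousAt_iff_continuous_left'_right'.2 ⟨h1, h.rotation_right t ht⟩,
    continuousAt_iff_continuous_left'_right'.2 ⟨h2, h.translation_right t ht⟩⟩

lemma tendsto_affine_height {S : Set ℝ} {Q : Mat2} {b x : Plane}
    (hR : Tendsto R (𝓝[S] x 1) (𝓝 Q)) (hψ : Tendsto ψ (𝓝[S] x 1) (𝓝 b)) :
    Tendsto (fun y : Plane => affine (R (y 1)) (ψ (y 1)) y) (𝓝[{y | y 1 ∈ S}] x)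
      (𝓝 (affine Q b x)) := by
  have hcont : Continuous fun z : Mat2 × Plane × Plane => affine z.1 z.2.1 z.2.2 := by
    unfold affine matVec
    have : Continuous fun z : Mat2 × Plane × Plane => z.1 *ᵥ z.2.2.ofLp :=
      continuous_fst.matrix_mulVec (by fun_prop)
    fun_prop
  have hh : Tendsto (fun y : Plane => y 1) (𝓝[{y | y 1 ∈ S}] x) (𝓝[S] x 1) := by
    refine tendsto_nhdsWithin_iff.2 ⟨?_, eventually_nhdsWithin_of_forall fun y hy => hy⟩
    exact ((by fun_prop : Continuous fun y : Plane => y 1).tendsto x).mono_left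
      nhdsWithin_le_nhds
  have h3 : Tendsto (fun y : Plane => y) (𝓝[{y | y 1 ∈ S}] x) (𝓝 x) :=
    tendsto_id.mono_left nhdsWithin_le_nhds
  have h1 : Tendsto (fun y : Plane => R (y 1)) (𝓝[{y | y 1 ∈ S}] x) (𝓝 Q) := hR.comp hh
  have h2 : Tendsto (fun y : Plane => ψ (y 1)) (𝓝[{y | y 1 ∈ S}] x) (𝓝 b) := hψ.comp hh
  have h4 := h1.prodMk_nhds (h2.prodMk_nhds h3)
  have h5 := (hcont.tendsto (Q, b, x)).comp h4
  exact h5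

lemma isClosed_SO2 : IsClosed SO2 := by
  have : SO2 = {R : Mat2 | R 1 1 = R 0 0} ∩ ({R : Mat2 | R 0 1 = -R 1 0} ∩
      {R : Mat2 | R 0 0 ^ 2 + R 1 0 ^ 2 = 1}) := by
    ext R; exact mem_SO2_iff R
  rw [this]
  have hc : ∀ i j, Continuous fun R : Mat2 => R i j := fun i j => by fun_prop
  exact (isClosed_eq (hc 1 1) (hc 0 0)).inter ((isClosed_eq (hc 0 1) (hc 1 0).neg).inter
    (isClosed_eq (((hc 0 0).pow 2).add ((hc 1 0).pow 2)) continuous_const))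

/-- The singular part of the derivative does not charge regions without jumps. -/
lemma IsLayered.singularPart_eq_zero (h : IsLayered Ω u Du R ψ C) (hΩ : IsOpen Ω)
    (hb : Bornology.IsBounded Ω) (hc : CantorPartZero Ω u Du)
    (hlim : HasOneSidedLimits (heightInterval Ω) R L ψ χ) {p q : ℝ}
    (hpq : Disjoint (Ioo p q) (jumpHeights (heightInterval Ω) R L ψ χ)) (i j : Fin 2)
    {B : Set Plane} (hB : MeasurableSet B) (hBΩ : B ⊆ Ω ∩ {x | p < x 1 ∧ x 1 < q}) :
    (Du i j).singularPart volume B = 0 := by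
  -- Away from jump heights `R` and `ψ` are continuous, so `u` has approximate limits there; off
  -- `S_u` the singular part is the Cantor part, which is zero.
  refine hc i j B hB fun x hx => ⟨(hBΩ hx).1, fun hS => hS.2 ?_⟩
  obtain ⟨h1, h2⟩ := hlim.continuousAt (mem_heightInterval hΩ hb (hBΩ hx).1)
    (disjoint_left.1 hpq (hBΩ hx).2)
  refine hasApproxLimit_of_continuousAt hΩ (hBΩ hx).1 h.rep ?_
  have := tendsto_affine_height (x := x) (S := univ) (R := R) (ψ := ψ)
    (by rw [nhdsWithin_univ]; exact h1) (by rw [nhdsWithin_univ]; exact h2)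
  simpa [ContinuousAt] using this

/-- At a jump height, almost the whole slice belongs to the jump set. -/
lemma IsLayered.width_le_hausdorffMeasure (h : IsLayered Ω u Du R ψ C) (hΩ : IsOpen Ω)
    (hlim : HasOneSidedLimits (heightInterval Ω) R L ψ χ) {τ : ℝ}
    (hτ : τ ∈ jumpHeights (heightInterval Ω) R L ψ χ) :
    width Ω τ ≤ Measure.hausdorffMeasure 1 (jumpSet Ω u ∩ {x | x 1 = τ}) := by
  have hL : L τ ∈ SO2 := isClosed_SO2.mem_of_tendsto (hlim.rotation_left τ hτ.1)
    (Eventually.of_forall fun t => h.rotation t)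
  obtain ⟨l1, l2, -⟩ := (mem_SO2_iff _).1 hL
  obtain ⟨r1, r2, -⟩ := (mem_SO2_iff _).1 (h.rotation τ)
  -- Agreement at two points of a horizontal line forces equal first columns, hence equal rotations
  -- and translations, which is excluded at a jump height.
  set bad : Set ℝ := {s | affine (R τ) (ψ τ) !₂[s, τ] = affine (L τ) (χ τ) !₂[s, τ]} with hbad
  have hsub : bad.Subsingleton := by
    intro s hs s' hs'
    by_contra hne
    have e : ∀ σ ∈ bad, ∀ i, R τ i 0 * σ + R τ i 1 * τ + ψ τ i =
        L τ i 0 * σ + L τ i 1 * τ + χ τ i := fun σ hσ i => by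
      have := congrArg (fun z : Plane => z i) (show affine _ _ _ = affine _ _ _ from hσ)
      simpa [affine, matVec_apply] using this
    have hcol : ∀ i, R τ i 0 = L τ i 0 := fun i => by
      have : (R τ i 0 - L τ i 0) * (s - s') = 0 := by
        linear_combination e s hs i - e s' hs' i
      rcases mul_eq_zero.1 this with h0 | h0
      · linarith
      · exact absurd (by linarith) hne
    have hRL : L τ = R τ := by
      have e0 := hcol 0
      have e1 := hcol 1
      ext i j
      fin_cases i <;> fin_cases j <;> simp_all
    have hψ : χ τ = ψ τ := by
      ext i
      have := e s hs i
      rw [hRL] at this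
      linarith
    rcases hτ.2 with h1 | h1
    · exact h1 hRL
    · exact h1 hψ
  have hiso : Isometry fun s : ℝ => (!₂[s, τ] : Plane) := by
    refine Isometry.of_dist_eq fun s s' => ?_
    rw [EuclideanSpace.dist_eq, Fin.sum_univ_two]
    simp [Real.dist_eq, Real.sqrt_sq_eq_abs]
  calc width Ω τ ≤ volume (slice Ω τ \ bad) + volume bad := by
        refine (measure_mono ?_).trans (measure_union_le _ _)
        rw [sdiff_union_self]; exact subset_union_left
    _ = Measure.hausdorffMeasure 1 ((fun s : ℝ => (!₂[s, τ] : Plane)) '' (slice Ω τ \ bad)) := by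
        rw [hsub.measure_zero, add_zero, hiso.hausdorffMeasure_image (.inl zero_le_one),
          hausdorffMeasure_real]
    _ ≤ _ := by
        refine measure_mono ?_
        rintro _ ⟨s, ⟨hs, hsb⟩, rfl⟩
        refine ⟨?_, by simp⟩
        refine mem_jumpSet_of_tendsto hΩ hs h.rep hsb ?_ ?_
        · refine tendsto_affine_height (S := Ioi ((!₂[s, τ] : Plane) 1)) ?_ ?_
          · simpa using hlim.rotation_right τ hτ.1
          · simpa using hlim.translation_right τ hτ.1
        · refine tendsto_affine_height (S := Iio ((!₂[s, τ] : Plane) 1)) ?_ ?_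
          · simpa using hlim.rotation_left τ hτ.1
          · simpa using hlim.translation_left τ hτ.1

lemma exists_box_of_mem_Ioo (hΩ : IsOpen Ω) (hconn : IsConnected Ω) {s t x : ℝ}
    (hs : s ∈ heightInterval Ω) (ht : t ∈ heightInterval Ω) (hx : x ∈ Ioo s t) :
    ∃ l r p q, l < r ∧ x ∈ Ioo p q ∧ Ioo p q ⊆ Ioo s t ∧
      ∀ s' ∈ Ioo l r, ∀ t' ∈ Ioo p q, (!₂[s', t'] : Plane) ∈ Ω := by
  obtain ⟨σ, hσ⟩ := exists_mem_of_mem_heightInterval hconn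
    (ordConnected_Ioo.out hs ht ⟨hx.1.le, hx.2.le⟩)
  obtain ⟨ρ, hρ, hbox⟩ := exists_box hΩ hσ
  refine ⟨σ - ρ, σ + ρ, max s (x - ρ), min t (x + ρ), by linarith,
    ⟨max_lt hx.1 (by linarith), lt_min hx.2 (by linarith)⟩,
    Ioo_subset_Ioo (le_max_left _ _) (min_le_left _ _), fun s' hs' t' ht' => hbox _ _ ?_ ?_⟩
  · rw [abs_lt]; constructor <;> linarith [hs'.1, hs'.2]
  · rw [abs_lt]
    have h1 := (le_max_right s (x - ρ)).trans_lt ht'.1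
    have h2 := ht'.2.trans_le (min_le_right t (x + ρ))
    constructor <;> linarith

/-- On an interval without jumps, the map changes only by a translation in direction `R e₁`. -/
lemma IsLayered.step_of_disjoint (h : IsLayered Ω u Du R ψ C) (hΩ : IsOpen Ω)
    (hconn : IsConnected Ω) (hb : Bornology.IsBounded Ω) (hc : CantorPartZero Ω u Du)
    (hlim : HasOneSidedLimits (heightInterval Ω) R L ψ χ) {s t : ℝ}
    (hs : s ∈ heightInterval Ω) (ht : t ∈ heightInterval Ω) (hst : s < t)
    (hd : Disjoint (Ioc s t) (jumpHeights (heightInterval Ω) R L ψ χ)) :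
    R t = R s ∧ ∃ r : ℝ, ψ t = ψ s + r • col₁ (R s) := by
  have hI : Ioo s t ⊆ heightInterval Ω := fun x hx =>
    ordConnected_Ioo.out hs ht ⟨hx.1.le, hx.2.le⟩
  have hcont : ∀ x ∈ Ioc s t, ContinuousAt R x ∧ ContinuousAt ψ x := fun x hx =>
    hlim.continuousAt (ordConnected_Ioo.out hs ht ⟨hx.1.le, hx.2⟩) (disjoint_left.1 hd hx)
  have hsing : ∀ p q, Ioo p q ⊆ Ioo s t → ∀ i, ∀ B, MeasurableSet B →
      B ⊆ Ω ∩ {x | p < x 1 ∧ x 1 < q} → (Du i 1).singularPart volume B = 0 :=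
    fun p q hpq i B hB hBΩ => h.singularPart_eq_zero hΩ hb hc hlim
      (hd.mono_left (hpq.trans Ioo_subset_Ioc_self)) i 1 hB hBΩ
  have hproj : ∀ i j, Continuous fun Q : Mat2 => Q i j := fun i j => by fun_prop
  have hprojv : ∀ i, Continuous fun z : Plane => z i := fun i => by fun_prop
  -- `Ω` may contain no box over the whole interval, so constancy is proved locally and spread by
  -- connectedness.
  have hRc : ∀ x ∈ Ioo s t, ∀ y ∈ Ioo s t, R x = R y := by
    intro x hx y hy
    refine isPreconnected_Ioo.induction₂ (fun x y => R x = R y) (fun x hx => ?_)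
      (fun _ _ _ _ _ _ => Eq.trans) (fun _ _ _ _ => Eq.symm) hx hy
    obtain ⟨l, r, p, q, hlr, hxpq, hpq, hbox⟩ := exists_box_of_mem_Ioo hΩ hconn hs ht hx
    filter_upwards [mem_nhdsWithin_of_mem_nhds (isOpen_Ioo.mem_nhds hxpq)] with y hy
    exact h.rotation_eq hΩ hb hlr (hxpq.1.trans hxpq.2) hbox (hsing p q hpq)
      (fun i z hz => ((hproj i 0).continuousAt.comp
        (hcont z (Ioo_subset_Ioc_self (hpq hz))).1).continuousWithinAt) hxpq hy
  obtain ⟨x₀, hx₀⟩ := nonempty_Ioo.2 hst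
  have hev : ∀ᶠ x in 𝓝[>] s, x ∈ Ioo s t := Ioo_mem_nhdsGT hst
  have hev' : ∀ᶠ x in 𝓝[<] t, x ∈ Ioo s t := Ioo_mem_nhdsLT hst
  have htt := hcont t (right_mem_Ioc.2 hst)
  -- The lower end `s` may itself be a jump height; right-continuity suffices there, whereas `t` is
  -- a continuity point.
  have hRs : R s = R x₀ := tendsto_nhds_unique (hlim.rotation_right s hs)
    (tendsto_const_nhds.congr' (hev.mono fun x hx => hRc x₀ hx₀ x hx))
  have hRt : R t = R x₀ := tendsto_nhds_unique (htt.1.tendsto.mono_left nhdsWithin_le_nhds)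
    (tendsto_const_nhds.congr' (hev'.mono fun x hx => hRc x₀ hx₀ x hx) :
      Tendsto R (𝓝[<] t) _)
  refine ⟨hRt.trans hRs.symm, ?_⟩
  set Q := R x₀ with hQ
  set n : Plane → ℝ := fun z => Q 0 0 * z 1 - Q 1 0 * z 0 with hn
  have hnc : Continuous n := by rw [hn]; fun_prop
  have hψc : ∀ x ∈ Ioo s t, ∀ y ∈ Ioo s t, n (ψ x) = n (ψ y) := by
    intro x hx y hy
    refine isPreconnected_Ioo.induction₂ (fun x y => n (ψ x) = n (ψ y)) (fun x hx => ?_)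
      (fun _ _ _ _ _ _ => Eq.trans) (fun _ _ _ _ => Eq.symm) hx hy
    obtain ⟨l, r, p, q, hlr, hxpq, hpq, hbox⟩ := exists_box_of_mem_Ioo hΩ hconn hs ht hx
    filter_upwards [mem_nhdsWithin_of_mem_nhds (isOpen_Ioo.mem_nhds hxpq)] with y hy
    exact h.translation_eq hΩ hb hlr (hxpq.1.trans hxpq.2) hbox (hsing p q hpq)
      (fun z hz => hRc z (hpq hz) x₀ hx₀)
      (fun i z hz => ((hprojv i).continuousAt.comp
        (hcont z (Ioo_subset_Ioc_self (hpq hz))).2).continuousWithinAt) hxpq hy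
  have hψs : n (ψ s) = n (ψ x₀) :=
    tendsto_nhds_unique ((hnc.tendsto _).comp (hlim.translation_right s hs))
      (tendsto_const_nhds.congr' (hev.mono fun x hx => hψc x₀ hx₀ x hx))
  have hψt : n (ψ t) = n (ψ x₀) :=
    tendsto_nhds_unique
      ((hnc.tendsto _).comp (htt.2.tendsto.mono_left (nhdsWithin_le_nhds (s := Iio t))))
      (tendsto_const_nhds.congr' (hev'.mono fun x hx => hψc x₀ hx₀ x hx))
  have hψst : n (ψ t) = n (ψ s) := hψt.trans hψs.symm
  simp only [hn] at hψst
  obtain ⟨-, -, q3⟩ := (mem_SO2_iff _).1 (h.rotation x₀)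
  rw [hRs]
  -- The component of `ψ t - ψ s` along `Q e₁`; the orthogonal component vanishes by `hψst`.
  refine ⟨Q 0 0 * (ψ t 0 - ψ s 0) + Q 1 0 * (ψ t 1 - ψ s 1), ?_⟩
  ext i
  rw [PiLp.add_apply, PiLp.smul_apply, smul_eq_mul, col₁_apply]
  fin_cases i
  · show ψ t 0 = ψ s 0 + _ * Q 0 0
    linear_combination -(ψ t 0 - ψ s 0) * q3 - Q 1 0 * hψst
  · show ψ t 1 = ψ s 1 + _ * Q 1 0
    linear_combination -(ψ t 1 - ψ s 1) * q3 + Q 0 0 * hψst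

end Jumps

end LayeredBV
end

open scoped ENNReal

noncomputable section

namespace LayeredBV

/-! ### Right-continuous representatives. -/

section Representatives

lemma real_Iic_sub (ν : Measure ℝ) [IsFiniteMeasure ν] {s t : ℝ} (hst : s ≤ t) :
    ν.real (Iic t) - ν.real (Iic s) = ν.real (Ioc s t) := by
  rw [← measureReal_sdiff (Iic_subset_Iic.2 hst) measurableSet_Iic, Iic_sdiff_Iic]

/-- With right-continuity, this lifts closed conditions that hold almost everywhere to every point
of the interval. -/
lemma ae_restrict_Ioo_frequently_right {a b t : ℝ} {P : ℝ → Prop}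
    (h : ∀ᵐ x ∂volume.restrict (Ioo a b), P x) (ht : t ∈ Ioo a b) : ∃ᶠ x in 𝓝[>] t, P x := by
  intro hn
  obtain ⟨y, hy, hsub⟩ := (mem_nhdsGT_iff_exists_Ioo_subset' ht.2).1 hn
  rw [ae_restrict_iff' measurableSet_Ioo] at h
  have h0 : volume (Ioo t (min y b)) = 0 := by
    refine measure_mono_null (fun x hx => ?_) h
    have hxy := hx.2.trans_le (min_le_left _ _)
    have hxb := hx.2.trans_le (min_le_right _ _)
    exact fun hc => hsub ⟨hx.1, hxy⟩ (hc ⟨ht.1.trans hx.1, hxb⟩)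
  rw [Real.volume_Ioo, ENNReal.ofReal_eq_zero] at h0
  have := lt_min (show t < y from hy) ht.2
  linarith

variable {a b : ℝ}

/-- The matrix-valued function of bounded variation with derivative `μ`, continuous from the
right. -/
def cumulativeMatrix (c : Mat2) (μ : Fin 2 → Fin 2 → SignedMeasure ℝ) (t : ℝ) : Mat2 :=
  Matrix.of fun i j => c i j + μ i j (Iic t)

/-- The vector-valued function of bounded variation with derivative `ν`, continuous from the
right. -/
def cumulativeVector (d : Plane) (ν : Fin 2 → SignedMeasure ℝ) (t : ℝ) : Plane :=
  WithLp.toLp 2 fun i => d i + ν i (Iic t)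

variable (c : Mat2) (μ : Fin 2 → Fin 2 → SignedMeasure ℝ) (d : Plane)
  (ν : Fin 2 → SignedMeasure ℝ)

lemma tendsto_cumulativeMatrix_right (t : ℝ) :
    Tendsto (cumulativeMatrix c μ) (𝓝[>] t) (𝓝 (cumulativeMatrix c μ t)) :=
  tendsto_pi_nhds.2 fun i => tendsto_pi_nhds.2 fun j =>
    (tendsto_cumulative_right (μ i j) t).const_add (c i j)

lemma tendsto_cumulativeMatrix_left (t : ℝ) :
    Tendsto (cumulativeMatrix c μ) (𝓝[<] t)
      (𝓝 (Matrix.of fun i j => c i j + μ i j (Iio t))) :=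
  tendsto_pi_nhds.2 fun i => tendsto_pi_nhds.2 fun j =>
    (tendsto_cumulative_left (μ i j) t).const_add (c i j)

lemma tendsto_toLp {l : Filter ℝ} {f : ℝ → Fin 2 → ℝ} {g : Fin 2 → ℝ}
    (h : ∀ i, Tendsto (fun t => f t i) l (𝓝 (g i))) :
    Tendsto (fun t => (WithLp.toLp 2 (f t) : Plane)) l (𝓝 (WithLp.toLp 2 g)) :=
  ((PiLp.continuous_toLp 2 fun _ : Fin 2 => ℝ).tendsto g).comp (tendsto_pi_nhds.2 h)

lemma tendsto_cumulativeVector_right (t : ℝ) :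
    Tendsto (cumulativeVector d ν) (𝓝[>] t) (𝓝 (cumulativeVector d ν t)) :=
  tendsto_toLp fun i => (tendsto_cumulative_right (ν i) t).const_add (d i)

lemma tendsto_cumulativeVector_left (t : ℝ) :
    Tendsto (cumulativeVector d ν) (𝓝[<] t)
      (𝓝 (WithLp.toLp 2 fun i => d i + ν i (Iio t))) :=
  tendsto_toLp fun i => (tendsto_cumulative_left (ν i) t).const_add (d i)

lemma norm_le_abs_add_abs (x : Plane) : ‖x‖ ≤ |x 0| + |x 1| := by
  refine le_of_sq_le_sq ?_ (by positivity)
  rw [norm_sq_plane, add_sq, sq_abs, sq_abs]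
  have := mul_nonneg (abs_nonneg (x 0)) (abs_nonneg (x 1))
  linarith

lemma norm_cumulativeVector_sub_le {s t : ℝ} (hst : s ≤ t) :
    ‖cumulativeVector d ν t - cumulativeVector d ν s‖ ≤
      ((ν 0).variation + (ν 1).variation).real (Ioc s t) := by
  have h : ∀ i, |(cumulativeVector d ν t - cumulativeVector d ν s) i| ≤
      (ν i).variation.real (Ioc s t) := fun i => by
    rw [← real_Iic_sub _ hst]
    refine le_trans (le_of_eq ?_) (abs_cumulative_sub_le (ν i) hst)
    simp [cumulativeVector]
  rw [measureReal_add_apply]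
  exact (norm_le_abs_add_abs _).trans (add_le_add (h 0) (h 1))

end Representatives

/-! ### The class `𝒜 ∩ SBV_∞`. -/

section SBV

theorem exists_approximation_of_mem_classA {Ω : Set Plane} (hΩ : IsOpen Ω)
    (hconn : IsConnected Ω) (hb : Bornology.IsBounded Ω) (hlip : HasLipschitzBoundary Ω)
    (hx1 : IsX1Connected Ω) {lam : ℝ} (hlam : lam ∈ Ioo (0 : ℝ) 1) {u : Plane → Plane}
    (hu : u ∈ classA Ω) (hu' : u ∈ SBVInfty Ω) :
    ∃ v : ℝ → Plane → Plane, (∀ ε : ℝ, 0 < ε → v ε ∈ admissible Ω lam ε) ∧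
      WeakStarTendstoBV Ω v (𝓝[>] 0) u := by
  obtain ⟨Du, hDu, ⟨R₀, ψ₀, hR₀, hSO, hψ₀, hrep₀⟩, hdet⟩ := hu
  obtain ⟨Du', hDu', hcantor, -, hJ⟩ := hu'
  obtain rfl := hDu.unique hΩ hb hDu'
  have hab := lowerHeight_lt_upperHeight hΩ hconn hb
  choose hRi μ hμ using hR₀
  choose hψi ν hν using hψ₀
  choose c hc using fun i j => IsDistribDeriv.exists_ae_eq_cumulative hab (hRi i j) (hμ i j)
  choose d hd using fun i => IsDistribDeriv.exists_ae_eq_cumulative hab (hψi i) (hν i)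
  set R₁ := cumulativeMatrix (Matrix.of c) μ with hR₁
  set ψ := cumulativeVector (WithLp.toLp 2 d) ν with hψ
  have hR₁ae : ∀ᵐ t ∂volume.restrict (heightInterval Ω), R₀ t = R₁ t := by
    filter_upwards [hc 0 0, hc 0 1, hc 1 0, hc 1 1] with t h1 h2 h3 h4
    ext i j
    fin_cases i <;> fin_cases j <;> simpa [hR₁, cumulativeMatrix]
  have hψae : ∀ᵐ t ∂volume.restrict (heightInterval Ω), ψ₀ t = ψ t := by
    filter_upwards [hd 0, hd 1] with t h1 h2
    ext i
    fin_cases i <;> simpa [hψ, cumulativeVector]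
  have hSO₁ : ∀ t ∈ heightInterval Ω, R₁ t ∈ SO2 := fun t ht => by
    have h1 : ∀ᵐ t ∂volume.restrict (heightInterval Ω), R₁ t ∈ SO2 := by
      filter_upwards [hSO, hR₁ae] with t h1 h2 using h2 ▸ h1
    exact isClosed_SO2.mem_of_frequently_of_tendsto (ae_restrict_Ioo_frequently_right h1 ht)
      (tendsto_cumulativeMatrix_right _ _ t)
  classical
  -- A profile takes rotations at all heights, since blocks outside `Ω` also occur in the chain; the
  -- identity is a default outside the height interval.
  set R : ℝ → Mat2 := fun t => if t ∈ heightInterval Ω then R₁ t else 1 with hR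
  have hRI : ∀ t ∈ heightInterval Ω, R t = R₁ t := fun t ht => if_pos ht
  have hRSO : ∀ t, R t ∈ SO2 := fun t => by
    by_cases ht : t ∈ heightInterval Ω
    · rw [hRI t ht]; exact hSO₁ t ht
    · simp only [hR, if_neg ht]
      rw [mem_SO2_iff]; simp
  have hRev : ∀ t ∈ heightInterval Ω, R₁ =ᶠ[𝓝 t] R := fun t ht => by
    filter_upwards [isOpen_Ioo.mem_nhds ht] with s hs using (hRI s hs).symm
  have hψbd : ∀ t, ∀ i, |ψ t i| ≤ |d i| + (ν i).variation.real univ := fun t i => by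
    show |d i + ν i (Iic t)| ≤ _
    exact (abs_add_le _ _).trans (add_le_add le_rfl (abs_cumulative_le _ _))
  set C : ℝ := (|d 0| + (ν 0).variation.real univ) + (|d 1| + (ν 1).variation.real univ) + 1 with hC
  have hvn : ∀ i, 0 ≤ |d i| + (ν i).variation.real univ := fun i => by positivity
  have hlay : IsLayered Ω u Du R ψ C := by
    refine ⟨hDu, ?_, fun i j => ?_, fun i => ?_, hRSO, ?_, fun t i => ?_, hdet⟩
    · filter_upwards [hrep₀, ae_restrict_height hΩ hb hR₁ae, ae_restrict_height hΩ hb hψae,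
        ae_restrict_mem hΩ.measurableSet] with x h1 h2 h3 hxΩ
      rw [h1, h2, h3, hRI _ (mem_heightInterval hΩ hb hxΩ), affine]
    · have h1 : (fun t => R t i j) = fun t =>
          if t ∈ heightInterval Ω then R₁ t i j else (1 : Mat2) i j := by
        ext t; simp only [hR]; split_ifs <;> rfl
      rw [h1]
      exact Measurable.ite measurableSet_Ioo ((measurable_cumulative (μ i j)).const_add (c i j))
        measurable_const
    · exact (measurable_cumulative (ν i)).const_add (d i)
    · rw [hC]; linarith [hvn 0, hvn 1]
    · refine (hψbd t i).trans ?_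
      fin_cases i
      · show |d 0| + (ν 0).variation.real univ ≤ C
        linarith [hvn 1]
      · show |d 1| + (ν 1).variation.real univ ≤ C
        linarith [hvn 0]
  set L : ℝ → Mat2 := fun t => Matrix.of fun i j => c i j + μ i j (Iio t) with hL
  set χ : ℝ → Plane := fun t => WithLp.toLp 2 fun i => d i + ν i (Iio t) with hχ
  have hlim : HasOneSidedLimits (heightInterval Ω) R L ψ χ := by
    refine ⟨fun t ht => ?_, fun t ht => ?_, fun t ht => tendsto_cumulativeVector_right _ _ t,
      fun t ht => tendsto_cumulativeVector_left _ _ t⟩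
    · rw [hRI t ht]
      exact (tendsto_cumulativeMatrix_right _ _ t).congr'
        ((hRev t ht).filter_mono nhdsWithin_le_nhds)
    · exact (tendsto_cumulativeMatrix_left _ _ t).congr'
        ((hRev t ht).filter_mono nhdsWithin_le_nhds)
  have hmeas : Measurable fun x : Plane => x 1 := by fun_prop
  have : IsFiniteMeasure ((Measure.hausdorffMeasure 1 : Measure Plane).restrict (jumpSet Ω u)) :=
    ⟨by simpa using hJ⟩
  -- The image under `x₂` of length on `J_u`: its atom at a jump height is at least the width of the
  -- slice. It is finite because the jump set has finite length.
  set κ : Measure ℝ :=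
    ((Measure.hausdorffMeasure 1 : Measure Plane).restrict (jumpSet Ω u)).map fun x => x 1 with hκ
  set m : Measure ℝ := ((ν 0).variation + (ν 1).variation) + κ with hm
  have hκτ : ∀ τ ∈ jumpHeights (heightInterval Ω) R L ψ χ, width Ω τ ≤ κ {τ} := fun τ hτ => by
    rw [hκ, Measure.map_apply hmeas (measurableSet_singleton τ),
      Measure.restrict_apply (hmeas (measurableSet_singleton τ)), inter_comm]
    exact hlay.width_le_hausdorffMeasure hΩ hlim hτ
  have hp : IsProfile Ω R ψ (fun t => m.real (Iic t)) (C + m.real univ) := by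
    refine ⟨hRSO, fun t => ?_, fun s t hst => measureReal_mono (Iic_subset_Iic.2 hst), fun t => ?_,
      fun s _ t _ hst => ?_, fun s hs t ht hst => ?_⟩
    · have h1 := norm_le_abs_add_abs (ψ t)
      have h2 : 0 ≤ m.real univ := measureReal_nonneg
      linarith [hψbd t 0, hψbd t 1]
    · have h1 : m.real (Iic t) ≤ m.real univ := measureReal_mono (subset_univ _)
      rw [abs_of_nonneg measureReal_nonneg]
      linarith [hlay.one_le]
    · rw [real_Iic_sub _ hst, hm, measureReal_add_apply]
      exact (norm_cumulativeVector_sub_le _ _ hst).trans (le_add_of_nonneg_right measureReal_nonneg)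
    · by_cases hdj : Disjoint (Ioc s t) (jumpHeights (heightInterval Ω) R L ψ χ)
      · exact .inl (hlay.step_of_disjoint hΩ hconn hb hcantor hlim hs ht hst hdj)
      · obtain ⟨τ, hτ, hτJ⟩ := not_disjoint_iff.1 hdj
        refine .inr ⟨τ, hτ, ?_⟩
        rw [real_Iic_sub _ hst.le, Measure.real, ENNReal.ofReal_toReal (measure_ne_top _ _)]
        calc width Ω τ ≤ κ {τ} := hκτ τ hτJ
          _ ≤ κ (Ioc s t) := measure_mono (singleton_subset_iff.2 hτ)
          _ ≤ m (Ioc s t) := by rw [hm, Measure.add_apply]; exact le_add_self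
  exact hp.exists_approximation hΩ hconn hb hlip hx1 hlam hDu hlay.rep

end SBV

end LayeredBV
end

theorem theorem1p3 (Ω : Set LayeredBV.Plane) (hopen : IsOpen Ω) (hconn : IsConnected Ω)
    (hbdd : Bornology.IsBounded Ω) (hlip : LayeredBV.HasLipschitzBoundary Ω)
    (hx1 : LayeredBV.IsX1Connected Ω)
    (lam : ℝ) (hlam : lam ∈ Set.Ioo (0 : ℝ) 1) (u : LayeredBV.Plane → LayeredBV.Plane)
    (hu : u ∈ (LayeredBV.classA Ω ∩ LayeredBV.SBVInfty Ω) ∪ LayeredBV.classAPar Ω) :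
    ∃ v : ℝ → LayeredBV.Plane → LayeredBV.Plane,
      (∀ ε : ℝ, 0 < ε → v ε ∈ LayeredBV.admissible Ω lam ε) ∧
      LayeredBV.WeakStarTendstoBV Ω v (nhdsWithin (0 : ℝ) (Set.Ioi 0)) u := by
  rcases hu with ⟨hA, hS⟩ | hP
  · exact LayeredBV.exists_approximation_of_mem_classA hopen hconn hbdd hlip hx1 hlam hA hS
  · exact LayeredBV.exists_approximation_of_mem_classAPar hopen hconn hbdd hlip hx1 hlam hP
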